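/- Let $K$ be a field of characteristic $0$, let $\Phi\in K\langle\langle x,y\rangle\rangle$ be a Drinfel'd associator (a group-like series with constant term $1$ satisfying the pentagon equation and the two hexagon equations with $R=\exp(\hbar t/2)$), and let $\mathfrak g,\mathfrak h$ be Lie algebras over $K$ with chosen elements $t_{\mathfrak g}\in(S^2\mathfrak g)^{\mathfrak g}$, $t_{\mathfrak h}\in(S^2\mathfrak h)^{\mathfrak h}$. *Modules.* For a Lie algebra $\mathfrak l$ with $t\in(S^2\mathfrak l)^{\mathfrak l}$ let $U(\mathfrak l)\text{-Mod}^\Phi_\hbar$ be the monoidal category whose objects are the $U(\mathfrak l)$-modules, with $\mathrm{Hom}(X,Y)=\mathrm{Hom}_{U(\mathfrak l)}(X,Y)[[\hbar]]$, with the usual tensor product and unit, and with associativity constraint given by the action of $\Phi(\hbar t^{1,2},\hbar t^{2,3})$. For a finite set $I$ let $\mathfrak g^I=\mathrm{Maps}(I,\mathfrak g)$, and equip $\mathfrak g^I\oplus\mathfrak h$ with $\sum_{i\in I}t_{\mathfrak g}^{(i)}+t_{\mathfrak h}$, where $t_{\mathfrak g}^{(i)}$ is the copy of $t_{\mathfrak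 g}$ in the $i$-th summand. *The source.* $\mathrm{FSet}^{(<)}$ is the strict 2-category whose objects are finite sets; whose 1-morphisms $p:I\to J$ are maps together with, for each $j\in J$, a linear order and a parenthesization of the fibre $p^{-1}(j)$ (fibres may be empty), composed by substituting parenthesized words into each other (lexicographic order; empty words are deleted); and which has exactly one 2-morphism $p\to p'$ if $p,p'$ have the same underlying map and the same orders on fibres, and none otherwise. *The target.* $\mathrm{MonCat}$ is the strict 2-category of monoidal categories, monoidal functors (with invertible coherence maps) and monoidal natural transformations. *Fusion functors.* For $p:I\to J$ let $F^p:U(\mathfrak g^I\oplus\mathfrak h)\text{-Mod}^\Phi_\hbar\to U(\mathfrak g^J\oplus\mathfrak h)\text{-Mod}^\Phi_\hbar$ be the restriction along $p^!\oplus\mathrm{id}$, where $p^!\xi=\xi\circ p$. For $j\in J$ let $T_j$ be the parenthesized word $p^{-1}(j)$, let $T_j^{(a)}T_j^{(b)}$ be the product of two copies of $T_j$ with letters $i^a$ and $i^b$, and let $T_j^{(ab)}$ be $T_j$ with each letter $i$ replaced by $(i^a i^b)$. Let $B_j$ be the parenthesized braid $T_j^{(a)}T_j^{(b)}\to T_j^{(ab)}$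 in which the strands $i^a$ move to the right, passing over the strands $i^b$, which move to the left. Let $K_j\in U(\mathfrak g^I)^{\otimes 2}[[\hbar]]$ be the element of $B_j$: a reparenthesization $(AB)C\to A(BC)$ contributes $\Phi(\hbar t^{A,B},\hbar t^{B,C})$, and a crossing $AB\to BA$ in which $A$ passes over $B$ contributes $\exp(\hbar t^{A,B}/2)$, where $t^{A,B}$ is the sum of the $t_{\mathfrak g}^{s,s'}$ over the strands $s$ of $A$ and $s'$ of $B$; set $K_j=1$ if $p^{-1}(j)=\emptyset$. Put $\nu^p=\prod_{j\in J}K_j$ (the factors commute). **Theorem.** 1. For each 1-morphism $p:I\to J$ of $\mathrm{FSet}^{(<)}$, the functor $F^p$ is a monoidal functor with the identity as unit coherence map and with the action of $\nu^p$ as coherence map $F^p(X)\otimes F^p(Y)\to F^p(X\otimes Y)$. 2. For each 2-morphism $p\to p'$ the words $p^{-1}(j)$ and $p'^{-1}(j)$, $j\in J$, are related by reparenthesizations, i.e. composites of elementary reparenthesizations $(AB)C\leftrightarrow A(BC)$ inside words. For every choice of such composites, let $\Phi^{p,p'}\in U(\mathfrak g^I)[[\hbar]]$ be the product over $j\in J$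 of the corresponding products of $\Phi(\hbar t^{A,B},\hbar t^{B,C})^{\pm1}$. Its action on the modules $X$ does not depend on the choices, and is an invertible monoidal natural transformation $(F^p,\nu^p)\to(F^{p'},\nu^{p'})$. 3. The assignments $I\mapsto U(\mathfrak g^I\oplus\mathfrak h)\text{-Mod}^\Phi_\hbar$, $p\mapsto(F^p,\nu^p)$, $(p\to p')\mapsto\Phi^{p,p'}$ define a strict 2-functor $\mathrm{FSet}^{(<)}\to\mathrm{MonCat}$. -/

import Mathlib

open CategoryTheory
open scoped TensorProduct

universe u v w x

namespace QuantumFusion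

attribute [local instance 100] LieRing.ofAssociativeRing

/-! ### Noncommutative power series and Drinfeld associators -/

section Series

/-- Noncommutative formal power series in two variables `x` (letter `0`) and `y` (letter `1`):
the family of the coefficients of all words. -/
abbrev NCSeries (K : Type u) := List (Fin 2) → K

variable {K : Type u} [Field K] {A : Type v} [Ring A] [Algebra K A]

/-- `Φ(ħ a, ħ b)`, a formal power series in `ħ` with coefficients in the algebra `A`. -/
noncomputable def NCSeries.evalh (Φ : NCSeries K) (a b : A) : PowerSeries A :=
  PowerSeries.mk fun n =>
    ∑ w : Fin n → Fin 2, Φ (List.ofFn w) • (List.ofFn fun k => ![a, b] (w k)).prod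

variable (K) in
/-- `exp(ħ a)`. -/
noncomputable def exph (a : A) : PowerSeries A :=
  PowerSeries.mk fun n => ((n.factorial : K)⁻¹) • a ^ n

/-- The inverse of a formal power series (it is only used for series with constant term `1`). -/
noncomputable def psInv {A : Type v} [Ring A] (P : PowerSeries A) : PowerSeries A := Ring.inverse P

/-- The infinitesimal braid relations between the generators `t i j`. -/
inductive DKRel (K : Type u) [Field K] (n : ℕ) :
    FreeAlgebra K (Fin n × Fin n) → FreeAlgebra K (Fin n × Fin n) → Prop
  | diag (i : Fin n) : DKRel K n (FreeAlgebra.ι K (i, i)) 0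
  | symm (i j : Fin n) : DKRel K n (FreeAlgebra.ι K (i, j)) (FreeAlgebra.ι K (j, i))
  | locality (i j k l : Fin n) (hik : i ≠ k) (hil : i ≠ l) (hjk : j ≠ k) (hjl : j ≠ l) :
      DKRel K n (FreeAlgebra.ι K (i, j) * FreeAlgebra.ι K (k, l))
        (FreeAlgebra.ι K (k, l) * FreeAlgebra.ι K (i, j))
  | fourTerm (i j k : Fin n) (hij : i ≠ j) (hik : i ≠ k) (hjk : j ≠ k) :
      DKRel K n
        (FreeAlgebra.ι K (i, j) * (FreeAlgebra.ι K (i, k) + FreeAlgebra.ι K (j, k)))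
        ((FreeAlgebra.ι K (i, k) + FreeAlgebra.ι K (j, k)) * FreeAlgebra.ι K (i, j))

/-- The enveloping algebra of the Lie algebra of infinitesimal braids on `n` strands. -/
abbrev DK (K : Type u) [Field K] (n : ℕ) := RingQuot (DKRel K n)

/-- The generator `t^{i,j}` (strands are numbered from `0`). -/
noncomputable def DK.t (K : Type u) [Field K] {n : ℕ} (i j : Fin n) : DK K n :=
  RingQuot.mkAlgHom K (DKRel K n) (FreeAlgebra.ι K (i, j))

/-- A Drinfeld associator (with coupling constant `1`): a group-like series which satisfies the
pentagon and the two hexagon equations.  All the arguments are homogeneous of degree one in the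
generators, so an equation in the degree completion of the graded algebra `DK K n` is the same as
the equation in `(DK K n)⟦ħ⟧` obtained by multiplying each generator by `ħ`; the same remark
applies to group-likeness, where `Δ Φ = Φ(x ⊗ 1 + 1 ⊗ x, y ⊗ 1 + 1 ⊗ y)`. -/
structure DrinfeldAssociator (K : Type u) [Field K] where
  series : NCSeries K
  coeff_nil : series [] = 1
  groupLike :
    letI F := FreeAlgebra K (Fin 2)
    letI x : F := FreeAlgebra.ι K 0
    letI y : F := FreeAlgebra.ι K 1
    series.evalh (x ⊗ₜ[K] (1 : F) + (1 : F) ⊗ₜ[K] x) (y ⊗ₜ[K] (1 : F) + (1 : F) ⊗ₜ[K] y) =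
      series.evalh (x ⊗ₜ[K] (1 : F)) (y ⊗ₜ[K] (1 : F)) *
        series.evalh ((1 : F) ⊗ₜ[K] x) ((1 : F) ⊗ₜ[K] y)
  pentagon :
    letI t : Fin 4 → Fin 4 → DK K 4 := DK.t K
    series.evalh (t 0 1) (t 1 2 + t 1 3) * series.evalh (t 0 2 + t 1 2) (t 2 3) =
      series.evalh (t 1 2) (t 2 3) * series.evalh (t 0 1 + t 0 2) (t 1 3 + t 2 3) *
        series.evalh (t 0 1) (t 1 2)
  hexagon :
    letI t : Fin 3 → Fin 3 → DK K 3 := DK.t K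
    exph K ((2 : K)⁻¹ • (t 0 2 + t 1 2)) =
      series.evalh (t 0 2) (t 0 1) * exph K ((2 : K)⁻¹ • t 0 2) *
        psInv (series.evalh (t 0 2) (t 1 2)) * exph K ((2 : K)⁻¹ • t 1 2) *
          series.evalh (t 0 1) (t 1 2)
  hexagon' :
    letI t : Fin 3 → Fin 3 → DK K 3 := DK.t K
    exph K ((2 : K)⁻¹ • (t 0 1 + t 0 2)) =
      psInv (series.evalh (t 1 2) (t 0 2)) * exph K ((2 : K)⁻¹ • t 0 2) *
        series.evalh (t 0 1) (t 0 2) * exph K ((2 : K)⁻¹ • t 0 1) *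
          psInv (series.evalh (t 0 1) (t 1 2))

end Series

/-! ### Lie algebras with an invariant symmetric tensor -/

section Tensor

/-- An element `t` of `(S² L)^L`, as a symmetric tensor invariant under the adjoint action. -/
structure InvTensor (K : Type u) [Field K] (L : Type v) [LieRing L] [LieAlgebra K L] where
  val : L ⊗[K] L
  symm : TensorProduct.comm K L L val = val
  inv : ∀ a : L, ⁅a, val⁆ = 0

variable {K : Type u} [Field K] {L : Type v} [LieRing L] [LieAlgebra K L]
variable {A : Type w} [Ring A] [Algebra K A]

/-- The image of `t = ∑ a ⊗ b` under `a ⊗ b ↦ f a * g b`. -/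
noncomputable def InvTensor.act (t : InvTensor K L) (f g : L →ₗ[K] A) : A :=
  LinearMap.mul' K A (TensorProduct.map f g t.val)

namespace InvTensor

variable (t : InvTensor K L)

lemma act_add_left (f f' g : L →ₗ[K] A) : t.act (f + f') g = t.act f g + t.act f' g := by
  simp [act, TensorProduct.map_add_left]

lemma act_add_right (f g g' : L →ₗ[K] A) : t.act f (g + g') = t.act f g + t.act f g' := by
  simp [act, TensorProduct.map_add_right]

lemma act_zero_left (g : L →ₗ[K] A) : t.act 0 g = 0 := by
  simp [act]

lemma act_zero_right (f : L →ₗ[K] A) : t.act f 0 = 0 := by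
  simp [act]

lemma act_map {B : Type x} [Ring B] [Algebra K B] (φ : A →ₐ[K] B) (f g : L →ₗ[K] A) :
    t.act (φ.toLinearMap ∘ₗ f) (φ.toLinearMap ∘ₗ g) = φ (t.act f g) := by
  unfold act
  induction t.val using TensorProduct.induction_on with
  | zero => simp
  | tmul a b => simp
  | add a b ha hb => simp only [map_add, ha, hb]

lemma act_swap (f g : L →ₗ[K] A) (h : ∀ a b, Commute (f a) (g b)) : t.act f g = t.act g f := by
  have key : ∀ s : L ⊗[K] L, LinearMap.mul' K A (TensorProduct.map f g s) =
      LinearMap.mul' K A (TensorProduct.map g f (TensorProduct.comm K L L s)) := by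
    intro s
    induction s using TensorProduct.induction_on with
    | zero => simp
    | tmul a b => simpa using (h a b).eq
    | add a b ha hb => simp only [map_add, ha, hb]
  unfold act
  rw [key, t.symm]

lemma commute_act {f g : L →ₗ[K] A} {z : A} (hf : ∀ a, Commute z (f a))
    (hg : ∀ a, Commute z (g a)) : Commute z (t.act f g) := by
  unfold act
  induction t.val using TensorProduct.induction_on with
  | zero => simp
  | tmul a b => simpa using (hf a).mul_right (hg b)
  | add a b ha hb => simpa only [map_add] using ha.add_right hb

/-- The element `t^{1,2}` is invariant under the diagonal action. -/
lemma commute_act_add (f g : L →ₗ⁅K⁆ A) (h : ∀ a b, Commute (f a) (g b)) (z : L) :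
    Commute (f z + g z) (t.act (f : L →ₗ[K] A) g) := by
  have key : ∀ s : L ⊗[K] L,
      (f z + g z) * LinearMap.mul' K A (TensorProduct.map (f : L →ₗ[K] A) (g : L →ₗ[K] A) s) -
        LinearMap.mul' K A (TensorProduct.map (f : L →ₗ[K] A) (g : L →ₗ[K] A) s) * (f z + g z) =
      LinearMap.mul' K A (TensorProduct.map (f : L →ₗ[K] A) (g : L →ₗ[K] A) ⁅z, s⁆) := by
    intro s
    induction s using TensorProduct.induction_on with
    | zero => simp
    | tmul a b =>
      have h1 := (h z b).eq
      have h2 := (h a z).eq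
      simp only [TensorProduct.map_tmul, LinearMap.mul'_apply, TensorProduct.LieModule.lie_tmul_right,
        map_add, LieHom.coe_toLinearMap, LieHom.map_lie, LieRing.of_associative_ring_bracket]
      have h3 : g z * (f a * g b) = f a * g z * g b := by rw [← mul_assoc, h2]
      have h4 : f a * g b * f z = f a * f z * g b := by rw [mul_assoc, ← h1, mul_assoc]
      rw [add_mul, mul_add, h3, h4]
      noncomm_ring
    | add a b ha hb =>
      rw [lie_add, map_add, map_add, map_add, map_add, ← ha, ← hb]
      noncomm_ring
  have := key t.val
  rw [t.inv, map_zero, map_zero, sub_eq_zero] at this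
  exact this

end InvTensor

lemma NCSeries.map_evalh (Φ : NCSeries K) {B : Type x} [Ring B] [Algebra K B] (φ : A →ₐ[K] B)
    (a b : A) : PowerSeries.map φ.toRingHom (Φ.evalh a b) = Φ.evalh (φ a) (φ b) := by
  ext n
  have : ∀ i : Fin 2, φ (![a, b] i) = ![φ a, φ b] i := by
    intro i; fin_cases i <;> rfl
  simp [NCSeries.evalh, map_list_prod, List.map_ofFn, Function.comp_def, this]

lemma NCSeries.commute_evalh (Φ : NCSeries K) {a b z : A} (ha : Commute z a) (hb : Commute z b)
    (n : ℕ) : Commute z (PowerSeries.coeff n (Φ.evalh a b)) := by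
  simp only [NCSeries.evalh, PowerSeries.coeff_mk]
  refine Commute.sum_right _ _ _ fun w _ => Commute.smul_right ?_ _
  refine Commute.list_prod_right _ _ fun y hy => ?_
  obtain ⟨k, rfl⟩ := (List.mem_ofFn' _ _).1 hy
  change Commute z (![a, b] (w k))
  generalize w k = i
  fin_cases i
  · exact ha
  · exact hb

lemma NCSeries.coeff_zero_evalh (Φ : NCSeries K) (a b : A) :
    PowerSeries.coeff 0 (Φ.evalh a b) = Φ [] • (1 : A) := by
  simp [NCSeries.evalh]

lemma NCSeries.isUnit_evalh (Φ : NCSeries K) (h : Φ [] = 1) (a b : A) :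
    IsUnit (Φ.evalh a b) := by
  rw [PowerSeries.isUnit_iff_constantCoeff, ← PowerSeries.coeff_zero_eq_constantCoeff_apply,
    Φ.coeff_zero_evalh, h, one_smul]
  exact isUnit_one

lemma commute_C_iff (z : A) (P : PowerSeries A) :
    Commute (PowerSeries.C z) P ↔ ∀ n, Commute z (PowerSeries.coeff n P) := by
  constructor
  · intro h n
    have := congrArg (PowerSeries.coeff n) h.eq
    simpa [Commute, SemiconjBy] using this
  · intro h
    ext n
    simpa using (h n).eq

lemma commute_inverse {M : Type x} [MonoidWithZero M] {z p : M} (h : Commute z p) :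
    Commute z (Ring.inverse p) := by
  by_cases hp : IsUnit p
  · obtain ⟨p, rfl⟩ := hp
    rw [Ring.inverse_unit]
    exact h.units_inv_right
  · rw [Ring.inverse_non_unit _ hp]
    exact Commute.zero_right z

lemma commute_coeff_inverse {z : A} {P : PowerSeries A}
    (h : ∀ n, Commute z (PowerSeries.coeff n P)) (n : ℕ) :
    Commute z (PowerSeries.coeff n (psInv P)) :=
  (commute_C_iff _ _).1 (commute_inverse ((commute_C_iff _ _).2 h)) n

end Tensor

section Strands

variable {K : Type u} [Field K] {L : Type v} [LieRing L] [LieAlgebra K L]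
  {A : Type w} [Ring A] [Algebra K A]

open Classical in
/-- Commuting actions of `L` on `A`, indexed by the strands, yield an action of the enveloping
algebra of the Lie algebra of infinitesimal braids. -/
noncomputable def strandHom (t : InvTensor K L) {n : ℕ} (R : Fin n → (L →ₗ⁅K⁆ A))
    (hR : ∀ i j, i ≠ j → ∀ a b, Commute (R i a) (R j b)) : DK K n →ₐ[K] A :=
  RingQuot.liftAlgHom K ⟨FreeAlgebra.lift K fun p : Fin n × Fin n =>
    if p.1 = p.2 then 0 else t.act (R p.1 : L →ₗ[K] A) (R p.2 : L →ₗ[K] A), by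
    have hc : ∀ i j k l, i ≠ k → i ≠ l → j ≠ k → j ≠ l →
        Commute (t.act (R i : L →ₗ[K] A) (R j : L →ₗ[K] A))
          (t.act (R k : L →ₗ[K] A) (R l : L →ₗ[K] A)) := by
      intro i j k l hik hil hjk hjl
      refine t.commute_act (fun a => ?_) (fun a => ?_)
      · exact (t.commute_act (fun b => hR _ _ hik.symm _ _) (fun b => hR _ _ hjk.symm _ _)).symm
      · exact (t.commute_act (fun b => hR _ _ hil.symm _ _) (fun b => hR _ _ hjl.symm _ _)).symm
    intro x y h
    induction h with
    | diag i => simp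
    | symm i j =>
      by_cases hij : i = j
      · simp [hij]
      · simp only [FreeAlgebra.lift_ι_apply, hij, Ne.symm hij, if_false]
        exact t.act_swap _ _ (hR i j hij)
    | locality i j k l hik hil hjk hjl =>
      simp only [map_mul, FreeAlgebra.lift_ι_apply]
      by_cases hij : i = j
      · simp [hij]
      by_cases hkl : k = l
      · simp [hkl]
      simp only [hij, hkl, if_false]
      exact hc i j k l hik hil hjk hjl
    | fourTerm i j k hij hik hjk =>
      simp only [map_mul, map_add, FreeAlgebra.lift_ι_apply, hij, hik, hjk, if_false]
      rw [← t.act_add_left]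
      refine (t.commute_act (fun a => ?_) (fun a => ?_)).eq
      · exact (t.commute_act_add _ _ (hR i j hij) a).symm
      · exact (t.commute_act (fun b => hR _ _ hik.symm _ _) (fun b => hR _ _ hjk.symm _ _)).symm⟩

lemma strandHom_t (t : InvTensor K L) {n : ℕ} (R : Fin n → (L →ₗ⁅K⁆ A))
    (hR : ∀ i j, i ≠ j → ∀ a b, Commute (R i a) (R j b)) {i j : Fin n} (hij : i ≠ j) :
    strandHom t R hR (DK.t K i j) = t.act (R i : L →ₗ[K] A) (R j : L →ₗ[K] A) := by
  simp [strandHom, DK.t, hij]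

/-- The pentagon equation for four commuting actions. -/
lemma pentagon_act (t : InvTensor K L) (Φ : DrinfeldAssociator K) (R₀ R₁ R₂ R₃ : L →ₗ⁅K⁆ A)
    (h01 : ∀ a b, Commute (R₀ a) (R₁ b)) (h02 : ∀ a b, Commute (R₀ a) (R₂ b))
    (h03 : ∀ a b, Commute (R₀ a) (R₃ b)) (h12 : ∀ a b, Commute (R₁ a) (R₂ b))
    (h13 : ∀ a b, Commute (R₁ a) (R₃ b)) (h23 : ∀ a b, Commute (R₂ a) (R₃ b)) :
    letI τ : (L →ₗ⁅K⁆ A) → (L →ₗ⁅K⁆ A) → A := fun f g => t.act (f : L →ₗ[K] A) (g : L →ₗ[K] A)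
    Φ.series.evalh (τ R₀ R₁) (τ R₁ R₂ + τ R₁ R₃) * Φ.series.evalh (τ R₀ R₂ + τ R₁ R₂) (τ R₂ R₃) =
      Φ.series.evalh (τ R₁ R₂) (τ R₂ R₃) * Φ.series.evalh (τ R₀ R₁ + τ R₀ R₂) (τ R₁ R₃ + τ R₂ R₃) *
        Φ.series.evalh (τ R₀ R₁) (τ R₁ R₂) := by
  have hR : ∀ i j : Fin 4, i ≠ j → ∀ a b, Commute (![R₀, R₁, R₂, R₃] i a)
      (![R₀, R₁, R₂, R₃] j b) := by
    intro i j hij a b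
    fin_cases i <;> fin_cases j <;> first | exact absurd rfl hij | skip
    · exact h01 a b
    · exact h02 a b
    · exact h03 a b
    · exact (h01 b a).symm
    · exact h12 a b
    · exact h13 a b
    · exact (h02 b a).symm
    · exact (h12 b a).symm
    · exact h23 a b
    · exact (h03 b a).symm
    · exact (h13 b a).symm
    · exact (h23 b a).symm
  have key := congrArg (PowerSeries.map (strandHom t _ hR).toRingHom) Φ.pentagon
  simp only [map_mul, NCSeries.map_evalh, map_add] at key
  have e01 := strandHom_t t _ hR (i := 0) (j := 1) (by decide)
  have e02 := strandHom_t t _ hR (i := 0) (j := 2) (by decide)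
  have e12 := strandHom_t t _ hR (i := 1) (j := 2) (by decide)
  have e13 := strandHom_t t _ hR (i := 1) (j := 3) (by decide)
  have e23 := strandHom_t t _ hR (i := 2) (j := 3) (by decide)
  rw [e01, e02, e12, e13, e23] at key
  exact key

end Strands

/-! ### Formal power series of morphisms in a linear category -/

section Conv

open Finset.HasAntidiagonal

variable {M : Type w} [Category.{x} M] [Preadditive M] {V₁ V₂ V₃ V₄ : M}

/-- The `ħ`-bilinear composition of formal power series of morphisms (`f` is applied first). -/
def conv (f : ℕ → (V₁ ⟶ V₂)) (g : ℕ → (V₂ ⟶ V₃)) : ℕ → (V₁ ⟶ V₃) :=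
  fun n => ∑ p ∈ antidiagonal n, f p.1 ≫ g p.2

/-- The constant formal power series. -/
def cst (e : V₁ ⟶ V₂) : ℕ → (V₁ ⟶ V₂) := fun n => if n = 0 then e else 0

lemma conv_assoc (f : ℕ → (V₁ ⟶ V₂)) (g : ℕ → (V₂ ⟶ V₃)) (h : ℕ → (V₃ ⟶ V₄)) :
    conv (conv f g) h = conv f (conv g h) := by
  funext n
  simp only [conv, Preadditive.sum_comp, Preadditive.comp_sum]
  rw [Finset.sum_sigma', Finset.sum_sigma']
  refine Finset.sum_nbij' (fun a => ⟨(a.2.1, a.2.2 + a.1.2), (a.2.2, a.1.2)⟩)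
    (fun a => ⟨(a.1.1 + a.2.1, a.2.2), (a.1.1, a.2.1)⟩) ?_ ?_ ?_ ?_ ?_ <;>
  simp only [Finset.mem_sigma, mem_antidiagonal] <;>
  rintro ⟨⟨a, b⟩, c, d⟩ h <;> grind

lemma conv_cst_left (e : V₁ ⟶ V₂) (f : ℕ → (V₂ ⟶ V₃)) :
    conv (cst e) f = fun n => e ≫ f n := by
  funext n
  simp only [conv, cst]
  rw [Finset.sum_eq_single (0, n)]
  · simp
  · rintro ⟨a, b⟩ h h'
    have : a ≠ 0 := by rintro rfl; simp_all
    simp [this]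
  · simp

lemma conv_cst_right (f : ℕ → (V₁ ⟶ V₂)) (e : V₂ ⟶ V₃) :
    conv f (cst e) = fun n => f n ≫ e := by
  funext n
  simp only [conv, cst]
  rw [Finset.sum_eq_single (n, 0)]
  · simp
  · rintro ⟨a, b⟩ h h'
    have : b ≠ 0 := by rintro rfl; simp_all
    simp [this]
  · simp

lemma conv_swap (f : ℕ → (V₁ ⟶ V₂)) (g : ℕ → (V₂ ⟶ V₄)) (f' : ℕ → (V₁ ⟶ V₃))
    (g' : ℕ → (V₃ ⟶ V₄)) (h : ∀ i j, f i ≫ g j = f' j ≫ g' i) : conv f g = conv f' g' := by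
  funext n
  simp only [conv]
  rw [← Finset.Nat.sum_antidiagonal_swap]
  exact Finset.sum_congr rfl fun p _ => h _ _

/-- The coefficients of a formal power series of endomorphisms. -/
noncomputable def endCoeff (P : PowerSeries (End V₁)) : ℕ → (V₁ ⟶ V₁) :=
  fun n => (PowerSeries.coeff (R := End V₁) n P).asHom

lemma conv_coeff (P Q : PowerSeries (End V₁)) :
    conv (endCoeff P) (endCoeff Q) = endCoeff (Q * P) := by
  funext n
  rw [endCoeff, PowerSeries.coeff_mul, conv, ← Finset.Nat.sum_antidiagonal_swap]
  rfl

lemma endCoeff_one : endCoeff (1 : PowerSeries (End V₁)) = cst (𝟙 V₁) := by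
  funext n
  rw [endCoeff, PowerSeries.coeff_one]
  rfl

lemma conv_push {c : ℕ → (V₂ ⟶ V₃)} {e : V₁ ⟶ V₂} {e' : V₁ ⟶ V₃}
    {P Q : PowerSeries (End V₁)} (h : ∀ n, e ≫ c n = endCoeff Q n ≫ e') :
    conv (fun n => endCoeff P n ≫ e) c = fun n => endCoeff (Q * P) n ≫ e' := by
  rw [← conv_cst_right, conv_assoc, conv_cst_left]
  have : (fun n => e ≫ c n) = conv (endCoeff Q) (cst e') := by
    rw [conv_cst_right]
    funext n
    exact h n
  rw [this, ← conv_assoc, conv_coeff, conv_cst_right]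

variable {K : Type u} [Field K] [Linear K M]

lemma InvTensor.act_comp {L : Type v} [LieRing L] [LieAlgebra K L] (t : InvTensor K L)
    {f g : L →ₗ[K] End V₁} {f' g' : L →ₗ[K] End V₂} {e : V₁ ⟶ V₂}
    (hf : ∀ a, e ≫ (f' a).asHom = (f a).asHom ≫ e)
    (hg : ∀ a, e ≫ (g' a).asHom = (g a).asHom ≫ e) :
    e ≫ (t.act f' g').asHom = (t.act f g).asHom ≫ e := by
  unfold InvTensor.act
  induction t.val using TensorProduct.induction_on with
  | zero => simp
  | tmul a b =>
    simp only [TensorProduct.map_tmul, LinearMap.mul'_apply, End.mul_def]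
    rw [← Category.assoc, hg, Category.assoc, hf, Category.assoc]
  | add a b ha hb =>
    simp only [map_add]
    exact (Preadditive.comp_add _ _ _ _ _ _).trans
      ((congrArg₂ (· + ·) ha hb).trans (Preadditive.add_comp _ _ _ _ _ _).symm)

lemma NCSeries.evalh_comp (Φ : NCSeries K) {a b : End V₁} {a' b' : End V₂}
    {e : V₁ ⟶ V₂} (ha : e ≫ a'.asHom = a.asHom ≫ e)
    (hb : e ≫ b'.asHom = b.asHom ≫ e) (n : ℕ) :
    e ≫ endCoeff (Φ.evalh a' b') n = endCoeff (Φ.evalh a b) n ≫ e := by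
  have key : ∀ l : List (Fin 2), e ≫ End.asHom (l.map ![a', b']).prod =
      End.asHom (l.map ![a, b]).prod ≫ e := by
    intro l
    induction l with
    | nil => simp [End.one_def]
    | cons i l ih =>
      simp only [List.map_cons, List.prod_cons, End.mul_def]
      rw [← Category.assoc, ih, Category.assoc, Category.assoc]
      congr 1
      fin_cases i
      · exact ha
      · exact hb
  simp only [endCoeff, NCSeries.evalh, PowerSeries.coeff_mk]
  refine (Preadditive.comp_sum _ _ _).trans (Eq.trans ?_ (Preadditive.sum_comp _ _ _).symm)
  refine Finset.sum_congr rfl fun w _ => ?_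
  refine (Linear.comp_smul _ _ _ _ _ _).trans (Eq.trans ?_ (Linear.smul_comp _ _ _ _ _ _).symm)
  congr 1
  have := key (List.ofFn w)
  simpa [List.map_ofFn, Function.comp_def] using this

end Conv

/-! ### Tensor products of representations -/

set_option linter.unusedSectionVars false

section Reps

open MonoidalCategory

variable {K : Type u} [Field K] {M : Type w} [Category.{x} M] [Preadditive M] [Linear K M]
  [MonoidalCategory M] [MonoidalPreadditive M] [MonoidalLinear K M]

variable (K) in
/-- `f ↦ f ⊗ id`. -/
def rAlg (V W : M) : End V →ₐ[K] End (V ⊗ W) where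
  toFun f := End.of (f.asHom ▷ W)
  map_one' := id_whiskerRight _ _
  map_mul' f g := comp_whiskerRight _ _ _
  map_zero' := MonoidalPreadditive.zero_whiskerRight
  map_add' f g := MonoidalPreadditive.add_whiskerRight _ _
  commutes' c := by
    rw [Algebra.algebraMap_eq_smul_one, Algebra.algebraMap_eq_smul_one]
    exact (MonoidalLinear.smul_whiskerRight c _ _).trans (by rw [End.one_def, id_whiskerRight]; rfl)

variable (K) in
/-- `f ↦ id ⊗ f`. -/
def lAlg (V W : M) : End W →ₐ[K] End (V ⊗ W) where
  toFun f := End.of (V ◁ f.asHom)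
  map_one' := whiskerLeft_id _ _
  map_mul' f g := whiskerLeft_comp _ _ _
  map_zero' := MonoidalPreadditive.whiskerLeft_zero
  map_add' f g := MonoidalPreadditive.whiskerLeft_add _ _
  commutes' c := by
    rw [Algebra.algebraMap_eq_smul_one, Algebra.algebraMap_eq_smul_one]
    exact (MonoidalLinear.whiskerLeft_smul _ c _).trans (by rw [End.one_def, whiskerLeft_id]; rfl)

lemma rAlg_apply (V W : M) (f : End V) : (rAlg K V W f).asHom = f.asHom ▷ W := rfl

lemma lAlg_apply (V W : M) (f : End W) : (lAlg K V W f).asHom = V ◁ f.asHom := rfl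

lemma commute_rAlg_lAlg {V W : M} (f : End V) (g : End W) :
    Commute (rAlg K V W f) (lAlg K V W g) := whisker_exchange f.asHom g.asHom

variable {L : Type v} [LieRing L] [LieAlgebra K L] {V W X Y : M}

/-- The action on the left factor of a tensor product. -/
def repL (ρ : L →ₗ⁅K⁆ End V) (W : M) : L →ₗ⁅K⁆ End (V ⊗ W) :=
  (rAlg K V W : End V →ₗ⁅K⁆ End (V ⊗ W)).comp ρ

/-- The action on the right factor of a tensor product. -/
def repR (V : M) (ρ : L →ₗ⁅K⁆ End W) : L →ₗ⁅K⁆ End (V ⊗ W) :=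
  (lAlg K V W : End W →ₗ⁅K⁆ End (V ⊗ W)).comp ρ

lemma repL_apply (ρ : L →ₗ⁅K⁆ End V) (a : L) : (repL ρ W a).asHom = (ρ a).asHom ▷ W := rfl

lemma repR_apply (ρ : L →ₗ⁅K⁆ End W) (a : L) : (repR V ρ a).asHom = V ◁ (ρ a).asHom := rfl

lemma commute_repL_repR (ρ : L →ₗ⁅K⁆ End V) (σ : L →ₗ⁅K⁆ End W) (a b : L) :
    Commute (repL ρ W a) (repR V σ b) := commute_rAlg_lAlg (K := K) _ _

lemma commute_repL_repL {ρ σ : L →ₗ⁅K⁆ End V} {a b : L} (h : Commute (ρ a) (σ b)) :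
    Commute (repL ρ W a) (repL σ W b) := h.map (rAlg K V W)

/-- The tensor product of two representations: `a` acts as `a ⊗ 1 + 1 ⊗ a`. -/
def tensorRep (ρ : L →ₗ⁅K⁆ End V) (σ : L →ₗ⁅K⁆ End W) : L →ₗ⁅K⁆ End (V ⊗ W) :=
  { toLinearMap := (repL ρ W : L →ₗ[K] End (V ⊗ W)) + (repR V σ : L →ₗ[K] End (V ⊗ W))
    map_lie' := by
      intro a b
      have h1 := (commute_repL_repR ρ σ a b).eq
      have h2 := (commute_repL_repR ρ σ b a).eq
      simp only [AddHom.toFun_eq_coe, LinearMap.coe_toAddHom, LinearMap.add_apply,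
        LieHom.coe_toLinearMap, LieHom.map_lie, LieRing.of_associative_ring_bracket]
      simp only [mul_add, add_mul, h1, h2]
      abel }

lemma tensorRep_apply (ρ : L →ₗ⁅K⁆ End V) (σ : L →ₗ⁅K⁆ End W) (a : L) :
    tensorRep ρ σ a = repL ρ W a + repR V σ a := rfl

lemma tensorRep_asHom (ρ : L →ₗ⁅K⁆ End V) (σ : L →ₗ⁅K⁆ End W) (a : L) :
    (tensorRep ρ σ a).asHom = (ρ a).asHom ▷ W + V ◁ (σ a).asHom := rfl

lemma whiskerRight_equivariant {f : V ⟶ X} {r : End V} {r' : End X}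
    (s : End W) (h : r.asHom ≫ f = f ≫ r'.asHom) :
    (r.asHom ▷ W + V ◁ s.asHom) ≫ f ▷ W = f ▷ W ≫ (r'.asHom ▷ W + X ◁ s.asHom) := by
  rw [Preadditive.add_comp, Preadditive.comp_add, ← comp_whiskerRight, h, comp_whiskerRight,
    whisker_exchange]

lemma whiskerLeft_equivariant {f : W ⟶ X} {s : End W} {s' : End X}
    (r : End V) (h : s.asHom ≫ f = f ≫ s'.asHom) :
    (r.asHom ▷ W + V ◁ s.asHom) ≫ V ◁ f = V ◁ f ≫ (r.asHom ▷ X + V ◁ s'.asHom) := by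
  rw [Preadditive.add_comp, Preadditive.comp_add, ← whiskerLeft_comp, h, whiskerLeft_comp,
    whisker_exchange]

lemma InvTensor.act_repL (t : InvTensor K L) (f g : L →ₗ⁅K⁆ End V) :
    t.act (repL f W : L →ₗ[K] End (V ⊗ W)) (repL g W : L →ₗ[K] End (V ⊗ W)) =
      rAlg K V W (t.act (f : L →ₗ[K] End V) (g : L →ₗ[K] End V)) :=
  t.act_map (rAlg K V W) (f : L →ₗ[K] End V) (g : L →ₗ[K] End V)

lemma InvTensor.act_repR (t : InvTensor K L) (f g : L →ₗ⁅K⁆ End W) :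
    t.act (repR V f : L →ₗ[K] End (V ⊗ W)) (repR V g : L →ₗ[K] End (V ⊗ W)) =
      lAlg K V W (t.act (f : L →ₗ[K] End W) (g : L →ₗ[K] End W)) :=
  t.act_map (lAlg K V W) (f : L →ₗ[K] End W) (g : L →ₗ[K] End W)

lemma NCSeries.evalh_whiskerRight (Φ : NCSeries K) (a b : End V) (n : ℕ) :
    endCoeff (Φ.evalh a b) n ▷ W = endCoeff (Φ.evalh (rAlg K V W a) (rAlg K V W b)) n := by
  have := congrArg (PowerSeries.coeff n) (Φ.map_evalh (rAlg K V W) a b)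
  rw [PowerSeries.coeff_map] at this
  exact this

lemma NCSeries.evalh_whiskerLeft (Φ : NCSeries K) (a b : End W) (n : ℕ) :
    V ◁ endCoeff (Φ.evalh a b) n = endCoeff (Φ.evalh (lAlg K V W a) (lAlg K V W b)) n := by
  have := congrArg (PowerSeries.coeff n) (Φ.map_evalh (lAlg K V W) a b)
  rw [PowerSeries.coeff_map] at this
  exact this

section Three

/-- The action on the first factor of `(V ⊗ W) ⊗ X`. -/
def rep₁ (ρ : L →ₗ⁅K⁆ End V) (W X : M) : L →ₗ⁅K⁆ End ((V ⊗ W) ⊗ X) := repL (repL ρ W) X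

/-- The action on the second factor of `(V ⊗ W) ⊗ X`. -/
def rep₂ (V : M) (σ : L →ₗ⁅K⁆ End W) (X : M) : L →ₗ⁅K⁆ End ((V ⊗ W) ⊗ X) := repL (repR V σ) X

/-- The action on the third factor of `(V ⊗ W) ⊗ X`. -/
def rep₃ (V W : M) (τ : L →ₗ⁅K⁆ End X) : L →ₗ⁅K⁆ End ((V ⊗ W) ⊗ X) := repR (V ⊗ W) τ

variable (ρ : L →ₗ⁅K⁆ End V) (σ : L →ₗ⁅K⁆ End W) (τ : L →ₗ⁅K⁆ End X) (υ : L →ₗ⁅K⁆ End Y)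

lemma commute_rep₁_rep₂ (a b : L) : Commute (rep₁ ρ W X a) (rep₂ V σ X b) :=
  commute_repL_repL (commute_repL_repR _ _ _ _)

lemma commute_rep₁_rep₃ (a b : L) : Commute (rep₁ ρ W X a) (rep₃ V W τ b) :=
  commute_repL_repR _ _ _ _

lemma commute_rep₂_rep₃ (a b : L) : Commute (rep₂ V σ X a) (rep₃ V W τ b) :=
  commute_repL_repR _ _ _ _

variable (t : InvTensor K L) (Φ : DrinfeldAssociator K)

/-- The action of `Φ(ħ t^{1,2}, ħ t^{2,3})` on `(V ⊗ W) ⊗ X`. -/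
noncomputable def assocSeries : PowerSeries (End ((V ⊗ W) ⊗ X)) :=
  Φ.series.evalh
    (t.act (rep₁ ρ W X : L →ₗ[K] End ((V ⊗ W) ⊗ X)) (rep₂ V σ X : L →ₗ[K] End ((V ⊗ W) ⊗ X)))
    (t.act (rep₂ V σ X : L →ₗ[K] End ((V ⊗ W) ⊗ X)) (rep₃ V W τ : L →ₗ[K] End ((V ⊗ W) ⊗ X)))

lemma isUnit_assocSeries : IsUnit (assocSeries ρ σ τ t Φ) :=
  Φ.series.isUnit_evalh Φ.coeff_nil _ _

lemma commute_assocSeries (a : L) (n : ℕ) :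
    Commute (tensorRep (tensorRep ρ σ) τ a)
      (PowerSeries.coeff (R := End ((V ⊗ W) ⊗ X)) n (assocSeries ρ σ τ t Φ)) := by
  have h : tensorRep (tensorRep ρ σ) τ a = rep₁ ρ W X a + rep₂ V σ X a + rep₃ V W τ a := by
    change rAlg K _ _ (repL ρ W a + repR V σ a) + repR (V ⊗ W) τ a = _
    rw [map_add]
    rfl
  rw [h]
  refine Φ.series.commute_evalh ?_ ?_ n
  · exact (t.commute_act_add _ _ (commute_rep₁_rep₂ ρ σ) a).add_left
      (t.commute_act (fun b => (commute_rep₁_rep₃ ρ τ b a).symm)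
        (fun b => (commute_rep₂_rep₃ σ τ b a).symm))
  · rw [add_assoc]
    exact (t.commute_act (fun b => commute_rep₁_rep₂ ρ σ a b)
        (fun b => commute_rep₁_rep₃ ρ τ a b)).add_left
      (t.commute_act_add _ _ (commute_rep₂_rep₃ σ τ) a)

lemma assocSeries_equivariant (a : L) (n : ℕ) :
    (tensorRep (tensorRep ρ σ) τ a).asHom ≫ endCoeff (assocSeries ρ σ τ t Φ) n =
      endCoeff (assocSeries ρ σ τ t Φ) n ≫ (tensorRep (tensorRep ρ σ) τ a).asHom :=
  (commute_assocSeries ρ σ τ t Φ a n).symm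

lemma assocSeries_inv_equivariant (a : L) (n : ℕ) :
    (tensorRep (tensorRep ρ σ) τ a).asHom ≫ endCoeff (psInv (assocSeries ρ σ τ t Φ)) n =
      endCoeff (psInv (assocSeries ρ σ τ t Φ)) n ≫ (tensorRep (tensorRep ρ σ) τ a).asHom :=
  (commute_coeff_inverse (commute_assocSeries ρ σ τ t Φ a) n).symm

lemma assoc_equivariant (a : L) :
    (tensorRep (tensorRep ρ σ) τ a).asHom ≫ (α_ V W X).hom =
      (α_ V W X).hom ≫ (tensorRep ρ (tensorRep σ τ) a).asHom := by
  simp only [tensorRep_asHom, MonoidalPreadditive.add_whiskerRight,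
    MonoidalPreadditive.whiskerLeft_add, Preadditive.add_comp, Preadditive.comp_add, add_assoc]
  simp

/-- The associativity constraint: the action of `Φ(ħ t^{1,2}, ħ t^{2,3})` followed by the usual
identification `(V ⊗ W) ⊗ X ≅ V ⊗ (W ⊗ X)`. -/
noncomputable def assocCoeff (n : ℕ) : (V ⊗ W) ⊗ X ⟶ V ⊗ (W ⊗ X) :=
  endCoeff (assocSeries ρ σ τ t Φ) n ≫ (α_ V W X).hom

/-- The inverse of the associativity constraint. -/
noncomputable def assocInvCoeff (n : ℕ) : V ⊗ (W ⊗ X) ⟶ (V ⊗ W) ⊗ X :=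
  (α_ V W X).inv ≫ endCoeff (psInv (assocSeries ρ σ τ t Φ)) n

lemma assocCoeff_eq : assocCoeff ρ σ τ t Φ =
    conv (endCoeff (assocSeries ρ σ τ t Φ)) (cst (α_ V W X).hom) := (conv_cst_right _ _).symm

lemma assocInvCoeff_eq : assocInvCoeff ρ σ τ t Φ =
    conv (cst (α_ V W X).inv) (endCoeff (psInv (assocSeries ρ σ τ t Φ))) :=
  (conv_cst_left _ _).symm

lemma assoc_hom_inv :
    conv (assocCoeff ρ σ τ t Φ) (assocInvCoeff ρ σ τ t Φ) = cst (𝟙 ((V ⊗ W) ⊗ X)) := by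
  rw [assocCoeff_eq, assocInvCoeff_eq, conv_assoc, ← conv_assoc (cst _) (cst _)]
  have : conv (cst (α_ V W X).hom) (cst (α_ V W X).inv) = cst (𝟙 ((V ⊗ W) ⊗ X)) := by
    rw [conv_cst_left]
    funext n
    simp only [cst]
    split_ifs <;> simp
  rw [this, conv_cst_left]
  simp only [Category.id_comp]
  change conv _ (endCoeff _) = _
  rw [conv_coeff, psInv, Ring.inverse_mul_cancel _ (isUnit_assocSeries ρ σ τ t Φ), endCoeff_one]

lemma assoc_inv_hom :
    conv (assocInvCoeff ρ σ τ t Φ) (assocCoeff ρ σ τ t Φ) = cst (𝟙 (V ⊗ (W ⊗ X))) := by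
  rw [assocCoeff_eq, assocInvCoeff_eq, conv_assoc, ← conv_assoc (endCoeff _) (endCoeff _),
    conv_coeff, psInv, Ring.mul_inverse_cancel _ (isUnit_assocSeries ρ σ τ t Φ), endCoeff_one,
    conv_cst_left, conv_cst_left]
  funext n
  simp only [cst]
  split_ifs <;> simp

lemma assocCoeff_equivariant (n : ℕ) (a : L) :
    (tensorRep (tensorRep ρ σ) τ a).asHom ≫ assocCoeff ρ σ τ t Φ n =
      assocCoeff ρ σ τ t Φ n ≫ (tensorRep ρ (tensorRep σ τ) a).asHom := by
  rw [assocCoeff, ← Category.assoc, assocSeries_equivariant, Category.assoc, assoc_equivariant,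
    Category.assoc]

lemma assocInvCoeff_equivariant (n : ℕ) (a : L) :
    (tensorRep ρ (tensorRep σ τ) a).asHom ≫ assocInvCoeff ρ σ τ t Φ n =
      assocInvCoeff ρ σ τ t Φ n ≫ (tensorRep (tensorRep ρ σ) τ a).asHom := by
  have h : (tensorRep ρ (tensorRep σ τ) a).asHom ≫ (α_ V W X).inv =
      (α_ V W X).inv ≫ (tensorRep (tensorRep ρ σ) τ a).asHom := by
    rw [Iso.eq_inv_comp, ← Category.assoc, ← assoc_equivariant, Category.assoc, Iso.hom_inv_id,
      Category.comp_id]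
  rw [assocInvCoeff, ← Category.assoc, h, Category.assoc, assocSeries_inv_equivariant,
    Category.assoc]

section Naturality

variable {V' W' X' : M} {ρ' : L →ₗ⁅K⁆ End V'} {σ' : L →ₗ⁅K⁆ End W'} {τ' : L →ₗ⁅K⁆ End X'}

lemma assocSeries_comp {e : (V ⊗ W) ⊗ X ⟶ (V' ⊗ W') ⊗ X'}
    (h₁ : ∀ a, e ≫ (rep₁ ρ' W' X' a).asHom = (rep₁ ρ W X a).asHom ≫ e)
    (h₂ : ∀ a, e ≫ (rep₂ V' σ' X' a).asHom = (rep₂ V σ X a).asHom ≫ e)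
    (h₃ : ∀ a, e ≫ (rep₃ V' W' τ' a).asHom = (rep₃ V W τ a).asHom ≫ e) (n : ℕ) :
    e ≫ endCoeff (assocSeries ρ' σ' τ' t Φ) n = endCoeff (assocSeries ρ σ τ t Φ) n ≫ e :=
  Φ.series.evalh_comp (t.act_comp h₁ h₂) (t.act_comp h₂ h₃) n

lemma assocCoeff_natural {f : V ⟶ V'} {g : W ⟶ W'} {h : X ⟶ X'}
    (hf : ∀ a, (ρ a).asHom ≫ f = f ≫ (ρ' a).asHom)
    (hg : ∀ a, (σ a).asHom ≫ g = g ≫ (σ' a).asHom)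
    (hh : ∀ a, (τ a).asHom ≫ h = h ≫ (τ' a).asHom) (n : ℕ) :
    ((f ⊗ₘ g) ⊗ₘ h) ≫ assocCoeff ρ' σ' τ' t Φ n =
      assocCoeff ρ σ τ t Φ n ≫ (f ⊗ₘ (g ⊗ₘ h)) := by
  rw [assocCoeff, assocCoeff, ← Category.assoc, assocSeries_comp ρ σ τ t Φ (ρ' := ρ') (σ' := σ')
    (τ' := τ'), Category.assoc, Category.assoc, associator_naturality]
  · intro a
    change _ ≫ (((ρ' a).asHom ▷ W') ▷ X') = (((ρ a).asHom ▷ W) ▷ X) ≫ _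
    simp only [← tensorHom_id, tensorHom_comp_tensorHom, hf, Category.id_comp, Category.comp_id]
  · intro a
    change _ ≫ ((V' ◁ (σ' a).asHom) ▷ X') = ((V ◁ (σ a).asHom) ▷ X) ≫ _
    simp only [← tensorHom_id, ← id_tensorHom, tensorHom_comp_tensorHom, hg, Category.id_comp,
      Category.comp_id]
  · intro a
    change _ ≫ ((V' ⊗ W') ◁ (τ' a).asHom) = ((V ⊗ W) ◁ (τ a).asHom) ≫ _
    simp only [← id_tensorHom, tensorHom_comp_tensorHom, hh, Category.id_comp,
      Category.comp_id]

end Naturality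

lemma pentagon_conv :
    conv (fun n => assocCoeff ρ σ τ t Φ n ▷ Y)
      (conv (assocCoeff ρ (tensorRep σ τ) υ t Φ) (fun n => V ◁ assocCoeff σ τ υ t Φ n)) =
    conv (assocCoeff (tensorRep ρ σ) τ υ t Φ) (assocCoeff ρ σ (tensorRep τ υ) t Φ) := by
  -- the four commuting actions on `((V ⊗ W) ⊗ X) ⊗ Y`
  let U : M := ((V ⊗ W) ⊗ X) ⊗ Y
  let R₀ : L →ₗ⁅K⁆ End U := repL (rep₁ ρ W X) Y
  let R₁ : L →ₗ⁅K⁆ End U := repL (rep₂ V σ X) Y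
  let R₂ : L →ₗ⁅K⁆ End U := repL (rep₃ V W τ) Y
  let R₃ : L →ₗ⁅K⁆ End U := repR ((V ⊗ W) ⊗ X) υ
  let T : (L →ₗ⁅K⁆ End U) → (L →ₗ⁅K⁆ End U) → End U := fun f g =>
    t.act (f : L →ₗ[K] End U) (g : L →ₗ[K] End U)
  have key := pentagon_act t Φ R₀ R₁ R₂ R₃
    (fun a b => commute_repL_repL (commute_rep₁_rep₂ ρ σ a b))
    (fun a b => commute_repL_repL (commute_rep₁_rep₃ ρ τ a b))
    (fun a b => commute_repL_repR _ _ a b)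
    (fun a b => commute_repL_repL (commute_rep₂_rep₃ σ τ a b))
    (fun a b => commute_repL_repR _ _ a b)
    (fun a b => commute_repL_repR _ _ a b)
  let E₁ : U ⟶ (V ⊗ (W ⊗ X)) ⊗ Y := (α_ V W X).hom ▷ Y
  let E₂ : U ⟶ V ⊗ ((W ⊗ X) ⊗ Y) := E₁ ≫ (α_ V (W ⊗ X) Y).hom
  let E₃ : U ⟶ V ⊗ (W ⊗ (X ⊗ Y)) := E₂ ≫ V ◁ (α_ W X Y).hom
  let E₄ : U ⟶ (V ⊗ W) ⊗ (X ⊗ Y) := (α_ (V ⊗ W) X Y).hom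
  have c₁ : (fun n => assocCoeff ρ σ τ t Φ n ▷ Y) = fun n =>
      endCoeff (Φ.series.evalh (T R₀ R₁) (T R₁ R₂)) n ≫ E₁ := by
    funext n
    rw [assocCoeff, comp_whiskerRight, assocSeries, NCSeries.evalh_whiskerRight (K := K)]
    rw [← InvTensor.act_repL, ← InvTensor.act_repL]
  have c₂ : ∀ n, E₁ ≫ assocCoeff ρ (tensorRep σ τ) υ t Φ n =
      endCoeff (Φ.series.evalh (T R₀ R₁ + T R₀ R₂) (T R₁ R₃ + T R₂ R₃)) n ≫ E₂ := by
    intro n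
    have h₁ : ∀ a, E₁ ≫ (rep₁ ρ (W ⊗ X) Y a).asHom = (R₀ a).asHom ≫ E₁ := by
      intro a
      change (α_ V W X).hom ▷ Y ≫ ((ρ a).asHom ▷ (W ⊗ X)) ▷ Y =
        (((ρ a).asHom ▷ W) ▷ X) ▷ Y ≫ (α_ V W X).hom ▷ Y
      simp only [← comp_whiskerRight]
      simp
    have h₂ : ∀ a, E₁ ≫ (rep₂ V (tensorRep σ τ) Y a).asHom =
        (((R₁ : L →ₗ[K] End U) + (R₂ : L →ₗ[K] End U)) a).asHom ≫ E₁ := by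
      intro a
      change (α_ V W X).hom ▷ Y ≫ (V ◁ ((σ a).asHom ▷ X + W ◁ (τ a).asHom)) ▷ Y =
        (((V ◁ (σ a).asHom) ▷ X) ▷ Y + ((V ⊗ W) ◁ (τ a).asHom) ▷ Y) ≫ (α_ V W X).hom ▷ Y
      rw [MonoidalPreadditive.whiskerLeft_add, MonoidalPreadditive.add_whiskerRight,
        Preadditive.add_comp, Preadditive.comp_add]
      simp only [← comp_whiskerRight]
      simp
    have h₃ : ∀ a, E₁ ≫ (rep₃ V (W ⊗ X) υ a).asHom = (R₃ a).asHom ≫ E₁ := by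
      intro a
      change (α_ V W X).hom ▷ Y ≫ (V ⊗ (W ⊗ X)) ◁ (υ a).asHom =
        ((V ⊗ W) ⊗ X) ◁ (υ a).asHom ≫ (α_ V W X).hom ▷ Y
      exact (whisker_exchange _ _).symm
    have h := Φ.series.evalh_comp (e := E₁) (n := n)
      (t.act_comp (g := (R₁ : L →ₗ[K] End U) + (R₂ : L →ₗ[K] End U)) h₁ h₂)
      (t.act_comp (f := (R₁ : L →ₗ[K] End U) + (R₂ : L →ₗ[K] End U)) h₂ h₃)
    rw [t.act_add_left, t.act_add_right] at h
    rw [assocCoeff, ← Category.assoc]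
    refine (congrArg (· ≫ _) h).trans ?_
    rw [Category.assoc]
  have c₃ : ∀ n, E₂ ≫ V ◁ assocCoeff σ τ υ t Φ n =
      endCoeff (Φ.series.evalh (T R₁ R₂) (T R₂ R₃)) n ≫ E₃ := by
    intro n
    have h₁ : ∀ a, E₂ ≫ (repR V (rep₁ σ X Y) a).asHom = (R₁ a).asHom ≫ E₂ := by
      intro a
      change ((α_ V W X).hom ▷ Y ≫ (α_ V (W ⊗ X) Y).hom) ≫ V ◁ (((σ a).asHom ▷ X) ▷ Y) =
        ((V ◁ (σ a).asHom) ▷ X) ▷ Y ≫ (α_ V W X).hom ▷ Y ≫ (α_ V (W ⊗ X) Y).hom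
      simp
    have h₂ : ∀ a, E₂ ≫ (repR V (rep₂ W τ Y) a).asHom = (R₂ a).asHom ≫ E₂ := by
      intro a
      change ((α_ V W X).hom ▷ Y ≫ (α_ V (W ⊗ X) Y).hom) ≫ V ◁ ((W ◁ (τ a).asHom) ▷ Y) =
        ((V ⊗ W) ◁ (τ a).asHom) ▷ Y ≫ (α_ V W X).hom ▷ Y ≫ (α_ V (W ⊗ X) Y).hom
      simp
    have h₃ : ∀ a, E₂ ≫ (repR V (rep₃ W X υ) a).asHom = (R₃ a).asHom ≫ E₂ := by
      intro a
      change ((α_ V W X).hom ▷ Y ≫ (α_ V (W ⊗ X) Y).hom) ≫ V ◁ ((W ⊗ X) ◁ (υ a).asHom) =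
        ((V ⊗ W) ⊗ X) ◁ (υ a).asHom ≫ (α_ V W X).hom ▷ Y ≫ (α_ V (W ⊗ X) Y).hom
      simp
    have h := Φ.series.evalh_comp (e := E₂) (n := n) (t.act_comp h₁ h₂) (t.act_comp h₂ h₃)
    rw [t.act_repR, t.act_repR] at h
    rw [assocCoeff, whiskerLeft_comp, assocSeries, NCSeries.evalh_whiskerLeft (K := K),
      ← Category.assoc]
    refine (congrArg (· ≫ _) h).trans ?_
    rw [Category.assoc]
  have c₄ : assocCoeff (tensorRep ρ σ) τ υ t Φ = fun n =>
      endCoeff (Φ.series.evalh (T R₀ R₂ + T R₁ R₂) (T R₂ R₃)) n ≫ E₄ := by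
    funext n
    have h : (rep₁ (tensorRep ρ σ) X Y : L →ₗ[K] End U) =
        (R₀ : L →ₗ[K] End U) + (R₁ : L →ₗ[K] End U) := by
      ext a
      change (((ρ a).asHom ▷ W + V ◁ (σ a).asHom) ▷ X) ▷ Y =
        (((ρ a).asHom ▷ W) ▷ X) ▷ Y + ((V ◁ (σ a).asHom) ▷ X) ▷ Y
      simp only [MonoidalPreadditive.add_whiskerRight]
    rw [assocCoeff, assocSeries, h, t.act_add_left]
    rfl
  have c₅ : ∀ n, E₄ ≫ assocCoeff ρ σ (tensorRep τ υ) t Φ n =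
      endCoeff (Φ.series.evalh (T R₀ R₁) (T R₁ R₂ + T R₁ R₃)) n ≫ E₃ := by
    intro n
    have h₁ : ∀ a, E₄ ≫ (rep₁ ρ W (X ⊗ Y) a).asHom = (R₀ a).asHom ≫ E₄ := by
      intro a
      change (α_ (V ⊗ W) X Y).hom ≫ ((ρ a).asHom ▷ W) ▷ (X ⊗ Y) =
        (((ρ a).asHom ▷ W) ▷ X) ▷ Y ≫ (α_ (V ⊗ W) X Y).hom
      simp
    have h₂ : ∀ a, E₄ ≫ (rep₂ V σ (X ⊗ Y) a).asHom = (R₁ a).asHom ≫ E₄ := by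
      intro a
      change (α_ (V ⊗ W) X Y).hom ≫ (V ◁ (σ a).asHom) ▷ (X ⊗ Y) =
        ((V ◁ (σ a).asHom) ▷ X) ▷ Y ≫ (α_ (V ⊗ W) X Y).hom
      simp
    have h₃ : ∀ a, E₄ ≫ (rep₃ V W (tensorRep τ υ) a).asHom =
        (((R₂ : L →ₗ[K] End U) + (R₃ : L →ₗ[K] End U)) a).asHom ≫ E₄ := by
      intro a
      change (α_ (V ⊗ W) X Y).hom ≫ (V ⊗ W) ◁ ((τ a).asHom ▷ Y + X ◁ (υ a).asHom) =
        (((V ⊗ W) ◁ (τ a).asHom) ▷ Y + ((V ⊗ W) ⊗ X) ◁ (υ a).asHom) ≫ (α_ (V ⊗ W) X Y).hom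
      rw [MonoidalPreadditive.whiskerLeft_add, Preadditive.add_comp, Preadditive.comp_add]
      simp
    have h := Φ.series.evalh_comp (e := E₄) (n := n) (t.act_comp h₁ h₂)
      (t.act_comp (g := (R₂ : L →ₗ[K] End U) + (R₃ : L →ₗ[K] End U)) h₂ h₃)
    rw [t.act_add_right] at h
    rw [assocCoeff, ← Category.assoc]
    refine (congrArg (· ≫ _) h).trans ?_
    rw [Category.assoc]
    refine congrArg (_ ≫ ·) ?_
    exact (pentagon V W X Y).symm.trans (Category.assoc _ _ _).symm
  rw [← conv_assoc, c₁, conv_push c₂, conv_push c₃, c₄, conv_push c₅]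
  funext n
  rw [← mul_assoc]
  exact congrArg (fun P => endCoeff P n ≫ E₃) key.symm

end Three

end Reps

/-! ### The Drinfeld category -/

section Drinfeld

open MonoidalCategory

variable {K : Type u} [Field K] {L : Type v} [LieRing L] [LieAlgebra K L]

/-- The objects of the Drinfeld category `U(L)-Mod^Φ_ħ`: the `U(L)`-modules, given by a vector
space and a representation of `L`.  The tensor `t` and the associator `Φ` enter only in the
monoidal structure. -/
structure DrinfeldCat (t : InvTensor K L) (Φ : DrinfeldAssociator K) where
  V : ModuleCat.{u} K
  ρ : L →ₗ⁅K⁆ End V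

lemma conv_whiskerRight {V₁ V₂ V₃ : ModuleCat.{u} K} (f : ℕ → (V₁ ⟶ V₂)) (g : ℕ → (V₂ ⟶ V₃))
    (W : ModuleCat.{u} K) (n : ℕ) :
    conv f g n ▷ W = conv (fun n => f n ▷ W) (fun n => g n ▷ W) n := by
  simp only [conv, sum_whiskerRight, comp_whiskerRight]

lemma conv_whiskerLeft {V₁ V₂ V₃ : ModuleCat.{u} K} (f : ℕ → (V₁ ⟶ V₂)) (g : ℕ → (V₂ ⟶ V₃))
    (W : ModuleCat.{u} K) (n : ℕ) :
    W ◁ conv f g n = conv (fun n => W ◁ f n) (fun n => W ◁ g n) n := by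
  simp only [conv, whiskerLeft_sum, whiskerLeft_comp]

namespace DrinfeldCat

variable {t : InvTensor K L} {Φ : DrinfeldAssociator K}

/-- The morphisms are the formal power series in `ħ` of `U(L)`-linear maps. -/
@[ext]
structure Hom (X Y : DrinfeldCat t Φ) where
  coeff : ℕ → (X.V ⟶ Y.V)
  equivariant : ∀ (n : ℕ) (a : L), (X.ρ a).asHom ≫ coeff n = coeff n ≫ (Y.ρ a).asHom

lemma cst_equivariant {V W : ModuleCat.{u} K} {r : V ⟶ V} {s : W ⟶ W} {e : V ⟶ W}
    (h : r ≫ e = e ≫ s) (n : ℕ) : r ≫ cst e n = cst e n ≫ s := by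
  unfold cst
  split_ifs
  · exact h
  · simp

/-- A `U(L)`-linear map, considered as a constant formal power series. -/
def Hom.const {X Y : DrinfeldCat t Φ} (e : X.V ⟶ Y.V)
    (h : ∀ a : L, (X.ρ a).asHom ≫ e = e ≫ (Y.ρ a).asHom) : Hom X Y where
  coeff := cst e
  equivariant n a := cst_equivariant (h a) n

instance : Category (DrinfeldCat t Φ) where
  Hom := Hom
  id X := Hom.const (𝟙 X.V) fun a => by simp
  comp f g :=
    { coeff := conv f.coeff g.coeff
      equivariant := fun n a => by
        simp only [conv, Preadditive.comp_sum, Preadditive.sum_comp]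
        refine Finset.sum_congr rfl fun p _ => ?_
        rw [← Category.assoc, f.equivariant, Category.assoc, g.equivariant, Category.assoc] }
  id_comp f := Hom.ext ((conv_cst_left _ _).trans (funext fun _ => Category.id_comp _))
  comp_id f := Hom.ext ((conv_cst_right _ _).trans (funext fun _ => Category.comp_id _))
  assoc f g h := Hom.ext (conv_assoc _ _ _)

@[ext]
lemma hom_ext {X Y : DrinfeldCat t Φ} {f g : X ⟶ Y} (h : f.coeff = g.coeff) : f = g := Hom.ext h

lemma id_coeff (X : DrinfeldCat t Φ) : Hom.coeff (𝟙 X) = cst (𝟙 X.V) := rfl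

lemma comp_coeff {X Y Z : DrinfeldCat t Φ} (f : X ⟶ Y) (g : Y ⟶ Z) :
    (f ≫ g).coeff = conv f.coeff g.coeff := rfl

/-- The tensor product of two modules. -/
def tensor (X Y : DrinfeldCat t Φ) : DrinfeldCat t Φ := ⟨X.V ⊗ Y.V, tensorRep X.ρ Y.ρ⟩

/-- The morphism `f ⊗ id`. -/
def whiskR {X X' : DrinfeldCat t Φ} (f : X ⟶ X') (Y : DrinfeldCat t Φ) :
    tensor X Y ⟶ tensor X' Y where
  coeff n := f.coeff n ▷ Y.V
  equivariant n a := whiskerRight_equivariant _ (f.equivariant n a)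

/-- The morphism `id ⊗ f`. -/
def whiskL (X : DrinfeldCat t Φ) {Y Y' : DrinfeldCat t Φ} (f : Y ⟶ Y') :
    tensor X Y ⟶ tensor X Y' where
  coeff n := X.V ◁ f.coeff n
  equivariant n a := whiskerLeft_equivariant _ (f.equivariant n a)

/-- The associativity constraint, given by the action of `Φ(ħ t^{1,2}, ħ t^{2,3})`. -/
noncomputable def assoc (X Y Z : DrinfeldCat t Φ) :
    tensor (tensor X Y) Z ≅ tensor X (tensor Y Z) where
  hom := ⟨assocCoeff X.ρ Y.ρ Z.ρ t Φ, assocCoeff_equivariant X.ρ Y.ρ Z.ρ t Φ⟩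
  inv := ⟨assocInvCoeff X.ρ Y.ρ Z.ρ t Φ, assocInvCoeff_equivariant X.ρ Y.ρ Z.ρ t Φ⟩
  hom_inv_id := hom_ext (assoc_hom_inv X.ρ Y.ρ Z.ρ t Φ)
  inv_hom_id := hom_ext (assoc_inv_hom X.ρ Y.ρ Z.ρ t Φ)

/-- An equivariant isomorphism, considered as a constant isomorphism. -/
def constIso {X Y : DrinfeldCat t Φ} (e : X.V ≅ Y.V)
    (h : ∀ a : L, (X.ρ a).asHom ≫ e.hom = e.hom ≫ (Y.ρ a).asHom) : X ≅ Y where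
  hom := Hom.const e.hom h
  inv := Hom.const e.inv fun a => by
    rw [Iso.eq_inv_comp, ← Category.assoc, ← h, Category.assoc, Iso.hom_inv_id, Category.comp_id]
  hom_inv_id := hom_ext ((conv_cst_left _ _).trans (by
    funext n; simp only [Hom.const, cst, id_coeff]; split_ifs <;> simp))
  inv_hom_id := hom_ext ((conv_cst_left _ _).trans (by
    funext n; simp only [Hom.const, cst, id_coeff]; split_ifs <;> simp))

/-- The trivial module. -/
def unit : DrinfeldCat t Φ := ⟨𝟙_ (ModuleCat.{u} K), 0⟩

lemma unit_ρ (a : L) : ((unit (t := t) (Φ := Φ)).ρ a).asHom = 0 := rfl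

/-- The left unit constraint. -/
def lUnit (X : DrinfeldCat t Φ) : tensor unit X ≅ X :=
  constIso (λ_ X.V) fun a => by
    change ((0 : 𝟙_ (ModuleCat.{u} K) ⟶ _) ▷ X.V + _ ◁ (X.ρ a).asHom) ≫ _ = _
    rw [MonoidalPreadditive.zero_whiskerRight, zero_add, leftUnitor_naturality]
    rfl

/-- The right unit constraint. -/
def rUnit (X : DrinfeldCat t Φ) : tensor X unit ≅ X :=
  constIso (ρ_ X.V) fun a => by
    change ((X.ρ a).asHom ▷ _ + X.V ◁ (0 : 𝟙_ (ModuleCat.{u} K) ⟶ _)) ≫ _ = _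
    rw [MonoidalPreadditive.whiskerLeft_zero, add_zero, rightUnitor_naturality]
    rfl

lemma assoc_natural₁ {X X' : DrinfeldCat t Φ} (f : X ⟶ X') (Y Z : DrinfeldCat t Φ) :
    whiskR (whiskR f Y) Z ≫ (assoc X' Y Z).hom = (assoc X Y Z).hom ≫ whiskR f (tensor Y Z) := by
  refine hom_ext (conv_swap _ _ _ _ fun i j => ?_)
  have := assocCoeff_natural X.ρ Y.ρ Z.ρ t Φ (ρ' := X'.ρ) (σ' := Y.ρ) (τ' := Z.ρ) (f := f.coeff i)
    (g := 𝟙 Y.V) (h := 𝟙 Z.V) (f.equivariant i) (by simp) (by simp) j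
  simp only [tensorHom_id, id_whiskerRight] at this
  exact this

lemma assoc_natural₂ (X : DrinfeldCat t Φ) {Y Y' : DrinfeldCat t Φ} (f : Y ⟶ Y')
    (Z : DrinfeldCat t Φ) :
    whiskR (whiskL X f) Z ≫ (assoc X Y' Z).hom = (assoc X Y Z).hom ≫ whiskL X (whiskR f Z) := by
  refine hom_ext (conv_swap _ _ _ _ fun i j => ?_)
  have := assocCoeff_natural X.ρ Y.ρ Z.ρ t Φ (ρ' := X.ρ) (σ' := Y'.ρ) (τ' := Z.ρ) (f := 𝟙 X.V)
    (g := f.coeff i) (h := 𝟙 Z.V) (by simp) (f.equivariant i) (by simp) j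
  simp only [tensorHom_id, id_tensorHom] at this
  exact this

lemma assoc_natural₃ (X Y : DrinfeldCat t Φ) {Z Z' : DrinfeldCat t Φ} (f : Z ⟶ Z') :
    whiskL (tensor X Y) f ≫ (assoc X Y Z').hom = (assoc X Y Z).hom ≫ whiskL X (whiskL Y f) := by
  refine hom_ext (conv_swap _ _ _ _ fun i j => ?_)
  have := assocCoeff_natural X.ρ Y.ρ Z.ρ t Φ (ρ' := X.ρ) (σ' := Y.ρ) (τ' := Z'.ρ) (f := 𝟙 X.V)
    (g := 𝟙 Y.V) (h := f.coeff i) (by simp) (by simp) (f.equivariant i) j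
  simp only [tensorHom_id, id_tensorHom, id_whiskerRight] at this
  exact this

lemma whiskR_comp {X X' X'' : DrinfeldCat t Φ} (f : X ⟶ X') (g : X' ⟶ X'')
    (Y : DrinfeldCat t Φ) : whiskR (f ≫ g) Y = whiskR f Y ≫ whiskR g Y := by
  refine hom_ext (funext fun n => ?_)
  exact conv_whiskerRight _ _ _ _

lemma whiskL_comp (Y : DrinfeldCat t Φ) {X X' X'' : DrinfeldCat t Φ} (f : X ⟶ X') (g : X' ⟶ X'') :
    whiskL Y (f ≫ g) = whiskL Y f ≫ whiskL Y g := by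
  refine hom_ext (funext fun n => ?_)
  exact conv_whiskerLeft _ _ _ _

lemma whiskR_id (X Y : DrinfeldCat t Φ) : whiskR (𝟙 X) Y = 𝟙 (tensor X Y) := by
  refine hom_ext (funext fun n => ?_)
  change cst (𝟙 X.V) n ▷ Y.V = cst (𝟙 (X.V ⊗ Y.V)) n
  unfold cst
  split_ifs <;> simp

lemma whiskL_id (X Y : DrinfeldCat t Φ) : whiskL X (𝟙 Y) = 𝟙 (tensor X Y) := by
  refine hom_ext (funext fun n => ?_)
  change X.V ◁ cst (𝟙 Y.V) n = cst (𝟙 (X.V ⊗ Y.V)) n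
  unfold cst
  split_ifs <;> simp

lemma whisk_exchange {X X' Y Y' : DrinfeldCat t Φ} (f : X ⟶ X') (g : Y ⟶ Y') :
    whiskL X g ≫ whiskR f Y' = whiskR f Y ≫ whiskL X' g :=
  hom_ext (conv_swap _ _ _ _ fun _ _ => whisker_exchange _ _)

lemma lUnit_natural {X Y : DrinfeldCat t Φ} (f : X ⟶ Y) :
    whiskL unit f ≫ (lUnit Y).hom = (lUnit X).hom ≫ f := by
  refine hom_ext ((conv_cst_right _ _).trans (Eq.trans ?_ (conv_cst_left _ _).symm))
  exact funext fun n => leftUnitor_naturality _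

lemma rUnit_natural {X Y : DrinfeldCat t Φ} (f : X ⟶ Y) :
    whiskR f unit ≫ (rUnit Y).hom = (rUnit X).hom ≫ f := by
  refine hom_ext ((conv_cst_right _ _).trans (Eq.trans ?_ (conv_cst_left _ _).symm))
  exact funext fun n => rightUnitor_naturality _

lemma pent (W X Y Z : DrinfeldCat t Φ) :
    whiskR (assoc W X Y).hom Z ≫ (assoc W (tensor X Y) Z).hom ≫ whiskL W (assoc X Y Z).hom =
      (assoc (tensor W X) Y Z).hom ≫ (assoc W X (tensor Y Z)).hom :=
  hom_ext (pentagon_conv W.ρ X.ρ Y.ρ Z.ρ t Φ)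

lemma evalh_zero {A : Type w} [Ring A] [Algebra K A] : Φ.series.evalh (0 : A) 0 = 1 := by
  ext n
  simp only [NCSeries.evalh, PowerSeries.coeff_mk, PowerSeries.coeff_one]
  cases n with
  | zero => simp [Φ.coeff_nil]
  | succ n =>
    have h : ∀ i : Fin 2, ![(0 : A), 0] i = 0 := fun i => by fin_cases i <;> rfl
    simp [h]

lemma tri (X Y : DrinfeldCat t Φ) :
    (assoc X unit Y).hom ≫ whiskL X (lUnit Y).hom = whiskR (rUnit X).hom Y := by
  refine hom_ext ?_
  have h : (rep₂ X.V (unit (t := t) (Φ := Φ)).ρ Y.V :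
      L →ₗ[K] End ((X.V ⊗ (unit (t := t) (Φ := Φ)).V) ⊗ Y.V)) = 0 := by
    refine LinearMap.ext fun a => ?_
    change (X.V ◁ (0 : 𝟙_ (ModuleCat.{u} K) ⟶ _)) ▷ Y.V = 0
    rw [MonoidalPreadditive.whiskerLeft_zero, MonoidalPreadditive.zero_whiskerRight]
  have hs : assocSeries X.ρ (unit (t := t) (Φ := Φ)).ρ Y.ρ t Φ = 1 := by
    unfold assocSeries
    rw [h, InvTensor.act_zero_left, InvTensor.act_zero_right]
    exact evalh_zero
  have ha : (assoc X unit Y).hom.coeff = cst (α_ X.V (𝟙_ _) Y.V).hom := by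
    change assocCoeff X.ρ (unit (t := t) (Φ := Φ)).ρ Y.ρ t Φ = _
    rw [assocCoeff_eq, hs, endCoeff_one, conv_cst_left]
    simp only [Category.id_comp]
    rfl
  rw [comp_coeff, ha]
  refine (conv_cst_left _ _).trans (funext fun n => ?_)
  change (α_ X.V (𝟙_ _) Y.V).hom ≫ X.V ◁ cst (λ_ Y.V).hom n = cst (ρ_ X.V).hom n ▷ Y.V
  unfold cst
  split_ifs <;> simp

noncomputable instance : MonoidalCategory (DrinfeldCat t Φ) where
  tensorObj := tensor
  whiskerLeft := whiskL
  whiskerRight := whiskR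
  tensorUnit := unit
  associator := assoc
  leftUnitor := lUnit
  rightUnitor := rUnit
  id_tensorHom_id X Y := by
    change whiskR _ _ ≫ whiskL _ _ = _
    rw [whiskR_id, whiskL_id, Category.comp_id]
  tensorHom_comp_tensorHom {X₁ Y₁ Z₁ X₂ Y₂ Z₂} f₁ f₂ g₁ g₂ := by
    change (whiskR _ _ ≫ whiskL _ _) ≫ whiskR _ _ ≫ whiskL _ _ = whiskR _ _ ≫ whiskL _ _
    rw [whiskR_comp, whiskL_comp, Category.assoc, Category.assoc, ← Category.assoc (whiskL _ _),
      whisk_exchange, Category.assoc]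
  whiskerLeft_id := whiskL_id
  id_whiskerRight := whiskR_id
  associator_naturality f₁ f₂ f₃ := by
    change (whiskR (whiskR _ _ ≫ whiskL _ _) _ ≫ whiskL _ _) ≫ (assoc _ _ _).hom =
      (assoc _ _ _).hom ≫ whiskR _ _ ≫ whiskL _ (whiskR _ _ ≫ whiskL _ _)
    simp only [whiskR_comp, whiskL_comp, Category.assoc]
    rw [assoc_natural₃, ← Category.assoc (whiskR (whiskL _ _) _), assoc_natural₂, Category.assoc,
      ← Category.assoc (whiskR (whiskR _ _) _), assoc_natural₁, Category.assoc]
  leftUnitor_naturality := lUnit_natural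
  rightUnitor_naturality := rUnit_natural
  pentagon := pent
  triangle := tri

end DrinfeldCat

end Drinfeld

/-! ### The strict 2-category of monoidal categories -/

set_option linter.unusedVariables false
set_option linter.checkUnivs false

section MonoidalCat

open MonoidalCategory Functor.LaxMonoidal

universe v₁ u₁ v₂ u₂ v₃ u₃ v₄ u₄

/-- A (strong) monoidal functor: a lax monoidal functor whose coherence maps
`ε : 1 ⟶ F 1` and `μ : F X ⊗ F Y ⟶ F (X ⊗ Y)` are isomorphisms. -/
structure MonFunctor (C : Type u₁) [Category.{v₁} C] [MonoidalCategory C]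
    (D : Type u₂) [Category.{v₂} D] [MonoidalCategory D] extends LaxMonoidalFunctor C D where
  isIso_ε : IsIso (ε toFunctor)
  isIso_μ : ∀ X Y : C, IsIso (μ toFunctor X Y)

namespace MonFunctor

variable {C : Type u₁} [Category.{v₁} C] [MonoidalCategory C]
  {D : Type u₂} [Category.{v₂} D] [MonoidalCategory D]
  {E : Type u₃} [Category.{v₃} E] [MonoidalCategory E]

/-- The morphisms of monoidal functors are the monoidal natural transformations. -/
instance : Category (MonFunctor C D) where
  Hom F G := F.toLaxMonoidalFunctor ⟶ G.toLaxMonoidalFunctor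
  id F := 𝟙 F.toLaxMonoidalFunctor
  comp f g := LaxMonoidalFunctor.homMk (f.hom ≫ g.hom)

/-- A monoidal natural transformation as a morphism of monoidal functors. -/
def ofHom {F G : MonFunctor C D} (τ : F.toFunctor ⟶ G.toFunctor) (h : NatTrans.IsMonoidal τ) :
    F ⟶ G := ⟨τ, h⟩

/-- The underlying natural transformation. -/
def nat {F G : MonFunctor C D} (τ : F ⟶ G) : F.toFunctor ⟶ G.toFunctor := τ.hom

@[ext]
lemma hom_ext {F G : MonFunctor C D} {f g : F ⟶ G} (h : ∀ X, (nat f).app X = (nat g).app X) :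
    f = g := LaxMonoidalFunctor.hom_ext (NatTrans.ext (funext h))

lemma nat_id (F : MonFunctor C D) (X : C) : (nat (𝟙 F)).app X = 𝟙 (F.obj X) := rfl

lemma nat_comp {F G H : MonFunctor C D} (f : F ⟶ G) (g : G ⟶ H) (X : C) :
    (nat (f ≫ g)).app X = (nat f).app X ≫ (nat g).app X := rfl

/-- An invertible monoidal natural transformation. -/
def isoMk {F G : MonFunctor C D} (e : F.toFunctor ≅ G.toFunctor) (h : NatTrans.IsMonoidal e.hom) :
    F ≅ G where
  hom := ofHom e.hom h
  inv := ofHom e.inv inferInstance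
  hom_inv_id := hom_ext fun X => e.hom_inv_id_app X
  inv_hom_id := hom_ext fun X => e.inv_hom_id_app X

variable (C) in
/-- The identity monoidal functor. -/
def idFunctor : MonFunctor C C where
  toLaxMonoidalFunctor := LaxMonoidalFunctor.of (𝟭 C)
  isIso_ε := inferInstanceAs (IsIso (𝟙 _))
  isIso_μ _ _ := inferInstanceAs (IsIso (𝟙 _))

/-- The composition of monoidal functors. -/
def compFunctor (F : MonFunctor C D) (G : MonFunctor D E) : MonFunctor C E where
  toLaxMonoidalFunctor := LaxMonoidalFunctor.of (F.toFunctor ⋙ G.toFunctor)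
  isIso_ε := by
    have := F.isIso_ε
    have := G.isIso_ε
    exact inferInstanceAs (IsIso (ε G.toFunctor ≫ G.map (ε F.toFunctor)))
  isIso_μ X Y := by
    have := F.isIso_μ X Y
    have := G.isIso_μ (F.obj X) (F.obj Y)
    exact inferInstanceAs (IsIso (μ G.toFunctor _ _ ≫ G.map (μ F.toFunctor X Y)))

lemma ext_of {F G : MonFunctor C D} (h : F.toFunctor = G.toFunctor)
    (hε : ε F.toFunctor ≫ eqToHom (by rw [h]) = ε G.toFunctor)
    (hμ : ∀ X Y, μ F.toFunctor X Y ≫ eqToHom (by rw [h]) =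
      (eqToHom (by rw [h]) : F.obj X ⊗ F.obj Y ⟶ G.obj X ⊗ G.obj Y) ≫ μ G.toFunctor X Y) :
    F = G := by
  obtain ⟨⟨F, hF⟩, _, _⟩ := F
  obtain ⟨⟨G, hG⟩, _, _⟩ := G
  obtain rfl : F = G := h
  have : hF = hG := by
    refine Functor.LaxMonoidal.ext ?_ ?_
    · simpa using hε
    · funext X Y
      simpa using hμ X Y
  subst this
  rfl

lemma eqToHom_nat {F G : MonFunctor C D} (h : F = G) (X : C) :
    (nat (eqToHom h)).app X = eqToHom (by rw [h]) := by
  subst h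
  rfl

lemma eqToHom_app_id {F G : MonFunctor C D} (h : F = G) (X : C) {h' : F.obj X = G.obj X} :
    (nat (eqToHom h)).app X = eqToHom h' := eqToHom_nat h X

variable {E' : Type u₄} [Category.{v₄} E'] [MonoidalCategory E']

lemma compFunctor_id_left (F : MonFunctor C D) : compFunctor (idFunctor C) F = F := by
  refine ext_of rfl ?_ fun X Y => ?_
  · change (ε F.toFunctor ≫ F.map (𝟙 _)) ≫ 𝟙 _ = _
    simp
  · change (μ F.toFunctor X Y ≫ F.map (𝟙 _)) ≫ 𝟙 _ = 𝟙 _ ≫ _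
    simp

lemma compFunctor_id_right (F : MonFunctor C D) : compFunctor F (idFunctor D) = F := by
  refine ext_of rfl ?_ fun X Y => ?_
  · change (𝟙 _ ≫ ε F.toFunctor) ≫ 𝟙 _ = _
    simp
  · change (𝟙 _ ≫ μ F.toFunctor X Y) ≫ 𝟙 _ = 𝟙 _ ≫ _
    simp

lemma compFunctor_assoc (F : MonFunctor C D) (G : MonFunctor D E) (H : MonFunctor E E') :
    compFunctor (compFunctor F G) H = compFunctor F (compFunctor G H) := by
  refine ext_of rfl ?_ fun X Y => ?_
  · change (ε H.toFunctor ≫ H.map (ε G.toFunctor ≫ G.map (ε F.toFunctor))) ≫ 𝟙 _ =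
      (ε H.toFunctor ≫ H.map (ε G.toFunctor)) ≫ H.map (G.map (ε F.toFunctor))
    simp
  · change (μ H.toFunctor _ _ ≫ H.map (μ G.toFunctor _ _ ≫ G.map (μ F.toFunctor X Y))) ≫ 𝟙 _ =
      𝟙 _ ≫ (μ H.toFunctor _ _ ≫ H.map (μ G.toFunctor _ _)) ≫ H.map (G.map (μ F.toFunctor X Y))
    simp

end MonFunctor

/-- The type of (bundled) monoidal categories. -/
structure MonoidalCat where
  /-- The bundled monoidal category. -/
  of ::
  carrier : Type u₁
  [category : Category.{v₁} carrier]
  [monoidal : MonoidalCategory carrier]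

attribute [instance] MonoidalCat.category MonoidalCat.monoidal

namespace MonoidalCat

open MonFunctor

lemma conj_id {C : Type u₁} [Category.{v₁} C] {X Y : C} (f : X ⟶ Y) : 𝟙 X ≫ f ≫ 𝟙 Y = f := by
  simp

lemma pentagon_id {C : Type u₁} [Category.{v₁} C] {X : C} {f : X ⟶ X} (h : f = 𝟙 X) :
    f ≫ 𝟙 X ≫ 𝟙 X = 𝟙 X ≫ 𝟙 X := by
  simp [h]

lemma triangle_id {C : Type u₁} [Category.{v₁} C] {X : C} {f : X ⟶ X} (h : f = 𝟙 X) :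
    𝟙 X ≫ 𝟙 X = f := by
  simp [h]

/-- Monoidal categories, monoidal functors and monoidal natural transformations. -/
instance : Bicategory MonoidalCat.{v₁, u₁} where
  Hom C D := MonFunctor C.carrier D.carrier
  id C := idFunctor C.carrier
  comp F G := compFunctor F G
  homCategory C D := inferInstanceAs (Category (MonFunctor C.carrier D.carrier))
  whiskerLeft F G H η :=
    have := η.isMonoidal
    ofHom (F := compFunctor F G) (G := compFunctor F H) (Functor.whiskerLeft F.toFunctor η.hom)
      (inferInstanceAs (NatTrans.IsMonoidal (Functor.whiskerLeft F.toFunctor η.hom)))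
  whiskerRight {_ _ _ F G} η H :=
    have := η.isMonoidal
    ofHom (F := compFunctor F H) (G := compFunctor G H) (Functor.whiskerRight η.hom H.toFunctor)
      (inferInstanceAs (NatTrans.IsMonoidal (Functor.whiskerRight η.hom H.toFunctor)))
  associator F G H := isoMk (F := compFunctor (compFunctor F G) H)
    (G := compFunctor F (compFunctor G H))
    (Functor.associator F.toFunctor G.toFunctor H.toFunctor)
    (inferInstanceAs (NatTrans.IsMonoidal
      (Functor.associator F.toFunctor G.toFunctor H.toFunctor).hom))
  leftUnitor F := isoMk (F := compFunctor (idFunctor _) F) (G := F)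
    (Functor.leftUnitor F.toFunctor)
    (inferInstanceAs (NatTrans.IsMonoidal (Functor.leftUnitor F.toFunctor).hom))
  rightUnitor F := isoMk (F := compFunctor F (idFunctor _)) (G := F)
    (Functor.rightUnitor F.toFunctor)
    (inferInstanceAs (NatTrans.IsMonoidal (Functor.rightUnitor F.toFunctor).hom))
  whiskerLeft_id F G := rfl
  whiskerLeft_comp F _ _ _ η θ := rfl
  id_whiskerLeft η := hom_ext fun _ => (conj_id _).symm
  comp_whiskerLeft F G _ _ η := hom_ext fun _ => (conj_id _).symm
  id_whiskerRight F G := hom_ext fun _ => G.map_id _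
  comp_whiskerRight η θ F := hom_ext fun _ => F.map_comp _ _
  whiskerRight_id η := hom_ext fun _ => (conj_id _).symm
  whiskerRight_comp η F G := hom_ext fun _ => (conj_id _).symm
  whisker_assoc F _ _ η H := hom_ext fun _ => (conj_id _).symm
  whisker_exchange η θ := hom_ext fun X => (θ.hom.naturality (η.hom.app X)).symm
  pentagon F G H I := hom_ext fun X => pentagon_id (I.map_id _)
  triangle F G := hom_ext fun X => triangle_id (G.map_id _)

instance : Bicategory.Strict MonoidalCat.{v₁, u₁} where
  id_comp F := compFunctor_id_left F
  comp_id F := compFunctor_id_right F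
  assoc F G H := compFunctor_assoc F G H
  leftUnitor_eqToIso F := Iso.ext (hom_ext fun X =>
    (eqToHom_app_id (compFunctor_id_left F) X (h' := rfl)).symm)
  rightUnitor_eqToIso F := Iso.ext (hom_ext fun X =>
    (eqToHom_app_id (compFunctor_id_right F) X (h' := rfl)).symm)
  associator_eqToIso F G H := Iso.ext (hom_ext fun X =>
    (eqToHom_app_id (compFunctor_assoc F G H) X (h' := rfl)).symm)

end MonoidalCat

end MonoidalCat

/-! ### The 2-category of finite sets and parenthesized ordered morphisms -/

section FSet

/-- The letters of a parenthesized word, from left to right. -/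
def leaves {S : Type w} : FreeMagma S → List S
  | .of s => [s]
  | .mul a b => leaves a ++ leaves b

/-- The letters of a possibly empty parenthesized word: an element of the free unital magma. -/
def leavesOne {S : Type w} : WithOne (FreeMagma S) → List S :=
  WithOne.recOneCoe [] leaves

/-- Substitution of possibly empty parenthesized words for the letters of such a word. -/
def substOne {S : Type w} {S' : Type x} (f : S → WithOne (FreeMagma S')) :
    WithOne (FreeMagma S) →* WithOne (FreeMagma S') :=
  WithOne.lift (FreeMagma.lift f)

section Subst

variable {S : Type w} {S' : Type x}

lemma leavesOne_one : leavesOne (1 : WithOne (FreeMagma S)) = [] := rfl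

lemma leavesOne_coe (T : FreeMagma S) : leavesOne (T : WithOne (FreeMagma S)) = leaves T := rfl

lemma leavesOne_mul (a b : WithOne (FreeMagma S)) :
    leavesOne (a * b) = leavesOne a ++ leavesOne b := by
  induction a using WithOne.recOneCoe with
  | one => simp [leavesOne_one]
  | coe a =>
    induction b using WithOne.recOneCoe with
    | one => simp [leavesOne_one]
    | coe b => rfl

lemma substOne_one (f : S → WithOne (FreeMagma S')) : substOne f 1 = 1 := rfl

lemma substOne_of (f : S → WithOne (FreeMagma S')) (s : S) :
    substOne f (FreeMagma.of s : FreeMagma S) = f s := rfl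

lemma substOne_mul (f : S → WithOne (FreeMagma S')) (a b : FreeMagma S) :
    substOne f ((a * b : FreeMagma S) : WithOne (FreeMagma S)) = substOne f a * substOne f b := by
  rw [WithOne.coe_mul, map_mul]

lemma leavesOne_substOne (f : S → WithOne (FreeMagma S')) (a : WithOne (FreeMagma S)) :
    leavesOne (substOne f a) = (leavesOne a).flatMap fun s => leavesOne (f s) := by
  induction a using WithOne.recOneCoe with
  | one => rfl
  | coe a =>
    induction a using FreeMagma.recOnMul with
    | ih1 s => simp [substOne_of, leavesOne_coe, leaves]
    | ih2 a b ha hb =>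
      rw [substOne_mul, leavesOne_mul, ha, hb, leavesOne_coe, leavesOne_coe, ← List.flatMap_append]
      rfl

lemma substOne_id (a : WithOne (FreeMagma S)) :
    substOne (fun s => (FreeMagma.of s : WithOne (FreeMagma S))) a = a := by
  induction a using WithOne.recOneCoe with
  | one => rfl
  | coe a =>
    induction a using FreeMagma.recOnMul with
    | ih1 s => rfl
    | ih2 a b ha hb => rw [substOne_mul, ha, hb, WithOne.coe_mul]

lemma substOne_substOne {S'' : Type v} (f : S → WithOne (FreeMagma S'))
    (g : S' → WithOne (FreeMagma S'')) (a : WithOne (FreeMagma S)) :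
    substOne g (substOne f a) = substOne (fun s => substOne g (f s)) a := by
  induction a using WithOne.recOneCoe with
  | one => rfl
  | coe a =>
    induction a using FreeMagma.recOnMul with
    | ih1 s => rfl
    | ih2 a b ha hb => rw [substOne_mul, map_mul, substOne_mul, ha, hb]

end Subst

/-- An ordered morphism of finite sets: a map together with a linear order on each of its fibres,
recorded as the list `fibre j` of the elements of the fibre over `j` in increasing order. -/
@[ext]
structure OrdMor (I J : Type w) where
  map : I → J
  fibre : J → List I
  nodup : ∀ j, (fibre j).Nodup
  mem : ∀ i j, i ∈ fibre j ↔ map i = j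

/-- A parenthesized ordered morphism of finite sets: an ordered morphism together with a
parenthesization of each of its fibres. -/
@[ext]
structure ParMor (I J : Type w) extends OrdMor I J where
  paren : J → WithOne (FreeMagma I)
  leaves_paren : ∀ j, leavesOne (paren j) = fibre j

/-- The identity. -/
def ParMor.id (I : Type w) : ParMor I I where
  map := _root_.id
  fibre i := [i]
  nodup := by simp
  mem := by simp
  paren i := (FreeMagma.of i : FreeMagma I)
  leaves_paren _ := rfl

/-- Composition of ordered morphisms, with the lexicographic order on the fibres. -/
def OrdMor.comp {I J J' : Type w} (p : OrdMor I J) (q : OrdMor J J') : OrdMor I J' where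
  map := q.map ∘ p.map
  fibre k := (q.fibre k).flatMap p.fibre
  nodup k := by
    refine List.nodup_flatMap.2 ⟨fun j _ => p.nodup j, (q.nodup k).imp ?_⟩
    intro j j' hjj' i hi hi'
    exact hjj' (((p.mem _ _).1 hi).symm.trans ((p.mem _ _).1 hi'))
  mem i k := by simp [List.mem_flatMap, p.mem, q.mem]

/-- Composition of parenthesized ordered morphisms: the parenthesizations are substituted into
each other (polygons are glued), and empty fibres disappear. -/
def ParMor.comp {I J J' : Type w} (p : ParMor I J) (q : ParMor J J') : ParMor I J' where
  toOrdMor := p.toOrdMor.comp q.toOrdMor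
  paren k := substOne p.paren (q.paren k)
  leaves_paren k := by
    rw [leavesOne_substOne, q.leaves_paren]
    simp only [p.leaves_paren]
    rfl

/-- The type of finite sets. -/
structure FSet where
  /-- The bundled finite set. -/
  of ::
  carrier : Type w
  [fintype : Fintype carrier]

attribute [instance] FSet.fintype

namespace FSet

/-- There is a unique 2-morphism between any two parenthesized ordered morphisms with the same
underlying ordered morphism. -/
instance (I J : FSet.{w}) : Category (ParMor I.carrier J.carrier) where
  Hom p q := PLift (p.toOrdMor = q.toOrdMor)
  id p := ⟨rfl⟩
  comp f g := ⟨f.down.trans g.down⟩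

instance (I J : FSet.{w}) (p q : ParMor I.carrier J.carrier) : Subsingleton (p ⟶ q) :=
  inferInstanceAs (Subsingleton (PLift _))

lemma hom_eq {I J : FSet.{w}} {p q : ParMor I.carrier J.carrier} (α β : p ⟶ q) : α = β :=
  Subsingleton.elim _ _

/-- The 2-morphism between parallel morphisms with the same underlying ordered morphism. -/
def homMk {I J : FSet.{w}} {p q : ParMor I.carrier J.carrier} (h : p.toOrdMor = q.toOrdMor) :
    p ⟶ q := PLift.up h

lemma ordEq {I J : FSet.{w}} {p q : ParMor I.carrier J.carrier} (α : p ⟶ q) :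
    p.toOrdMor = q.toOrdMor := PLift.down α

/-- The invertible 2-morphism between equal 1-morphisms. -/
def isoMk {I J : FSet.{w}} {p q : ParMor I.carrier J.carrier} (h : p = q) : p ≅ q where
  hom := homMk (congrArg _ h)
  inv := homMk (congrArg _ h.symm)

lemma id_comp {I J : FSet.{w}} (p : ParMor I.carrier J.carrier) :
    (ParMor.id I.carrier).comp p = p := by
  refine ParMor.ext rfl ?_ ?_
  · funext k
    exact List.flatMap_singleton' _
  · funext k
    exact substOne_id _

lemma comp_id {I J : FSet.{w}} (p : ParMor I.carrier J.carrier) :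
    p.comp (ParMor.id J.carrier) = p := by
  refine ParMor.ext rfl ?_ ?_
  · funext k
    exact List.flatMap_singleton _ _
  · funext k
    exact substOne_of _ _

lemma comp_assoc {I J J' J'' : FSet.{w}} (p : ParMor I.carrier J.carrier)
    (q : ParMor J.carrier J'.carrier) (r : ParMor J'.carrier J''.carrier) :
    (p.comp q).comp r = p.comp (q.comp r) := by
  refine ParMor.ext rfl ?_ ?_
  · funext k
    exact List.flatMap_assoc.symm
  · funext k
    exact (substOne_substOne _ _ _).symm

/-- The 2-category `FSet^(<)` of finite sets, parenthesized ordered morphisms, and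
reparenthesizations. -/
instance : Bicategory FSet.{w} where
  Hom I J := ParMor I.carrier J.carrier
  id I := ParMor.id I.carrier
  comp p q := p.comp q
  homCategory I J := inferInstanceAs (Category (ParMor I.carrier J.carrier))
  whiskerLeft p _ _ η := homMk (congrArg p.toOrdMor.comp (ordEq η))
  whiskerRight η r := homMk (congrArg (fun q => OrdMor.comp q r.toOrdMor) (ordEq η))
  associator p q r := isoMk (comp_assoc p q r)
  leftUnitor p := isoMk (id_comp p)
  rightUnitor p := isoMk (comp_id p)
  whiskerLeft_id _ _ := Subsingleton.elim _ _
  whiskerLeft_comp _ _ _ _ _ _ := Subsingleton.elim _ _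
  id_whiskerLeft _ := Subsingleton.elim _ _
  comp_whiskerLeft _ _ _ _ _ := Subsingleton.elim _ _
  id_whiskerRight _ _ := Subsingleton.elim _ _
  comp_whiskerRight _ _ _ := Subsingleton.elim _ _
  whiskerRight_id _ := Subsingleton.elim _ _
  whiskerRight_comp _ _ _ := Subsingleton.elim _ _
  whisker_assoc _ _ _ _ _ := Subsingleton.elim _ _
  whisker_exchange _ _ := Subsingleton.elim _ _
  pentagon _ _ _ _ := Subsingleton.elim _ _
  triangle _ _ := Subsingleton.elim _ _

instance : Bicategory.Strict FSet.{w} where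
  id_comp p := id_comp p
  comp_id p := comp_id p
  assoc p q r := comp_assoc p q r
  leftUnitor_eqToIso _ := Iso.ext (hom_eq _ _)
  rightUnitor_eqToIso _ := Iso.ext (hom_eq _ _)
  associator_eqToIso _ _ _ := Iso.ext (hom_eq _ _)

end FSet

end FSet

/-! ### Parenthesized braids -/

section Braids

/-- Words of parenthesized braids, from one parenthesized word of strands to another one.  In
`cross a b` the strands of `a` move to the right and pass over the strands of `b`. -/
inductive ParBraid {S : Type w} : FreeMagma S → FreeMagma S → Type w
  | id (a : FreeMagma S) : ParBraid a a
  | comp {a b c : FreeMagma S} (f : ParBraid a b) (g : ParBraid b c) : ParBraid a c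
  | tensor {a a' b b' : FreeMagma S} (f : ParBraid a a') (g : ParBraid b b') :
      ParBraid (a * b) (a' * b')
  | assoc (a b c : FreeMagma S) : ParBraid (a * b * c) (a * (b * c))
  | assocInv (a b c : FreeMagma S) : ParBraid (a * (b * c)) (a * b * c)
  | cross (a b : FreeMagma S) : ParBraid (a * b) (b * a)

/-- A word without crossings: it only changes the parenthesization. -/
def ParBraid.NoCross {S : Type w} : {a b : FreeMagma S} → ParBraid a b → Prop
  | _, _, .id _ => True
  | _, _, .comp f g => f.NoCross ∧ g.NoCross
  | _, _, .tensor f g => f.NoCross ∧ g.NoCross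
  | _, _, .assoc _ _ _ => True
  | _, _, .assocInv _ _ _ => True
  | _, _, .cross _ _ => False

section Doubling

variable {I : Type w}

/-- `T^{(a)}`: the labels of the strands in `I ⊕ I` stand for `i^a` (left) and `i^b` (right). -/
def treeA : FreeMagma I → FreeMagma (I ⊕ I)
  | .of i => .of (Sum.inl i)
  | .mul x y => treeA x * treeA y

/-- `T^{(b)}`. -/
def treeB : FreeMagma I → FreeMagma (I ⊕ I)
  | .of i => .of (Sum.inr i)
  | .mul x y => treeB x * treeB y

/-- `T^{(ab)}`: each letter `i` is replaced by `i^a i^b`. -/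
def treeAB : FreeMagma I → FreeMagma (I ⊕ I)
  | .of i => .of (Sum.inl i) * .of (Sum.inr i)
  | .mul x y => treeAB x * treeAB y

/-- The middle interchange `(a b)(c d) → (a c)(b d)`, where `b` passes over `c`. -/
def interchange {S : Type w} (a b c d : FreeMagma S) :
    ParBraid (a * b * (c * d)) (a * c * (b * d)) :=
  .comp (.assoc a b (c * d)) <| .comp (.tensor (.id a) <|
    .comp (.assocInv b c d) <| .comp (.tensor (.cross b c) (.id d)) (.assoc c b d)) <|
      .assocInv a c (b * d)

/-- The parenthesized braid from `T^{(a)} T^{(b)}` to `T^{(ab)}` in which the strands `i^a` move to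
the right and pass over the strands `i^b`, which move to the left. -/
def shuffleBraid : (T : FreeMagma I) → ParBraid (treeA T * treeB T) (treeAB T)
  | .of _ => .id _
  | .mul x y => .comp (interchange (treeA x) (treeA y) (treeB x) (treeB y))
      (.tensor (shuffleBraid x) (shuffleBraid y))

end Doubling

variable {K : Type u} [Field K] {L : Type v} [LieRing L] [LieAlgebra K L]
  {A : Type x} [Ring A] [Algebra K A] {S : Type w}

/-- The sum of the `t^{s,s'}` over all the letters `s` of `a` and `s'` of `b`, where the strand
`s` acts on `A` through `R s`. -/
noncomputable def strandSum (t : InvTensor K L) (R : S → (L →ₗ[K] A)) (a b : FreeMagma S) : A :=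
  ((leaves a).map fun s => ((leaves b).map fun s' => t.act (R s) (R s')).sum).sum

/-- The element which corresponds to a word of parenthesized braids: reparenthesizations
`(a b) c → a (b c)` yield `Φ(ħ t^{a,b}, ħ t^{b,c})` and positive crossings yield
`exp(ħ t^{a,b} / 2)`.  The tensor factors are indexed by the labels of the strands, so that
permutations do not show up, and elements act from the left. -/
noncomputable def ParBraid.eval (t : InvTensor K L) (Φ : DrinfeldAssociator K)
    (R : S → (L →ₗ[K] A)) : {a b : FreeMagma S} → ParBraid a b → PowerSeries A
  | _, _, .id _ => 1
  | _, _, .comp f g => g.eval t Φ R * f.eval t Φ R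
  | _, _, .tensor f g => f.eval t Φ R * g.eval t Φ R
  | _, _, .assoc a b c => Φ.series.evalh (strandSum t R a b) (strandSum t R b c)
  | _, _, .assocInv a b c => psInv (Φ.series.evalh (strandSum t R a b) (strandSum t R b c))
  | _, _, .cross a b => exph K ((2 : K)⁻¹ • strandSum t R a b)

section Commute

variable {t : InvTensor K L} {Φ : DrinfeldAssociator K} {R : S → (L →ₗ[K] A)}

lemma commute_strandSum {z : A} {a b : FreeMagma S}
    (h : ∀ s ∈ leaves a, ∀ s' ∈ leaves b, Commute z (t.act (R s) (R s'))) :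
    Commute z (strandSum t R a b) := by
  refine Commute.list_sum_right _ _ fun y hy => ?_
  obtain ⟨s, hs, rfl⟩ := List.mem_map.1 hy
  refine Commute.list_sum_right _ _ fun y hy => ?_
  obtain ⟨s', hs', rfl⟩ := List.mem_map.1 hy
  exact h s hs s' hs'

lemma ParBraid.mem_leaves {a b : FreeMagma S} (f : ParBraid a b) (s : S) :
    s ∈ leaves b ↔ s ∈ leaves a := by
  induction f with
  | id a => rfl
  | comp f g hf hg => rw [hg, hf]
  | tensor f g hf hg =>
    change s ∈ leaves _ ++ leaves _ ↔ s ∈ leaves _ ++ leaves _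
    rw [List.mem_append, List.mem_append, hf, hg]
  | assoc a b c =>
    change s ∈ leaves _ ++ (leaves _ ++ leaves _) ↔ s ∈ (leaves _ ++ leaves _) ++ leaves _
    rw [List.append_assoc]
  | assocInv a b c =>
    change s ∈ (leaves _ ++ leaves _) ++ leaves _ ↔ s ∈ leaves _ ++ (leaves _ ++ leaves _)
    rw [List.append_assoc]
  | cross a b =>
    change s ∈ leaves _ ++ leaves _ ↔ s ∈ leaves _ ++ leaves _
    rw [List.mem_append, List.mem_append, or_comm]

lemma coeff_mul_commute {z : A} {P Q : PowerSeries A}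
    (hP : ∀ n, Commute z (PowerSeries.coeff n P)) (hQ : ∀ n, Commute z (PowerSeries.coeff n Q))
    (n : ℕ) : Commute z (PowerSeries.coeff n (P * Q)) :=
  (commute_C_iff _ _).1 (((commute_C_iff _ _).2 hP).mul_right ((commute_C_iff _ _).2 hQ)) n

lemma ParBraid.commute_eval {z : A} {a b : FreeMagma S} (f : ParBraid a b)
    (h : ∀ s ∈ leaves a, ∀ s' ∈ leaves a, Commute z (t.act (R s) (R s'))) (n : ℕ) :
    Commute z (PowerSeries.coeff n (f.eval t Φ R)) := by
  induction f generalizing n with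
  | id a =>
    rw [ParBraid.eval, PowerSeries.coeff_one]
    split_ifs
    · exact Commute.one_right z
    · exact Commute.zero_right z
  | comp f g hf hg =>
    refine coeff_mul_commute (hg fun s hs s' hs' => ?_) (hf h) n
    exact h s ((f.mem_leaves s).1 hs) s' ((f.mem_leaves s').1 hs')
  | tensor f g hf hg =>
    exact coeff_mul_commute
      (hf fun s hs s' hs' => h s (List.mem_append_left _ hs) s' (List.mem_append_left _ hs'))
      (hg fun s hs s' hs' => h s (List.mem_append_right _ hs) s' (List.mem_append_right _ hs')) n
  | assoc a b c =>
    have h' : ∀ s, s ∈ leaves (a * b * c) ↔ (s ∈ leaves a ∨ s ∈ leaves b) ∨ s ∈ leaves c := by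
      intro s
      change s ∈ (leaves _ ++ leaves _) ++ leaves _ ↔ _
      rw [List.mem_append, List.mem_append]
    exact Φ.series.commute_evalh
      (commute_strandSum fun s hs s' hs' => h s ((h' s).2 (by tauto)) s' ((h' s').2 (by tauto)))
      (commute_strandSum fun s hs s' hs' => h s ((h' s).2 (by tauto)) s' ((h' s').2 (by tauto))) n
  | assocInv a b c =>
    have h' : ∀ s, s ∈ leaves (a * (b * c)) ↔ s ∈ leaves a ∨ (s ∈ leaves b ∨ s ∈ leaves c) := by
      intro s
      change s ∈ leaves _ ++ (leaves _ ++ leaves _) ↔ _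
      rw [List.mem_append, List.mem_append]
    exact commute_coeff_inverse (Φ.series.commute_evalh
      (commute_strandSum fun s hs s' hs' => h s ((h' s).2 (by tauto)) s' ((h' s').2 (by tauto)))
      (commute_strandSum fun s hs s' hs' => h s ((h' s).2 (by tauto)) s' ((h' s').2 (by tauto)))) n
  | cross a b =>
    have h' : ∀ s, s ∈ leaves (a * b) ↔ s ∈ leaves a ∨ s ∈ leaves b := by
      intro s
      change s ∈ leaves _ ++ leaves _ ↔ _
      rw [List.mem_append]
    rw [ParBraid.eval, exph, PowerSeries.coeff_mk]
    refine Commute.smul_right (Commute.pow_right (Commute.smul_right ?_ _) _) _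
    exact commute_strandSum fun s hs s' hs' => h s ((h' s).2 (by tauto)) s' ((h' s').2 (by tauto))

/-- Locality in space: braids on sets of strands which commute with each other commute. -/
lemma ParBraid.eval_commute {a b a' b' : FreeMagma S} (f : ParBraid a b) (f' : ParBraid a' b')
    (h : ∀ s ∈ leaves a, ∀ s' ∈ leaves a', ∀ y z, Commute (R s y) (R s' z)) :
    Commute (f.eval t Φ R) (f'.eval t Φ R) := by
  have key : ∀ m n, Commute (PowerSeries.coeff m (f.eval t Φ R))
      (PowerSeries.coeff n (f'.eval t Φ R)) := by
    intro m n
    refine f'.commute_eval (fun r hr r' hr' => ?_) n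
    refine (f.commute_eval (fun s hs s' hs' => ?_) m).symm
    refine t.commute_act (fun y => ?_) (fun y => ?_)
    · exact (t.commute_act (fun z => h s hs r hr y z) (fun z => h s hs r' hr' y z)).symm
    · exact (t.commute_act (fun z => h s' hs' r hr y z) (fun z => h s' hs' r' hr' y z)).symm
  ext n
  rw [PowerSeries.coeff_mul, PowerSeries.coeff_mul, ← Finset.Nat.sum_antidiagonal_swap]
  exact Finset.sum_congr rfl fun p _ => key _ _

end Commute

end Braids

/-! ### Quantum fusion -/

section Powers

variable {I : Type w} {K : Type u} [Field K] {g : Type v} [LieRing g]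

/-- `g^I = Maps(I, g)` with the pointwise bracket. -/
instance instLieRingMaps : LieRing (I → g) where
  bracket ξ η i := ⁅ξ i, η i⁆
  add_lie _ _ _ := funext fun _ => add_lie _ _ _
  lie_add _ _ _ := funext fun _ => lie_add _ _ _
  lie_self _ := funext fun _ => lie_self _
  leibniz_lie _ _ _ := funext fun _ => leibniz_lie _ _ _

lemma maps_bracket_apply (ξ η : I → g) (i : I) : ⁅ξ, η⁆ i = ⁅ξ i, η i⁆ := rfl

variable [LieAlgebra K g]

instance instLieAlgebraMaps : LieAlgebra K (I → g) where
  lie_smul _ _ _ := funext fun _ => lie_smul _ _ _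

open Classical in
variable (K g) in
/-- The inclusion of the `i`-th copy of `g` into `g^I`. -/
noncomputable def single (i : I) : g →ₗ⁅K⁆ (I → g) where
  toLinearMap := LinearMap.single K (fun _ : I => g) i
  map_lie' {a b} := by
    funext j
    change (Pi.single i ⁅a, b⁆ : I → g) j = ⁅(Pi.single i a : I → g) j, (Pi.single i b : I → g) j⁆
    by_cases h : j = i
    · subst h
      simp
    · simp [Pi.single_eq_of_ne h]

open Classical in
lemma single_apply (i : I) (a : g) : single K g i a = Pi.single i a := rfl

lemma bracket_single (ξ : I → g) (i : I) (b : g) :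
    ⁅ξ, single K g i b⁆ = single K g i ⁅ξ i, b⁆ := by
  classical
  funext j
  rw [maps_bracket_apply, single_apply, single_apply]
  by_cases h : j = i
  · subst h
    simp
  · simp [Pi.single_eq_of_ne h]

lemma single_bracket_single {i j : I} (h : i ≠ j) (a b : g) :
    ⁅single K g i a, single K g j b⁆ = 0 := by
  classical
  rw [bracket_single, single_apply i, Pi.single_eq_of_ne h.symm, zero_lie, map_zero]

end Powers

section Fusion

variable {K : Type u} [Field K] {g : Type v} [LieRing g] [LieAlgebra K g]
  {h : Type x} [LieRing h] [LieAlgebra K h]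

lemma symm_map {L : Type w} [LieRing L] [LieAlgebra K L] (t : InvTensor K g) (f : g →ₗ[K] L) :
    TensorProduct.comm K L L (TensorProduct.map f f t.val) = TensorProduct.map f f t.val := by
  rw [← TensorProduct.map_comm, t.symm]

lemma inv_map {L : Type w} [LieRing L] [LieAlgebra K L] (t : InvTensor K g) (f : g →ₗ[K] L)
    (a : L) (a' : g) (ha : ∀ b, ⁅a, f b⁆ = f ⁅a', b⁆) :
    ⁅a, TensorProduct.map f f t.val⁆ = 0 := by
  have key : ∀ s : g ⊗[K] g, ⁅a, TensorProduct.map f f s⁆ = TensorProduct.map f f ⁅a', s⁆ := by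
    intro s
    induction s using TensorProduct.induction_on with
    | zero => simp
    | tmul b c => simp [TensorProduct.LieModule.lie_tmul_right, ha]
    | add b c hb hc => simp only [map_add, lie_add, hb, hc]
  rw [key, t.inv, map_zero]

/-- The invariant tensor `∑ i, t_g^{(i)} + t_h` of `g^I ⊕ h`. -/
noncomputable def fusionTensor (tg : InvTensor K g) (th : InvTensor K h) (I : Type w)
    [Fintype I] : InvTensor K ((I → g) × h) where
  val :=
    letI incl (i : I) : g →ₗ[K] (I → g) × h := (LieHom.inl K (I → g) h).comp (single K g i)
    letI inclh : h →ₗ[K] (I → g) × h := LieHom.inr K (I → g) h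
    ∑ i, TensorProduct.map (incl i) (incl i) tg.val + TensorProduct.map inclh inclh th.val
  symm := by
    rw [map_add, map_sum, symm_map]
    simp only [symm_map]
  inv := by
    rintro ⟨ξ, η⟩
    rw [lie_add, lie_sum, inv_map th _ _ η, add_zero]
    · refine Finset.sum_eq_zero fun i _ => inv_map tg _ _ (ξ i) fun b => ?_
      change (⁅ξ, single K g i b⁆, ⁅η, (0 : h)⁆) = (single K g i ⁅ξ i, b⁆, (0 : h))
      rw [bracket_single, lie_zero]
    · intro b
      change (⁅ξ, (0 : I → g)⁆, ⁅η, b⁆) = ((0 : I → g), ⁅η, b⁆)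
      rw [lie_zero]

/-- The morphism of Lie algebras `p^! ⊕ id : g^J ⊕ h → g^I ⊕ h`, where `p^! ξ = ξ ∘ p`. -/
def pullback {I J : Type w} (p : I → J) : ((J → g) × h) →ₗ⁅K⁆ ((I → g) × h) where
  toFun ξ := (ξ.1 ∘ p, ξ.2)
  map_add' _ _ := rfl
  map_smul' _ _ := rfl
  map_lie' := rfl

variable {tg : InvTensor K g} {th : InvTensor K h} {Φ : DrinfeldAssociator K}

variable (tg th Φ) in
/-- The category `U(g^I ⊕ h)-Mod^Φ_ħ`. -/
abbrev FusionCat (I : Type w) [Fintype I] := DrinfeldCat (fusionTensor tg th I) Φ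

/-- The functor `F^p : U(g^I ⊕ h)-Mod^Φ_ħ → U(g^J ⊕ h)-Mod^Φ_ħ`, the restriction along `p^!`. -/
def fusionFunctor {I J : Type w} [Fintype I] [Fintype J] (p : I → J) :
    FusionCat tg th Φ I ⥤ FusionCat tg th Φ J where
  obj X := ⟨X.V, X.ρ.comp (pullback p)⟩
  map f := ⟨f.coeff, fun n a => f.equivariant n (pullback p a)⟩
  map_id _ := rfl
  map_comp _ _ := rfl

variable (K g) in
/-- `U(g^I)`. -/
abbrev UPow (I : Type w) := UniversalEnvelopingAlgebra K (I → g)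

variable (K g) in
/-- The strand `i` in `U(g^I) = U(g)^{⊗ I}`. -/
noncomputable def strand {I : Type w} (i : I) : g →ₗ[K] UPow K g I :=
  (UniversalEnvelopingAlgebra.ι K).comp (single K g i)

variable (K g) in
/-- The strands `i^a` and `i^b` in `U(g^I) ⊗ U(g^I)`. -/
noncomputable def strandTwo {I : Type w} : I ⊕ I → (g →ₗ[K] UPow K g I ⊗[K] UPow K g I)
  | Sum.inl i => Algebra.TensorProduct.includeLeft.toLinearMap ∘ₗ strand K g i
  | Sum.inr i => Algebra.TensorProduct.includeRight.toLinearMap ∘ₗ strand K g i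

lemma commute_strand {I : Type w} {i j : I} (hij : i ≠ j) (a b : g) :
    Commute (strand K g i a) (strand K g j b) := by
  have h1 := (UniversalEnvelopingAlgebra.ι K (L := I → g)).map_lie (single K g i a) (single K g j b)
  rw [single_bracket_single hij, map_zero, LieRing.of_associative_ring_bracket, eq_comm,
    sub_eq_zero] at h1
  exact h1

lemma commute_strandTwo {I : Type w} {s s' : I ⊕ I} (hs : Sum.elim id id s ≠ Sum.elim id id s')
    (a b : g) : Commute (strandTwo K g s a) (strandTwo K g s' b) := by
  rcases s with i | i <;> rcases s' with j | j
  · exact (commute_strand hs a b).map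
      (Algebra.TensorProduct.includeLeft : UPow K g I →ₐ[K] UPow K g I ⊗[K] UPow K g I)
  · simp [strandTwo, Commute, SemiconjBy]
  · simp [strandTwo, Commute, SemiconjBy]
  · exact (commute_strand hs a b).map
      (Algebra.TensorProduct.includeRight : UPow K g I →ₐ[K] UPow K g I ⊗[K] UPow K g I)

variable (tg Φ) in
/-- The element of `U(g^I) ⊗ U(g^I)⟦ħ⟧` which corresponds to the parenthesized braid from
`T^{(a)} T^{(b)}` to `T^{(ab)}`; it is `1` for the empty word. -/
noncomputable def braidElement {I : Type w} (T : WithOne (FreeMagma I)) :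
    PowerSeries (UPow K g I ⊗[K] UPow K g I) :=
  WithOne.recOneCoe 1 (fun T => (shuffleBraid T).eval tg Φ (strandTwo K g)) T

lemma mem_leaves_treeA_treeB {I : Type w} (T : FreeMagma I) (s : I ⊕ I)
    (hs : s ∈ leaves (treeA T * treeB T)) : Sum.elim id id s ∈ leaves T := by
  have hA : ∀ T : FreeMagma I, leaves (treeA T) = (leaves T).map Sum.inl := by
    intro T
    induction T using FreeMagma.recOnMul with
    | ih1 i => rfl
    | ih2 a b ha hb =>
      change leaves (treeA a) ++ leaves (treeA b) = (leaves a ++ leaves b).map _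
      rw [ha, hb, List.map_append]
  have hB : ∀ T : FreeMagma I, leaves (treeB T) = (leaves T).map Sum.inr := by
    intro T
    induction T using FreeMagma.recOnMul with
    | ih1 i => rfl
    | ih2 a b ha hb =>
      change leaves (treeB a) ++ leaves (treeB b) = (leaves a ++ leaves b).map _
      rw [ha, hb, List.map_append]
  change s ∈ leaves (treeA T) ++ leaves (treeB T) at hs
  rw [hA, hB, List.mem_append, List.mem_map, List.mem_map] at hs
  rcases hs with ⟨i, hi, rfl⟩ | ⟨i, hi, rfl⟩ <;> exact hi

lemma braidElement_commute {I : Type w} {T T' : WithOne (FreeMagma I)}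
    (hT : ∀ i ∈ leavesOne T, i ∉ leavesOne T') :
    Commute (braidElement tg Φ T) (braidElement tg Φ T') := by
  induction T with
  | one => exact Commute.one_left _
  | coe T =>
    induction T' with
    | one => exact Commute.one_right _
    | coe T' =>
      refine ParBraid.eval_commute _ _ fun s hs s' hs' y z => commute_strandTwo ?_ y z
      intro e
      refine hT _ (mem_leaves_treeA_treeB T s hs) ?_
      rw [e]
      exact mem_leaves_treeA_treeB T' s' hs'

lemma ParMor.leaves_disjoint {I J : Type w} (p : ParMor I J) {j j' : J} (hj : j ≠ j') :
    ∀ i ∈ leavesOne (p.paren j), i ∉ leavesOne (p.paren j') := by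
  intro i hi hi'
  rw [p.leaves_paren, p.mem] at hi hi'
  exact hj (hi.symm.trans hi')

variable (tg Φ) in
/-- The element `ν^p = ∏ j, K_j` (the factors commute). -/
noncomputable def nu {I J : Type w} [Fintype J] (p : ParMor I J) :
    PowerSeries (UPow K g I ⊗[K] UPow K g I) :=
  Finset.univ.noncommProd (fun j => braidElement tg Φ (p.paren j))
    fun _ _ _ _ hj => braidElement_commute (p.leaves_disjoint hj)

/-- A reparenthesization, written as an iterated composite of elementary ones, between possibly
empty parenthesized words. -/
inductive Reparen {I : Type w} : WithOne (FreeMagma I) → WithOne (FreeMagma I) → Type w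
  | empty : Reparen 1 1
  | word {a b : FreeMagma I} (f : ParBraid a b) (hf : f.NoCross) :
      Reparen (a : WithOne (FreeMagma I)) (b : WithOne (FreeMagma I))

variable (tg Φ) in
/-- The composite of associators in `U(g^I)⟦ħ⟧` given by a reparenthesization. -/
noncomputable def Reparen.eval {I : Type w} : {T T' : WithOne (FreeMagma I)} → Reparen T T' →
    PowerSeries (UPow K g I)
  | _, _, .empty => 1
  | _, _, .word f _ => f.eval tg Φ (strand K g)

lemma Reparen.eval_commute {I : Type w} {T₁ T₁' T₂ T₂' : WithOne (FreeMagma I)}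
    (f₁ : Reparen T₁ T₁') (f₂ : Reparen T₂ T₂') (hT : ∀ i ∈ leavesOne T₁, i ∉ leavesOne T₂) :
    Commute (f₁.eval tg Φ) (f₂.eval tg Φ) := by
  cases f₁ with
  | empty => exact Commute.one_left _
  | word f₁ _ =>
    cases f₂ with
    | empty => exact Commute.one_right _
    | word f₂ _ =>
      refine ParBraid.eval_commute _ _ fun i hi i' hi' y z => commute_strand ?_ y z
      rintro rfl
      exact hT _ hi hi'

variable (tg Φ) in
/-- The higher associator `Φ^{p,p'}` in `U(g^I)⟦ħ⟧`, computed from a reparenthesization of each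
fibre (the factors commute). -/
noncomputable def higherAssoc {I J : Type w} [Fintype J] {p p' : ParMor I J}
    (r : ∀ j, Reparen (p.paren j) (p'.paren j)) : PowerSeries (UPow K g I) :=
  Finset.univ.noncommProd (fun j => (r j).eval tg Φ)
    fun _ _ _ _ hj => (r _).eval_commute (r _) (p.leaves_disjoint hj)

open MonoidalCategory

/-- The action of `U(g^I)` on a `U(g^I ⊕ h)`-module. -/
noncomputable def actOne {I : Type w} [Fintype I] (X : FusionCat tg th Φ I) :
    UPow K g I →ₐ[K] End X.V :=
  UniversalEnvelopingAlgebra.lift K (X.ρ.comp (LieHom.inl K (I → g) h))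

/-- The action of `U(g^I) ⊗ U(g^I)` on the tensor product of two `U(g^I ⊕ h)`-modules. -/
noncomputable def actTwo {I : Type w} [Fintype I] (X Y : FusionCat tg th Φ I) :
    UPow K g I ⊗[K] UPow K g I →ₐ[K] End (X.V ⊗ Y.V) :=
  Algebra.TensorProduct.lift ((rAlg K X.V Y.V).comp (actOne X)) ((lAlg K X.V Y.V).comp (actOne Y))
    fun _ _ => commute_rAlg_lAlg (K := K) _ _

open Functor.LaxMonoidal in
variable (tg th Φ) in
/-- The monoidal structure on `F^p`: the unit coherence map is the identity, and the coherence map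
`F^p X ⊗ F^p Y ⟶ F^p (X ⊗ Y)` is the action of `ν^p`. -/
structure FusionStructure {I J : Type w} [Fintype I] [Fintype J] (p : ParMor I J) where
  lax : (fusionFunctor (tg := tg) (th := th) (Φ := Φ) p.map).LaxMonoidal
  isIso_ε : IsIso lax.ε
  isIso_μ : ∀ X Y, IsIso (lax.μ X Y)
  ε_coeff : lax.ε.coeff = cst (𝟙 (𝟙_ (ModuleCat.{u} K)))
  μ_coeff : ∀ X Y : FusionCat tg th Φ I, (lax.μ X Y).coeff =
    endCoeff (PowerSeries.map (actTwo X Y : _ →+* End (X.V ⊗ Y.V)) (nu tg Φ p))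

/-- The quantum fusion functor, as a monoidal functor. -/
noncomputable def FusionStructure.functor {I J : Type w} [Fintype I] [Fintype J] {p : ParMor I J}
    (M : FusionStructure tg th Φ p) : MonFunctor (FusionCat tg th Φ I) (FusionCat tg th Φ J) where
  toLaxMonoidalFunctor := ⟨fusionFunctor p.map, M.lax⟩
  isIso_ε := M.isIso_ε
  isIso_μ := M.isIso_μ

/-- A monoidal natural transformation from `F^p` to `F^{p'}` is given by the action of the higher
associator `Φ^{p,p'}`: `p` and `p'` are related by a reparenthesization, and every
reparenthesization yields the action in question. -/
def IsHigherAssoc {I J : Type w} [Fintype I] [Fintype J] {p p' : ParMor I J}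
    {M : FusionStructure tg th Φ p} {M' : FusionStructure tg th Φ p'}
    (θ : M.functor ⟶ M'.functor) : Prop :=
  Nonempty (∀ j, Reparen (p.paren j) (p'.paren j)) ∧
    ∀ (r : ∀ j, Reparen (p.paren j) (p'.paren j)) (X : FusionCat tg th Φ I),
      ((MonFunctor.nat θ).app X).coeff =
        endCoeff (PowerSeries.map (actOne X : _ →+* End X.V) (higherAssoc tg Φ r))

/-- The data of the quantum fusion 2-functor: it sends `I` to `U(g^I ⊕ h)-Mod^Φ_ħ` and `p` to
`F^p`. -/
noncomputable def fusionData
    (M : ∀ {I J : FSet.{w}} (p : ParMor I.carrier J.carrier), FusionStructure tg th Φ p)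
    (Θ : ∀ {I J : FSet.{w}} {p p' : ParMor I.carrier J.carrier} (_ : p ⟶ p'),
      (M p).functor ⟶ (M p').functor) :
    PrelaxFunctorStruct FSet.{w} MonoidalCat where
  obj I := MonoidalCat.of (FusionCat tg th Φ I.carrier)
  map p := (M p).functor
  map₂ α := Θ α

end Fusion

end QuantumFusion

open QuantumFusion

/-! The braid elements are studied through the way in which they act. Let actions of a Lie algebra
with invariant tensor `t` on an algebra `A` commute with each other (`CommFam`). A word of strands
acts as a cable, by the sum of the actions of its letters (`listRep`, `repOne`). For a word without
repetitions this is again an action, and every `t^{A,B}` is `t` applied to two cables. So the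
pentagon and the hexagons hold for cables, and finite sets of strands form a braided monoidal
category, `StrandCat`. A morphism there is a bijection of strands with a power series depending on
the actions. The series commutes with everything that commutes with the strands (locality) and with
the sum of all the actions (equivariance). Locality yields the interchange law. Together with
equivariance it makes the associator and the braiding natural.

Two general facts are read off from this category. By Mac Lane's coherence theorem parallel
reparenthesizations have the same value (`ParBraid.eval_eq_of_noCross`). And in a braided category
the tensor product is itself a monoidal functor, by means of the middle interchange `(ab)(cd) →
(ac)(bd)`. This is the content of `interchangeElt_assoc` and `associator_interchangeElt`.

The shuffle braid is a recursive composite of middle interchanges: `K_{xy} = K_x K_y I(x,y)`, where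
`I` is the interchange of the four cables of `x` and `y` (`shuffleElt_mul`). This also holds for
empty words, because the pentagon forces `Φ(0,y) = Φ(x,0) = 1`. Induction on words then gives three
facts: compatibility with the associators of three modules (`assocElt_shuffleElt`), naturality with
respect to reparenthesizations (`Reparen.shuffleElt_evalRep`), and the factorization under
substitution of words (`shuffleElt_substOne`). Different fibres commute by locality, so taking
products over the fibres gives `assocElt_nuRep`, `nuRep_higherRep` and `nuRep_comp`.

For modules, the `j`-th copy of `g` acts on `F^p X` through the cable of the fibre over `j`
(`strands_pullback`). Because `Φ` is group-like, the associator of `g^I ⊕ h` is the product of the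
associators of the copies of `g` and of the one for `h` (`evalh_fusionTensor`). The latter is the
same before and after restriction and commutes with `ν^p`. Hence `assocElt_nuRep` says that `F^p` is
monoidal, `nuRep_higherRep` that `Φ^{p,p'}` is a monoidal transformation, and `nuRep_comp` that
composition is strictly preserved. Coherence gives the independence of choices, the vertical
composition and the whiskering of the `Φ^{p,p'}`. Naturality in the modules needs no computation:
the same formulas are evaluated in the algebra of intertwined pairs of endomorphisms
(`intertwine_of_map`). -/

namespace QuantumFusion

attribute [local instance 100] LieRing.ofAssociativeRing

/-! ### Series in `ħ`, and the associator equations for commuting actions -/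

section Algebra

open PowerSeries (C coeff)

variable {K : Type u} [Field K] {L : Type v} [LieRing L] [LieAlgebra K L]
  {A : Type w} [Ring A] [Algebra K A]

/-- An element which acts on `f` and `g` through the adjoint action of `z` commutes with the image
of an invariant tensor. -/
lemma InvTensor.commute_act_of_lie (t : InvTensor K L) {f g : L →ₗ[K] A} {y : A} {z : L}
    (hf : ∀ a, y * f a - f a * y = f ⁅z, a⁆) (hg : ∀ a, y * g a - g a * y = g ⁅z, a⁆) :
    Commute y (t.act f g) := by
  have key : ∀ s : L ⊗[K] L,
      y * LinearMap.mul' K A (TensorProduct.map f g s) -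
        LinearMap.mul' K A (TensorProduct.map f g s) * y =
      LinearMap.mul' K A (TensorProduct.map f g ⁅z, s⁆) := by
    intro s
    induction s using TensorProduct.induction_on with
    | zero => simp
    | tmul a b =>
      simp only [TensorProduct.map_tmul, LinearMap.mul'_apply,
        TensorProduct.LieModule.lie_tmul_right, map_add, ← hf, ← hg]
      noncomm_ring
    | add a b ha hb =>
      rw [lie_add, map_add, map_add, map_add, map_add, ← ha, ← hb]
      noncomm_ring
  have := key t.val
  rw [t.inv, map_zero, map_zero, sub_eq_zero] at this
  exact this

/-- Since `ħ` is central, commutation of series can be tested on coefficients. All later commutation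
arguments are reduced in this way to the generators. -/
lemma commute_of_coeff {P Q : PowerSeries A} (h : ∀ n, Commute (C (coeff n P)) Q) :
    Commute P Q := by
  have h' := fun n => (commute_C_iff _ _).1 (h n)
  ext n
  rw [PowerSeries.coeff_mul, PowerSeries.coeff_mul, ← Finset.Nat.sum_antidiagonal_swap]
  exact Finset.sum_congr rfl fun p _ => h' _ _

lemma commute_C_add {x y : A} {P : PowerSeries A} (hx : Commute (C x) P) (hy : Commute (C y) P) :
    Commute (C (x + y)) P := by
  rw [map_add]
  exact hx.add_left hy

lemma commute_C_act {t : InvTensor K L} {f g : L →ₗ[K] A} {P : PowerSeries A}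
    (hf : ∀ a, Commute (C (f a)) P) (hg : ∀ a, Commute (C (g a)) P) :
    Commute (C (t.act f g)) P :=
  (commute_C_iff _ _).2 fun n => (t.commute_act (fun a => ((commute_C_iff _ _).1 (hf a) n).symm)
    (fun a => ((commute_C_iff _ _).1 (hg a) n).symm)).symm

lemma NCSeries.commute_evalh_left (Φ : NCSeries K) {x y : A} {P : PowerSeries A}
    (hx : Commute (C x) P) (hy : Commute (C y) P) : Commute (Φ.evalh x y) P := by
  refine (commute_of_coeff fun m => (commute_C_iff _ _).2 fun n => ?_).symm
  exact Φ.commute_evalh ((commute_C_iff _ _).1 hx m).symm ((commute_C_iff _ _).1 hy m).symm n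

lemma commute_exph {z x : A} (h : Commute z x) : Commute (C z) (exph K x) := by
  refine (commute_C_iff _ _).2 fun n => ?_
  rw [exph, PowerSeries.coeff_mk]
  exact (h.pow_right n).smul_right _

lemma commute_exph_left {x : A} {P : PowerSeries A} (hx : Commute (C x) P) :
    Commute (exph K x) P := by
  refine (commute_of_coeff fun m => ?_).symm
  exact commute_exph ((commute_C_iff _ _).1 hx m).symm

lemma commute_C_evalh {Φ : NCSeries K} {z x y : A} (hx : Commute z x) (hy : Commute z y) :
    Commute (C z) (Φ.evalh x y) := (commute_C_iff _ _).2 (Φ.commute_evalh hx hy)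

lemma commute_C_smul {x : A} {P : PowerSeries A} (c : K) (hx : Commute (C x) P) :
    Commute (C (c • x)) P := by
  refine (commute_C_iff _ _).2 fun n => ?_
  exact ((commute_C_iff _ _).1 hx n).smul_left c

lemma psInv_one : psInv (1 : PowerSeries A) = 1 := Ring.inverse_one _

lemma exph_zero : exph K (0 : A) = 1 := by
  ext n
  rw [exph, PowerSeries.coeff_mk, PowerSeries.coeff_one]
  cases n <;> simp

lemma map_exph {B : Type x} [Ring B] [Algebra K B] (φ : A →ₐ[K] B) (a : A) :
    PowerSeries.map φ.toRingHom (exph K a) = exph K (φ a) := by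
  ext n
  simp [exph]

lemma isUnit_exph (x : A) : IsUnit (exph K x) := by
  rw [PowerSeries.isUnit_iff_constantCoeff, ← PowerSeries.coeff_zero_eq_constantCoeff_apply,
    exph, PowerSeries.coeff_mk]
  simp

/-- The unit hypothesis is essential: `Ring.inverse` is `0` on non-units, and a homomorphism may
turn a non-unit into a unit. -/
lemma map_psInv {B : Type x} [Ring B] (φ : A →+* B) {P : PowerSeries A} (hP : IsUnit P) :
    PowerSeries.map φ (psInv P) = psInv (PowerSeries.map φ P) := by
  obtain ⟨P, rfl⟩ := hP
  rw [psInv, psInv, Ring.inverse_unit]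
  have h : PowerSeries.map φ (P : PowerSeries A) =
    ((Units.map (PowerSeries.map φ : PowerSeries A →* PowerSeries B) P : (PowerSeries B)ˣ) :
      PowerSeries B) := rfl
  rw [h, Ring.inverse_unit]
  rfl

namespace DrinfeldAssociator

variable (Φ : DrinfeldAssociator K)

/-- A homomorphism from `DK K n` to a commutative algebra is the same as a symmetric matrix with
zero diagonal. -/
noncomputable def _root_.QuantumFusion.DK.liftComm {B : Type x} [CommRing B] [Algebra K B] {n : ℕ}
    (m : Fin n → Fin n → B) (h : ∀ i j, m i j = m j i) (h0 : ∀ i, m i i = 0) : DK K n →ₐ[K] B :=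
  RingQuot.liftAlgHom K ⟨FreeAlgebra.lift K fun p : Fin n × Fin n => m p.1 p.2, by
    intro x y hxy
    induction hxy with
    | diag i => simp [h0]
    | symm i j => simp [h i j]
    | locality => simp only [map_mul, mul_comm]
    | fourTerm => simp only [map_mul, mul_comm]⟩

lemma _root_.QuantumFusion.DK.liftComm_t {B : Type x} [CommRing B] [Algebra K B] {n : ℕ}
    (m : Fin n → Fin n → B) (h : ∀ i j, m i j = m j i) (h0 : ∀ i, m i i = 0) (i j : Fin n) :
    DK.liftComm (K := K) m h h0 (DK.t K i j) = m i j := by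
  simp [DK.liftComm, DK.t]

lemma isUnit_evalh (x y : A) : IsUnit (Φ.series.evalh x y) :=
  Φ.series.isUnit_evalh Φ.coeff_nil x y

lemma evalh_zero_zero : Φ.series.evalh (0 : A) 0 = 1 := DrinfeldCat.evalh_zero

/-- Map the pentagon to the commutative algebra `K[X]` so that only the strands `2` and `3`
interact, with `t^{2,3} = X`. What remains is `φ = φ * φ` for the unit `φ = Φ(0, X)`, hence `φ = 1`.
The general case follows by `X ↦ y`. This and its mirror image are what allows empty words and
trivial modules. -/
lemma evalh_zero_left (y : A) : Φ.series.evalh 0 y = 1 := by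
  have key : Φ.series.evalh (0 : Polynomial K) Polynomial.X = 1 := by
    let m : Fin 4 → Fin 4 → Polynomial K :=
      ![![0, 0, 0, 0], ![0, 0, 0, 0], ![0, 0, 0, Polynomial.X], ![0, 0, Polynomial.X, 0]]
    have h := congrArg (PowerSeries.map (DK.liftComm (K := K) m
      (by intro i j; fin_cases i <;> fin_cases j <;> rfl)
      (by intro i; fin_cases i <;> rfl)).toRingHom) Φ.pentagon
    simp only [map_mul, NCSeries.map_evalh, map_add, DK.liftComm_t, m] at h
    simp only [Matrix.cons_val, add_zero, zero_add, evalh_zero_zero, one_mul, mul_one] at h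
    have hu := Φ.isUnit_evalh (0 : Polynomial K) Polynomial.X
    exact (hu.mul_left_cancel ((mul_one _).trans h)).symm
  have h := congrArg (PowerSeries.map (Polynomial.aeval (R := K) y).toRingHom) key
  rw [NCSeries.map_evalh, map_zero, Polynomial.aeval_X, map_one] at h
  exact h

/-- The mirror image of `evalh_zero_left`: only the strands `0` and `1` interact. -/
lemma evalh_zero_right (y : A) : Φ.series.evalh y 0 = 1 := by
  have key : Φ.series.evalh (Polynomial.X : Polynomial K) 0 = 1 := by
    let m : Fin 4 → Fin 4 → Polynomial K :=
      ![![0, Polynomial.X, 0, 0], ![Polynomial.X, 0, 0, 0], ![0, 0, 0, 0], ![0, 0, 0, 0]]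
    have h := congrArg (PowerSeries.map (DK.liftComm (K := K) m
      (by intro i j; fin_cases i <;> fin_cases j <;> rfl)
      (by intro i; fin_cases i <;> rfl)).toRingHom) Φ.pentagon
    simp only [map_mul, NCSeries.map_evalh, map_add, DK.liftComm_t, m] at h
    simp only [Matrix.cons_val, add_zero, evalh_zero_zero, one_mul, mul_one] at h
    have hu := Φ.isUnit_evalh (Polynomial.X : Polynomial K) 0
    exact (hu.mul_left_cancel ((mul_one _).trans h)).symm
  have h := congrArg (PowerSeries.map (Polynomial.aeval (R := K) y).toRingHom) key
  rw [NCSeries.map_evalh, map_zero, Polynomial.aeval_X, map_one] at h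
  exact h

lemma _root_.QuantumFusion.commute_freeAlgebra_lift {S : Type x} {f : S → A} {z : A}
    (h : ∀ s, Commute z (f s)) (a : FreeAlgebra K S) : Commute z (FreeAlgebra.lift K f a) := by
  induction a using FreeAlgebra.induction with
  | grade0 r => simpa using Algebra.commute_algebraMap_right r z
  | grade1 s => simpa using h s
  | mul a b ha hb => simpa using ha.mul_right hb
  | add a b ha hb => simpa using ha.add_right hb

/-- A group-like series is multiplicative on commuting pairs of arguments. -/
lemma evalh_add {x₁ y₁ x₂ y₂ : A} (hxx : Commute x₁ x₂) (hxy : Commute x₁ y₂)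
    (hyx : Commute y₁ x₂) (hyy : Commute y₁ y₂) :
    Φ.series.evalh (x₁ + x₂) (y₁ + y₂) = Φ.series.evalh x₁ y₁ * Φ.series.evalh x₂ y₂ := by
  have hc : ∀ a b, Commute (FreeAlgebra.lift K ![x₁, y₁] a) (FreeAlgebra.lift K ![x₂, y₂] b) := by
    intro a b
    refine commute_freeAlgebra_lift (fun i => ?_) b
    refine (commute_freeAlgebra_lift (fun j => ?_) a).symm
    fin_cases i <;> fin_cases j
    · exact hxx.symm
    · exact hyx.symm
    · exact hxy.symm
    · exact hyy.symm
  -- The two free algebras have commuting images, so they induce a homomorphism from their tensor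
  -- product. It carries the equation of group-likeness to the claim.
  have h := congrArg (PowerSeries.map (Algebra.TensorProduct.lift (FreeAlgebra.lift K ![x₁, y₁])
    (FreeAlgebra.lift K ![x₂, y₂]) hc).toRingHom) Φ.groupLike
  simpa only [map_mul, NCSeries.map_evalh, map_add, Algebra.TensorProduct.lift_tmul, map_one,
    one_mul, mul_one, FreeAlgebra.lift_ι_apply, Matrix.cons_val] using h

end DrinfeldAssociator

/-- A linear map which is a homomorphism of Lie algebras. -/
def IsRep (f : L →ₗ[K] A) : Prop := ∀ a b, f a * f b - f b * f a = f ⁅a, b⁆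

/-- The homomorphism of Lie algebras. -/
def IsRep.toLieHom {f : L →ₗ[K] A} (h : IsRep f) : L →ₗ⁅K⁆ A :=
  { f with map_lie' := fun {a b} => (h a b).symm }

lemma isRep_lieHom (f : L →ₗ⁅K⁆ A) : IsRep (f : L →ₗ[K] A) := fun a b => (f.map_lie a b).symm

/-- The values of `f` commute with the values of `g`. -/
def Comm (f g : L →ₗ[K] A) : Prop := ∀ a b, Commute (f a) (g b)

lemma Comm.symm {f g : L →ₗ[K] A} (h : Comm f g) : Comm g f := fun a b => (h b a).symm

lemma Comm.add_left {f f' g : L →ₗ[K] A} (h : Comm f g) (h' : Comm f' g) : Comm (f + f') g :=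
  fun a b => (h a b).add_left (h' a b)

lemma Comm.add_right {f g g' : L →ₗ[K] A} (h : Comm f g) (h' : Comm f g') : Comm f (g + g') :=
  fun a b => (h a b).add_right (h' a b)

lemma Comm.zero_right (f : L →ₗ[K] A) : Comm f 0 := fun _ _ => Commute.zero_right _

lemma IsRep.zero : IsRep (0 : L →ₗ[K] A) := fun a b => by simp

lemma IsRep.add {f g : L →ₗ[K] A} (hf : IsRep f) (hg : IsRep g) (h : Comm f g) :
    IsRep (f + g) := by
  intro a b
  have h1 := (h a b).eq
  have h2 := (h b a).eq
  simp only [LinearMap.add_apply, ← hf a b, ← hg a b, add_mul, mul_add, h1, h2]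
  abel

variable (t : InvTensor K L) (Φ : DrinfeldAssociator K)

/-- Only commuting actions are required, so each of the four strands may be a cable. The maps are
linear maps with a property, rather than bundled homomorphisms, because cables are sums of linear
maps. -/
lemma pentagon_of_isRep {f₀ f₁ f₂ f₃ : L →ₗ[K] A} (h₀ : IsRep f₀) (h₁ : IsRep f₁)
    (h₂ : IsRep f₂) (h₃ : IsRep f₃) (h01 : Comm f₀ f₁) (h02 : Comm f₀ f₂) (h03 : Comm f₀ f₃)
    (h12 : Comm f₁ f₂) (h13 : Comm f₁ f₃) (h23 : Comm f₂ f₃) :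
    Φ.series.evalh (t.act f₀ f₁) (t.act f₁ f₂ + t.act f₁ f₃) *
        Φ.series.evalh (t.act f₀ f₂ + t.act f₁ f₂) (t.act f₂ f₃) =
      Φ.series.evalh (t.act f₁ f₂) (t.act f₂ f₃) *
        Φ.series.evalh (t.act f₀ f₁ + t.act f₀ f₂) (t.act f₁ f₃ + t.act f₂ f₃) *
          Φ.series.evalh (t.act f₀ f₁) (t.act f₁ f₂) :=
  pentagon_act t Φ h₀.toLieHom h₁.toLieHom h₂.toLieHom h₃.toLieHom h01 h02 h03 h12 h13 h23

/-- The action of the infinitesimal braids on three strands. -/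
noncomputable def strandHomThree {f₀ f₁ f₂ : L →ₗ[K] A} (h₀ : IsRep f₀) (h₁ : IsRep f₁)
    (h₂ : IsRep f₂) (h01 : Comm f₀ f₁) (h02 : Comm f₀ f₂) (h12 : Comm f₁ f₂) :
    DK K 3 →ₐ[K] A :=
  strandHom t ![h₀.toLieHom, h₁.toLieHom, h₂.toLieHom] (by
    intro i j hij a b
    fin_cases i <;> fin_cases j <;> first | exact absurd rfl hij | skip
    · exact h01 a b
    · exact h02 a b
    · exact (h01 b a).symm
    · exact h12 a b
    · exact (h02 b a).symm
    · exact (h12 b a).symm)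

lemma strandHomThree_t {f₀ f₁ f₂ : L →ₗ[K] A} (h₀ : IsRep f₀) (h₁ : IsRep f₁)
    (h₂ : IsRep f₂) (h01 : Comm f₀ f₁) (h02 : Comm f₀ f₂) (h12 : Comm f₁ f₂) {i j : Fin 3}
    (hij : i ≠ j) :
    strandHomThree t h₀ h₁ h₂ h01 h02 h12 (DK.t K i j) =
      t.act (![f₀, f₁, f₂] i) (![f₀, f₁, f₂] j) := by
  rw [strandHomThree, strandHom_t _ _ _ hij]
  have : ∀ i, (((![h₀.toLieHom, h₁.toLieHom, h₂.toLieHom] : Fin 3 → (L →ₗ⁅K⁆ A)) i :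
      L →ₗ⁅K⁆ A) : L →ₗ[K] A) = ![f₀, f₁, f₂] i := by
    intro i
    fin_cases i <;> rfl
  rw [this, this]

section Hexagon

variable {f₀ f₁ f₂ : L →ₗ[K] A}

/-- Commuting actions define a homomorphism from `DK K 3`, along which the hexagon equation is
transported. The inverse in it survives because values of `Φ` are units. -/
lemma hexagon_of_isRep (h₀ : IsRep f₀) (h₁ : IsRep f₁) (h₂ : IsRep f₂)
    (h01 : Comm f₀ f₁) (h02 : Comm f₀ f₂) (h12 : Comm f₁ f₂) :
    exph K ((2 : K)⁻¹ • (t.act f₀ f₂ + t.act f₁ f₂)) =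
      Φ.series.evalh (t.act f₀ f₂) (t.act f₀ f₁) * exph K ((2 : K)⁻¹ • t.act f₀ f₂) *
        psInv (Φ.series.evalh (t.act f₀ f₂) (t.act f₁ f₂)) *
          exph K ((2 : K)⁻¹ • t.act f₁ f₂) * Φ.series.evalh (t.act f₀ f₁) (t.act f₁ f₂) := by
  have h := congrArg (PowerSeries.map (strandHomThree t h₀ h₁ h₂ h01 h02 h12).toRingHom) Φ.hexagon
  simp only [map_mul, map_psInv _ (Φ.isUnit_evalh _ _), NCSeries.map_evalh, map_exph, map_add,
    map_smul] at h
  rwa [strandHomThree_t _ _ _ _ _ _ _ (by decide), strandHomThree_t _ _ _ _ _ _ _ (by decide),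
    strandHomThree_t _ _ _ _ _ _ _ (by decide)] at h

lemma hexagon'_of_isRep (h₀ : IsRep f₀) (h₁ : IsRep f₁) (h₂ : IsRep f₂)
    (h01 : Comm f₀ f₁) (h02 : Comm f₀ f₂) (h12 : Comm f₁ f₂) :
    exph K ((2 : K)⁻¹ • (t.act f₀ f₁ + t.act f₀ f₂)) =
      psInv (Φ.series.evalh (t.act f₁ f₂) (t.act f₀ f₂)) * exph K ((2 : K)⁻¹ • t.act f₀ f₂) *
        Φ.series.evalh (t.act f₀ f₁) (t.act f₀ f₂) * exph K ((2 : K)⁻¹ • t.act f₀ f₁) *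
          psInv (Φ.series.evalh (t.act f₀ f₁) (t.act f₁ f₂)) := by
  have h := congrArg (PowerSeries.map (strandHomThree t h₀ h₁ h₂ h01 h02 h12).toRingHom) Φ.hexagon'
  simp only [map_mul, map_psInv _ (Φ.isUnit_evalh _ _), NCSeries.map_evalh, map_exph, map_add,
    map_smul] at h
  rwa [strandHomThree_t _ _ _ _ _ _ _ (by decide), strandHomThree_t _ _ _ _ _ _ _ (by decide),
    strandHomThree_t _ _ _ _ _ _ _ (by decide)] at h

end Hexagon

end Algebra

/-! ### The monoidal category of finite sets of strands -/

section StrandCat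

open PowerSeries (C coeff)

variable {K : Type u} [Field K] {L : Type v} [LieRing L] [LieAlgebra K L]
  {A : Type w} [Ring A] [Algebra K A]

/-- A family of pairwise commuting actions. -/
structure CommFam {S : Type x} (R : S → (L →ₗ[K] A)) : Prop where
  rep : ∀ s, IsRep (R s)
  comm : ∀ s s', s ≠ s' → Comm (R s) (R s')

lemma CommFam.comp {S : Type x} {R : S → (L →ₗ[K] A)} (h : CommFam R) {T : Type*} {e : T → S}
    (he : Function.Injective e) : CommFam (R ∘ e) :=
  ⟨fun _ => h.rep _, fun _ _ hs => h.comm _ _ (he.ne hs)⟩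

lemma Comm.sum_left {S : Type x} {F : Finset S} {R : S → (L →ₗ[K] A)} {f : L →ₗ[K] A}
    (h : ∀ s ∈ F, Comm (R s) f) : Comm (∑ s ∈ F, R s) f := by
  intro a b
  rw [LinearMap.sum_apply]
  exact Commute.sum_left _ _ _ fun s hs => h s hs a b

/-- All summands except the one with index `s` commute with `R s`, and that one acts by the bracket.
This is the source of all equivariance statements. -/
lemma CommFam.lie_sum {S : Type x} [Fintype S] {R : S → (L →ₗ[K] A)} (h : CommFam R) (s : S)
    (z a : L) : (∑ r, R r) z * R s a - R s a * (∑ r, R r) z = R s ⁅z, a⁆ := by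
  classical
  rw [LinearMap.sum_apply, Finset.sum_mul, Finset.mul_sum, ← Finset.sum_sub_distrib,
    Finset.sum_eq_single s]
  · exact h.rep s z a
  · intro r _ hr
    rw [(h.comm r s hr z a).eq, sub_self]
  · simp

lemma CommFam.lie_sum_sum {S : Type x} [Fintype S] {R : S → (L →ₗ[K] A)} (h : CommFam R)
    {T : Type*} (F : Finset T) (e : T → S) (z a : L) :
    (∑ r, R r) z * (∑ s ∈ F, R (e s)) a - (∑ s ∈ F, R (e s)) a * (∑ r, R r) z =
      (∑ s ∈ F, R (e s)) ⁅z, a⁆ := by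
  rw [LinearMap.sum_apply _ _ a, LinearMap.sum_apply _ _ ⁅z, a⁆, Finset.sum_mul, Finset.mul_sum,
    ← Finset.sum_sub_distrib]
  exact Finset.sum_congr rfl fun s _ => h.lie_sum _ z a

lemma CommFam.isRep_sum {S : Type x} [Fintype S] {R : S → (L →ₗ[K] A)} (h : CommFam R) :
    IsRep (∑ s, R s) := by
  intro a b
  exact h.lie_sum_sum Finset.univ id a b

variable (K L A) in
/-- The families of commuting actions of `L` on `A` indexed by `S`. -/
def Fam (S : Type x) := {R : S → (L →ₗ[K] A) // CommFam R}

namespace Fam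

variable {S T U : Type}

/-- Reindexing along an injective map. -/
def comap (R : Fam K L A S) (e : T → S) (he : Function.Injective e) : Fam K L A T :=
  ⟨R.1 ∘ e, R.2.comp he⟩

/-- The family of the left summand. -/
def left (R : Fam K L A (S ⊕ T)) : Fam K L A S := R.comap Sum.inl Sum.inl_injective

/-- The family of the right summand. -/
def right (R : Fam K L A (S ⊕ T)) : Fam K L A T := R.comap Sum.inr Sum.inr_injective

/-- Reindexing along a bijection. -/
def push (R : Fam K L A S) (e : S ≃ T) : Fam K L A T := R.comap e.symm e.symm.injective

/-- The sum of the actions. -/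
def tot [Fintype S] (R : Fam K L A S) : L →ₗ[K] A := ∑ s, R.1 s

lemma isRep_tot [Fintype S] (R : Fam K L A S) : IsRep R.tot := R.2.isRep_sum

lemma tot_push [Fintype S] [Fintype T] (R : Fam K L A S) (e : S ≃ T) : (R.push e).tot = R.tot :=
  Equiv.sum_comp e.symm R.1

lemma tot_sum [Fintype S] [Fintype T] (R : Fam K L A (S ⊕ T)) :
    R.tot = R.left.tot + R.right.tot := Fintype.sum_sum_type _

lemma commute_tot_push [Fintype S] [Fintype T] {R : Fam K L A S} {e : S ≃ T} {a : L}
    {P : PowerSeries A} (h : Commute (C ((R.push e).tot a)) P) : Commute (C (R.tot a)) P := by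
  rwa [tot_push] at h

lemma commute_tot_sum [Fintype S] [Fintype T] {R : Fam K L A (S ⊕ T)} {a : L}
    {P : PowerSeries A} (h : Commute (C (R.left.tot a)) P) (h' : Commute (C (R.right.tot a)) P) :
    Commute (C (R.tot a)) P := by
  rw [tot_sum]
  exact commute_C_add h h'

lemma push_push_symm (R : Fam K L A S) (e : S ≃ T) : (R.push e).push e.symm = R :=
  Subtype.ext (funext fun s => congrArg R.1 (e.symm_apply_apply s))

lemma comm_tot [Fintype S] (R : Fam K L A S) {f : L →ₗ[K] A} (h : ∀ s, Comm (R.1 s) f) :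
    Comm R.tot f := Comm.sum_left fun s _ => h s

lemma comm_left_right (R : Fam K L A (S ⊕ T)) (s : S) (s' : T) :
    Comm (R.left.1 s) (R.right.1 s') := R.2.comm _ _ Sum.inl_ne_inr

lemma comm_tot_left_right [Fintype S] [Fintype T] (R : Fam K L A (S ⊕ T)) :
    Comm R.left.tot R.right.tot :=
  comm_tot _ fun s => (comm_tot _ fun s' => (R.comm_left_right s s').symm).symm

lemma comm_tot_left [Fintype S] (R : Fam K L A (S ⊕ T)) (s' : T) :
    Comm R.left.tot (R.right.1 s') := comm_tot _ fun s => R.comm_left_right s s'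

lemma comm_tot_right [Fintype T] (R : Fam K L A (S ⊕ T)) (s : S) :
    Comm R.right.tot (R.left.1 s) := comm_tot _ fun s' => (R.comm_left_right s s').symm

end Fam

/-- The objects of the category of infinitesimal braids in `A`: finite sets of strands. -/
structure StrandCat {K : Type u} [Field K] {L : Type v} [LieRing L] [LieAlgebra K L] (A : Type w)
    (t : InvTensor K L) (Φ : DrinfeldAssociator K) where
  carrier : Type
  [fintype : Fintype carrier]

attribute [instance] StrandCat.fintype

namespace StrandCat

variable {t : InvTensor K L} {Φ : DrinfeldAssociator K}

/-- A morphism is a bijection of strands together with a family of local and equivariant power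
series, which depends on the actions of the strands. -/
structure Hom (S T : StrandCat A t Φ) where
  e : S.carrier ≃ T.carrier
  fn : Fam K L A S.carrier → PowerSeries A
  isLocal : ∀ R (z : A), (∀ s a, Commute z (R.1 s a)) → Commute (C z) (fn R)
  equivariant : ∀ R a, Commute (C (R.tot a)) (fn R)

lemma Hom.ext' {S T : StrandCat A t Φ} {f g : Hom S T} (he : ∀ s, f.e s = g.e s)
    (hf : ∀ R, f.fn R = g.fn R) : f = g := by
  obtain ⟨e, f, _, _⟩ := f
  obtain ⟨e', g, _, _⟩ := g
  obtain rfl : e = e' := Equiv.ext he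
  obtain rfl : f = g := funext hf
  rfl

/-- The second series is evaluated at the family transported along the first bijection, and it
multiplies from the left because the series are operators. Since tensor factors are labelled by
strands, no permutation operators appear. -/
noncomputable instance : Category (StrandCat A t Φ) where
  Hom := Hom
  id S := ⟨Equiv.refl _, fun _ => 1, fun _ _ _ => Commute.one_right _,
    fun _ _ => Commute.one_right _⟩
  comp f g :=
    { e := f.e.trans g.e
      fn := fun R => g.fn (R.push f.e) * f.fn R
      isLocal := fun R z h => (g.isLocal _ z fun s a => h _ a).mul_right (f.isLocal R z h)
      equivariant := fun R a => by
        refine Commute.mul_right ?_ (f.equivariant R a)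
        have := g.equivariant (R.push f.e) a
        rwa [Fam.tot_push] at this }
  id_comp f := Hom.ext' (fun _ => rfl) fun R => mul_one _
  comp_id f := Hom.ext' (fun _ => rfl) fun R => one_mul _
  assoc f g h := Hom.ext' (fun _ => rfl) fun R => (mul_assoc _ _ _).symm

lemma hom_ext {S T : StrandCat A t Φ} {f g : S ⟶ T} (he : ∀ s, f.e s = g.e s)
    (hf : ∀ R, f.fn R = g.fn R) : f = g := Hom.ext' he hf

lemma comp_fn {S T U : StrandCat A t Φ} (f : S ⟶ T) (g : T ⟶ U) (R : Fam K L A S.carrier) :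
    (f ≫ g).fn R = g.fn (R.push f.e) * f.fn R := rfl

/-- The disjoint union. -/
abbrev tensor (S T : StrandCat A t Φ) : StrandCat A t Φ := ⟨S.carrier ⊕ T.carrier⟩

/-- The morphism `f ⊗ id`. -/
def whiskR {S S' : StrandCat A t Φ} (f : S ⟶ S') (T : StrandCat A t Φ) :
    tensor S T ⟶ tensor S' T where
  e := Equiv.sumCongr f.e (Equiv.refl _)
  fn R := f.fn (Fam.left R)
  isLocal _ z h := f.isLocal _ z fun _ a => h _ a
  equivariant R a := Fam.commute_tot_sum (f.equivariant _ a)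
    (f.isLocal _ _ fun s b => Fam.comm_tot_right R s a b)

/-- The morphism `id ⊗ f`. -/
def whiskL (S : StrandCat A t Φ) {T T' : StrandCat A t Φ} (f : T ⟶ T') :
    tensor S T ⟶ tensor S T' where
  e := Equiv.sumCongr (Equiv.refl _) f.e
  fn R := f.fn (Fam.right R)
  isLocal _ z h := f.isLocal _ z fun _ a => h _ a
  equivariant R a := Fam.commute_tot_sum
    (f.isLocal _ _ fun s b => Fam.comm_tot_left R s a b) (f.equivariant _ a)

lemma lie_tot_left {S T : Type} [Fintype S] [Fintype T] (R : Fam K L A (S ⊕ T)) (z a : L) :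
    R.tot z * R.left.tot a - R.left.tot a * R.tot z = R.left.tot ⁅z, a⁆ :=
  R.2.lie_sum_sum Finset.univ Sum.inl z a

lemma lie_tot_right {S T : Type} [Fintype S] [Fintype T] (R : Fam K L A (S ⊕ T)) (z a : L) :
    R.tot z * R.right.tot a - R.right.tot a * R.tot z = R.right.tot ⁅z, a⁆ :=
  R.2.lie_sum_sum Finset.univ Sum.inr z a

variable (t Φ) in
/-- The associator of three sets of strands. -/
noncomputable def assocFn {S T U : Type} [Fintype S] [Fintype T] [Fintype U]
    (R : Fam K L A ((S ⊕ T) ⊕ U)) : PowerSeries A :=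
  Φ.series.evalh (t.act R.left.left.tot R.left.right.tot) (t.act R.left.right.tot R.right.tot)

section

variable {S T U : Type} [Fintype S] [Fintype T] [Fintype U] (R : Fam K L A ((S ⊕ T) ⊕ U))

lemma isUnit_assocFn : IsUnit (assocFn t Φ R) := Φ.isUnit_evalh _ _

lemma assocFn_congr {S' T' U' : Type} [Fintype S'] [Fintype T'] [Fintype U']
    {R' : Fam K L A ((S' ⊕ T') ⊕ U')} (h₁ : R.left.left.tot = R'.left.left.tot)
    (h₂ : R.left.right.tot = R'.left.right.tot) (h₃ : R.right.tot = R'.right.tot) :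
    assocFn t Φ R = assocFn t Φ R' := by
  rw [assocFn, assocFn, h₁, h₂, h₃]

lemma assocFn_local (z : A) (h : ∀ s a, Commute z (R.1 s a)) :
    Commute (C z) (assocFn t Φ R) := by
  have h₁ : ∀ a, Commute z (R.left.left.tot a) := fun a => by
    rw [Fam.tot, LinearMap.sum_apply]
    exact Commute.sum_right _ _ _ fun s _ => h _ a
  have h₂ : ∀ a, Commute z (R.left.right.tot a) := fun a => by
    rw [Fam.tot, LinearMap.sum_apply]
    exact Commute.sum_right _ _ _ fun s _ => h _ a
  have h₃ : ∀ a, Commute z (R.right.tot a) := fun a => by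
    rw [Fam.tot, LinearMap.sum_apply]
    exact Commute.sum_right _ _ _ fun s _ => h _ a
  exact commute_C_evalh (t.commute_act h₁ h₂) (t.commute_act h₂ h₃)

/-- The sum of all the actions acts on each of the three cables by the adjoint action, and `t` is
invariant. -/
lemma assocFn_equivariant (a : L) : Commute (C (R.tot a)) (assocFn t Φ R) := by
  have h₁ : ∀ b, R.tot a * R.left.left.tot b - R.left.left.tot b * R.tot a =
      R.left.left.tot ⁅a, b⁆ := R.2.lie_sum_sum Finset.univ (Sum.inl ∘ Sum.inl) a
  have h₂ : ∀ b, R.tot a * R.left.right.tot b - R.left.right.tot b * R.tot a =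
      R.left.right.tot ⁅a, b⁆ := R.2.lie_sum_sum Finset.univ (Sum.inl ∘ Sum.inr) a
  have h₃ : ∀ b, R.tot a * R.right.tot b - R.right.tot b * R.tot a =
      R.right.tot ⁅a, b⁆ := R.2.lie_sum_sum Finset.univ Sum.inr a
  exact commute_C_evalh (t.commute_act_of_lie h₁ h₂) (t.commute_act_of_lie h₂ h₃)

end

/-- The associativity constraint. -/
noncomputable def assoc (S T U : StrandCat A t Φ) :
    tensor (tensor S T) U ≅ tensor S (tensor T U) where
  hom :=
    { e := Equiv.sumAssoc _ _ _
      fn := fun R => assocFn t Φ R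
      isLocal := fun R => assocFn_local R
      equivariant := fun R => assocFn_equivariant R }
  inv :=
    { e := (Equiv.sumAssoc _ _ _).symm
      fn := fun R => psInv (assocFn t Φ (Fam.push R (Equiv.sumAssoc _ _ _).symm))
      isLocal := fun R z h =>
        commute_inverse (assocFn_local (Fam.push R (Equiv.sumAssoc _ _ _).symm) z fun s => h _)
      equivariant := fun R a => commute_inverse (Fam.commute_tot_push
        (assocFn_equivariant (Fam.push R (Equiv.sumAssoc _ _ _).symm) a)) }
  hom_inv_id := hom_ext (fun s => (Equiv.sumAssoc _ _ _).symm_apply_apply s) fun R => by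
    refine (congrArg (fun R' => psInv (assocFn t Φ R') * assocFn t Φ R)
      (Fam.push_push_symm R (Equiv.sumAssoc _ _ _))).trans ?_
    exact Ring.inverse_mul_cancel _ (isUnit_assocFn R)
  inv_hom_id := hom_ext (fun s => (Equiv.sumAssoc _ _ _).apply_symm_apply s) fun R =>
    Ring.mul_inverse_cancel _ (isUnit_assocFn (t := t) (Φ := Φ) _)

/-- A bijection of strands, considered as an isomorphism. -/
noncomputable def bijIso {S T : StrandCat A t Φ} (e : S.carrier ≃ T.carrier) : S ≅ T where
  hom := ⟨e, fun _ => 1, fun _ _ _ => Commute.one_right _, fun _ _ => Commute.one_right _⟩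
  inv := ⟨e.symm, fun _ => 1, fun _ _ _ => Commute.one_right _, fun _ _ => Commute.one_right _⟩
  hom_inv_id := hom_ext (fun s => e.symm_apply_apply s) fun _ => one_mul _
  inv_hom_id := hom_ext (fun s => e.apply_symm_apply s) fun _ => one_mul _

/-- The empty set of strands. -/
def unit : StrandCat A t Φ := ⟨PEmpty⟩

lemma fn_congr {S T : StrandCat A t Φ} (f : S ⟶ T) {R R' : Fam K L A S.carrier}
    (h : ∀ s, R.1 s = R'.1 s) : f.fn R = f.fn R' := by rw [show R = R' from Subtype.ext (funext h)]

lemma commute_of_local {S T : StrandCat A t Φ} (f : S ⟶ T) (R : Fam K L A S.carrier)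
    {P : PowerSeries A} (h : ∀ s a, Commute (C (R.1 s a)) P) : Commute (f.fn R) P := by
  refine (commute_of_coeff fun n => f.isLocal R _ fun s a => ?_).symm
  exact ((commute_C_iff _ _).1 (h s a) n).symm

/-- Locality is imposed on morphisms for this law: strands of different tensor factors commute, so
series local to them commute as well. -/
lemma whisk_exchange {S S' T T' : StrandCat A t Φ} (f : S ⟶ S') (g : T ⟶ T') :
    whiskL S g ≫ whiskR f T' = whiskR f T ≫ whiskL S' g := by
  refine hom_ext (fun s => ?_) fun R => ?_
  · rcases s with s | s <;> rfl
  · have h : Commute (f.fn (Fam.left R)) (g.fn (Fam.right R)) :=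
      commute_of_local f _ fun s a => g.isLocal _ _ fun s' b => Fam.comm_left_right R s s' a b
    exact h.eq

/-- The associator only sees the total actions of the three cables, which a bijection does not
change. It commutes with the series of `f`, by equivariance for the cable on which `f` acts and by
locality for the other two. -/
lemma assoc_natural₁ {S S' : StrandCat A t Φ} (f : S ⟶ S') (T U : StrandCat A t Φ) :
    whiskR (whiskR f T) U ≫ (assoc S' T U).hom = (assoc S T U).hom ≫ whiskR f (tensor T U) := by
  refine hom_ext (fun s => ?_) fun R => ?_
  · rcases s with (s | s) | s <;> rfl
  · have h : assocFn t Φ (Fam.push R (whiskR (whiskR f T) U).e) = assocFn t Φ R :=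
      assocFn_congr _ (Fam.tot_push (Fam.left (Fam.left R)) f.e) rfl rfl
    have hc : Commute (assocFn t Φ R) (f.fn (Fam.left (Fam.left R))) :=
      Φ.series.commute_evalh_left
        (commute_C_act (f.equivariant _) fun a => f.isLocal _ _ fun s b =>
          Fam.comm_tot_right (Fam.left R) s a b)
        (commute_C_act (fun a => f.isLocal _ _ fun s b =>
          Fam.comm_tot_right (Fam.left R) s a b) (fun a => f.isLocal _ _ fun s b =>
          Fam.comm_tot_right R (Sum.inl s) a b))
    refine (congrArg (· * _) h).trans ?_
    exact hc.eq

lemma assoc_natural₂ (S : StrandCat A t Φ) {T T' : StrandCat A t Φ} (f : T ⟶ T')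
    (U : StrandCat A t Φ) :
    whiskR (whiskL S f) U ≫ (assoc S T' U).hom = (assoc S T U).hom ≫ whiskL S (whiskR f U) := by
  refine hom_ext (fun s => ?_) fun R => ?_
  · rcases s with (s | s) | s <;> rfl
  · have h : assocFn t Φ (Fam.push R (whiskR (whiskL S f) U).e) = assocFn t Φ R :=
      assocFn_congr _ rfl (Fam.tot_push (Fam.right (Fam.left R)) f.e) rfl
    have hc : Commute (assocFn t Φ R) (f.fn (Fam.right (Fam.left R))) :=
      Φ.series.commute_evalh_left
        (commute_C_act (fun a => f.isLocal _ _ fun s b =>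
          Fam.comm_tot_left (Fam.left R) s a b) (f.equivariant _))
        (commute_C_act (f.equivariant _) (fun a => f.isLocal _ _ fun s b =>
          Fam.comm_tot_right R (Sum.inr s) a b))
    refine (congrArg (· * _) h).trans ?_
    exact hc.eq

lemma assoc_natural₃ (S T : StrandCat A t Φ) {U U' : StrandCat A t Φ} (f : U ⟶ U') :
    whiskL (tensor S T) f ≫ (assoc S T U').hom = (assoc S T U).hom ≫ whiskL S (whiskL T f) := by
  refine hom_ext (fun s => ?_) fun R => ?_
  · rcases s with (s | s) | s <;> rfl
  · have h : assocFn t Φ (Fam.push R (whiskL (tensor S T) f).e) = assocFn t Φ R :=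
      assocFn_congr _ rfl rfl (Fam.tot_push (Fam.right R) f.e)
    have h₁ : ∀ a, Commute (C ((Fam.left (Fam.left R)).tot a)) (f.fn (Fam.right R)) :=
      fun a => f.isLocal _ _ fun s b =>
        Fam.comm_tot _ (fun r => Fam.comm_left_right R (Sum.inl r) s) a b
    have h₂ : ∀ a, Commute (C ((Fam.right (Fam.left R)).tot a)) (f.fn (Fam.right R)) :=
      fun a => f.isLocal _ _ fun s b =>
        Fam.comm_tot _ (fun r => Fam.comm_left_right R (Sum.inr r) s) a b
    have hc : Commute (assocFn t Φ R) (f.fn (Fam.right R)) :=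
      Φ.series.commute_evalh_left (commute_C_act h₁ h₂) (commute_C_act h₂ (f.equivariant _))
    refine (congrArg (· * _) h).trans ?_
    exact hc.eq

lemma whiskR_comp {S S' S'' : StrandCat A t Φ} (f : S ⟶ S') (g : S' ⟶ S'')
    (T : StrandCat A t Φ) : whiskR (f ≫ g) T = whiskR f T ≫ whiskR g T := by
  refine hom_ext (fun s => ?_) fun R => rfl
  rcases s with s | s <;> rfl

lemma whiskL_comp (T : StrandCat A t Φ) {S S' S'' : StrandCat A t Φ} (f : S ⟶ S') (g : S' ⟶ S'') :
    whiskL T (f ≫ g) = whiskL T f ≫ whiskL T g := by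
  refine hom_ext (fun s => ?_) fun R => rfl
  rcases s with s | s <;> rfl

lemma whiskR_id (S T : StrandCat A t Φ) : whiskR (𝟙 S) T = 𝟙 (tensor S T) := by
  refine hom_ext (fun s => ?_) fun R => rfl
  rcases s with s | s <;> rfl

lemma whiskL_id (S T : StrandCat A t Φ) : whiskL S (𝟙 T) = 𝟙 (tensor S T) := by
  refine hom_ext (fun s => ?_) fun R => rfl
  rcases s with s | s <;> rfl

/-- The pentagon equation for the four cables `S`, `T`, `U` and `V`. -/
lemma pent (S T U V : StrandCat A t Φ) :
    whiskR (assoc S T U).hom V ≫ (assoc S (tensor T U) V).hom ≫ whiskL S (assoc T U V).hom =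
      (assoc (tensor S T) U V).hom ≫ (assoc S T (tensor U V)).hom := by
  refine hom_ext (fun s => ?_) fun (R : Fam K L A (((_ ⊕ _) ⊕ _) ⊕ _)) => ?_
  · rcases s with ((s | s) | s) | s <;> rfl
  · have h01 := R.left.left.comm_tot_left_right
    have h2 := R.left.comm_tot_left_right
    have h3 := R.comm_tot_left_right
    have hl := fun s s' => R.left.comm_left_right s s'
    have hr := fun s s' => R.comm_left_right s s'
    have key := pentagon_of_isRep t Φ R.left.left.left.isRep_tot R.left.left.right.isRep_tot
      R.left.right.isRep_tot R.right.isRep_tot h01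
      (Fam.comm_tot _ fun s => (Fam.comm_tot _ fun s' => (hl (Sum.inl s) s').symm).symm)
      (Fam.comm_tot _ fun s => (Fam.comm_tot _ fun s' => (hr (Sum.inl (Sum.inl s)) s').symm).symm)
      (Fam.comm_tot _ fun s => (Fam.comm_tot _ fun s' => (hl (Sum.inr s) s').symm).symm)
      (Fam.comm_tot _ fun s => (Fam.comm_tot _ fun s' => (hr (Sum.inl (Sum.inr s)) s').symm).symm)
      (Fam.comm_tot _ fun s => (Fam.comm_tot _ fun s' => (hr (Sum.inr s) s').symm).symm)
    simp only [← InvTensor.act_add_left, ← InvTensor.act_add_right] at key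
    have e₁ : (R.left.left).tot = _ := R.left.left.tot_sum
    -- Both composites of series are unfolded. The sums that are written out run over the
    -- reassociated unions `T ⊔ U`, `T ⊔ U` and `U ⊔ V`; they have to be split before the pentagon
    -- equation applies.
    change (Φ.series.evalh (t.act R.left.left.right.tot R.left.right.tot)
        (t.act R.left.right.tot R.right.tot) *
        Φ.series.evalh (t.act R.left.left.left.tot (∑ s, R.1 _)) (t.act (∑ s, R.1 _) R.right.tot)) *
        Φ.series.evalh (t.act R.left.left.left.tot R.left.left.right.tot)
          (t.act R.left.left.right.tot R.left.right.tot) =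
      Φ.series.evalh (t.act R.left.left.left.tot R.left.left.right.tot)
          (t.act R.left.left.right.tot (∑ s, R.1 _)) *
        Φ.series.evalh (t.act R.left.left.tot R.left.right.tot)
          (t.act R.left.right.tot R.right.tot)
    rw [e₁, Fintype.sum_sum_type, Fintype.sum_sum_type]
    exact key.symm

end StrandCat

end StrandCat

/-! ### The braiding of strands -/

section StrandBraided

open PowerSeries (C coeff)
open MonoidalCategory

variable {K : Type u} [Field K] {L : Type v} [LieRing L] [LieAlgebra K L]
  {A : Type w} [Ring A] [Algebra K A]

namespace StrandCat

variable {t : InvTensor K L} {Φ : DrinfeldAssociator K}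

/-- The unit object is the empty set of strands and the unitors carry the series `1`. -/
noncomputable instance : MonoidalCategory (StrandCat A t Φ) where
  tensorObj := tensor
  whiskerLeft := whiskL
  whiskerRight := whiskR
  tensorUnit := unit
  associator := assoc
  leftUnitor S := bijIso (S := tensor unit S) (Equiv.emptySum PEmpty S.carrier)
  rightUnitor S := bijIso (S := tensor S unit) (Equiv.sumEmpty S.carrier PEmpty)
  id_tensorHom_id X Y := by
    change whiskR _ _ ≫ whiskL _ _ = _
    rw [whiskR_id, whiskL_id, Category.comp_id]
  tensorHom_comp_tensorHom {X₁ Y₁ Z₁ X₂ Y₂ Z₂} f₁ f₂ g₁ g₂ := by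
    change (whiskR _ _ ≫ whiskL _ _) ≫ whiskR _ _ ≫ whiskL _ _ = whiskR _ _ ≫ whiskL _ _
    rw [whiskR_comp, whiskL_comp, Category.assoc, Category.assoc, ← Category.assoc (whiskL _ _),
      whisk_exchange, Category.assoc]
  whiskerLeft_id := whiskL_id
  id_whiskerRight := whiskR_id
  associator_naturality f₁ f₂ f₃ := by
    change (whiskR (whiskR _ _ ≫ whiskL _ _) _ ≫ whiskL _ _) ≫ (assoc _ _ _).hom =
      (assoc _ _ _).hom ≫ whiskR _ _ ≫ whiskL _ (whiskR _ _ ≫ whiskL _ _)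
    simp only [whiskR_comp, whiskL_comp, Category.assoc]
    rw [assoc_natural₃, ← Category.assoc (whiskR (whiskL _ _) _), assoc_natural₂, Category.assoc,
      ← Category.assoc (whiskR (whiskR _ _) _), assoc_natural₁, Category.assoc]
  leftUnitor_naturality {S T} f := by
    refine hom_ext (fun s => ?_) fun R => ?_
    · rcases s with ⟨⟨⟩⟩ | s
      rfl
    · exact (one_mul _).trans (Eq.trans (fn_congr f fun _ => rfl) (mul_one _).symm)
  rightUnitor_naturality {S T} f := by
    refine hom_ext (fun s => ?_) fun R => ?_
    · rcases s with s | ⟨⟨⟩⟩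
      rfl
    · exact (one_mul _).trans (Eq.trans (fn_congr f fun _ => rfl) (mul_one _).symm)
  pentagon := pent
  triangle S T := by
    refine hom_ext (fun s => ?_) fun (R : Fam K L A ((S.carrier ⊕ PEmpty) ⊕ T.carrier)) => ?_
    · rcases s with (s | ⟨⟨⟩⟩) | s <;> rfl
    · refine (one_mul _).trans ?_
      -- The empty cable in the middle acts by `0`, so both arguments of `Φ` vanish.
      change Φ.series.evalh (t.act R.left.left.tot 0) (t.act 0 R.right.tot) = 1
      rw [t.act_zero_left, t.act_zero_right, Φ.evalh_zero_zero]

variable (t) in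
/-- The braiding of two sets of strands. -/
noncomputable def braidFn {S T : Type} [Fintype S] [Fintype T] (R : Fam K L A (S ⊕ T)) :
    PowerSeries A := exph K ((2 : K)⁻¹ • t.act R.left.tot R.right.tot)

lemma braidFn_local {S T : Type} [Fintype S] [Fintype T] (R : Fam K L A (S ⊕ T)) (z : A)
    (h : ∀ s a, Commute z (R.1 s a)) : Commute (C z) (braidFn t R) := by
  have h₁ : ∀ a, Commute z (R.left.tot a) := fun a => by
    rw [Fam.tot, LinearMap.sum_apply]
    exact Commute.sum_right _ _ _ fun s _ => h _ a
  have h₂ : ∀ a, Commute z (R.right.tot a) := fun a => by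
    rw [Fam.tot, LinearMap.sum_apply]
    exact Commute.sum_right _ _ _ fun s _ => h _ a
  exact commute_exph ((t.commute_act h₁ h₂).smul_right _)

lemma braidFn_equivariant {S T : Type} [Fintype S] [Fintype T] (R : Fam K L A (S ⊕ T)) (a : L) :
    Commute (C (R.tot a)) (braidFn t R) :=
  commute_exph ((t.commute_act_of_lie (lie_tot_left R a) (lie_tot_right R a)).smul_right _)

lemma isUnit_braidFn {S T : Type} [Fintype S] [Fintype T] (R : Fam K L A (S ⊕ T)) :
    IsUnit (braidFn t R) := isUnit_exph _

/-- The braiding. -/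
noncomputable def braid (S T : StrandCat A t Φ) : tensor S T ≅ tensor T S where
  hom :=
    { e := Equiv.sumComm _ _
      fn := fun R => braidFn t R
      isLocal := fun R => braidFn_local R
      equivariant := fun R => braidFn_equivariant R }
  inv :=
    { e := (Equiv.sumComm _ _).symm
      fn := fun R => psInv (braidFn t (Fam.push R (Equiv.sumComm _ _).symm))
      isLocal := fun R z h =>
        commute_inverse (braidFn_local (Fam.push R (Equiv.sumComm _ _).symm) z fun s => h _)
      equivariant := fun R a => commute_inverse (Fam.commute_tot_push
        (braidFn_equivariant (Fam.push R (Equiv.sumComm _ _).symm) a)) }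
  hom_inv_id := hom_ext (fun s => (Equiv.sumComm _ _).symm_apply_apply s) fun R => by
    refine (congrArg (fun R' => psInv (braidFn t R') * braidFn t R)
      (Fam.push_push_symm R (Equiv.sumComm _ _))).trans ?_
    exact Ring.inverse_mul_cancel _ (isUnit_braidFn R)
  inv_hom_id := hom_ext (fun s => (Equiv.sumComm _ _).apply_symm_apply s) fun R =>
    Ring.mul_inverse_cancel _ (isUnit_braidFn (t := t) _)

section

variable {S T U : Type} (R : Fam K L A ((S ⊕ T) ⊕ U))

lemma comm_tot₁₂ [Fintype S] [Fintype T] : Comm R.left.left.tot R.left.right.tot := R.left.comm_tot_left_right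

lemma comm_tot₁₃ [Fintype S] [Fintype U] : Comm R.left.left.tot R.right.tot :=
  Fam.comm_tot _ fun s => (Fam.comm_tot _ fun s' => (R.comm_left_right (Sum.inl s) s').symm).symm

lemma comm_tot₂₃ [Fintype T] [Fintype U] : Comm R.left.right.tot R.right.tot :=
  Fam.comm_tot _ fun s => (Fam.comm_tot _ fun s' => (R.comm_left_right (Sum.inr s) s').symm).symm

end

/-- This is the second hexagon equation for the cables `S`, `T`, `U`, after its two inverse
associators have been moved to the other side. The symmetry of `t` reconciles the orders of the
strands. -/
lemma hexagon_forward (S T U : StrandCat A t Φ) :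
    (assoc S T U).hom ≫ (braid S (tensor T U)).hom ≫ (assoc T U S).hom =
      whiskR (braid S T).hom U ≫ (assoc T S U).hom ≫ whiskL T (braid S U).hom := by
  refine hom_ext (fun s => ?_)
    fun (R : Fam K L A ((S.carrier ⊕ T.carrier) ⊕ U.carrier)) => ?_
  · rcases s with (s | s) | s <;> rfl
  · have key := hexagon'_of_isRep t Φ R.left.left.isRep_tot R.left.right.isRep_tot
      R.right.isRep_tot (comm_tot₁₂ R) (comm_tot₁₃ R) (comm_tot₂₃ R)
    have u₁ := Φ.isUnit_evalh (t.act R.left.right.tot R.right.tot)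
      (t.act R.left.left.tot R.right.tot)
    have u₂ := Φ.isUnit_evalh (t.act R.left.left.tot R.left.right.tot)
      (t.act R.left.right.tot R.right.tot)
    change (Φ.series.evalh (t.act R.left.right.tot R.right.tot)
        (t.act R.right.tot R.left.left.tot) *
        exph K ((2 : K)⁻¹ • t.act R.left.left.tot (∑ s, R.1 _))) *
        Φ.series.evalh (t.act R.left.left.tot R.left.right.tot)
          (t.act R.left.right.tot R.right.tot) =
      (exph K ((2 : K)⁻¹ • t.act R.left.left.tot R.right.tot) *
        Φ.series.evalh (t.act R.left.right.tot R.left.left.tot)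
          (t.act R.left.left.tot R.right.tot)) *
        exph K ((2 : K)⁻¹ • t.act R.left.left.tot R.left.right.tot)
    -- The cable which `S` crosses is the union of `T` and `U`, so the exponent is a sum of two
    -- terms.
    have e : t.act R.left.left.tot R.left.right.tot + t.act R.left.left.tot R.right.tot =
        t.act R.left.left.tot (∑ s : T.carrier ⊕ U.carrier,
          R.1 ((Equiv.sumAssoc S.carrier T.carrier U.carrier).symm (Sum.inr s))) := by
      rw [Fintype.sum_sum_type, ← t.act_add_right]
      rfl
    refine Eq.trans (congrArg (fun z => _ * exph K ((2 : K)⁻¹ • z) * _) e.symm) ?_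
    rw [key, t.act_swap _ _ (comm_tot₁₃ R).symm, t.act_swap _ _ (comm_tot₁₂ R).symm]
    simp only [mul_assoc, psInv]
    rw [Ring.inverse_mul_cancel _ u₂, mul_one, Ring.mul_inverse_cancel_left _ _ u₁]

/-- This is the first hexagon equation for the cables. The inverse associator at the source is moved
to the other side beforehand, so that the family stays indexed by `(S ⊔ T) ⊔ U`. -/
lemma hexagon_reverse (S T U : StrandCat A t Φ) :
    (assoc S T U).inv ≫ (braid (tensor S T) U).hom ≫ (assoc U S T).inv =
      whiskL S (braid T U).hom ≫ (assoc S U T).inv ≫ whiskR (braid S U).hom T := by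
  rw [Iso.inv_comp_eq]
  refine hom_ext (fun s => ?_)
    fun (R : Fam K L A ((S.carrier ⊕ T.carrier) ⊕ U.carrier)) => ?_
  · rcases s with (s | s) | s <;> rfl
  · have key := hexagon_of_isRep t Φ R.left.left.isRep_tot R.left.right.isRep_tot
      R.right.isRep_tot (comm_tot₁₂ R) (comm_tot₁₃ R) (comm_tot₂₃ R)
    have u₁ := Φ.isUnit_evalh (t.act R.left.left.tot R.right.tot)
      (t.act R.left.left.tot R.left.right.tot)
    change psInv (Φ.series.evalh (t.act R.right.tot R.left.left.tot)
        (t.act R.left.left.tot R.left.right.tot)) *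
        exph K ((2 : K)⁻¹ • t.act (∑ s, R.1 _) R.right.tot) =
      ((exph K ((2 : K)⁻¹ • t.act R.left.left.tot R.right.tot) *
        psInv (Φ.series.evalh (t.act R.left.left.tot R.right.tot)
          (t.act R.right.tot R.left.right.tot))) *
        exph K ((2 : K)⁻¹ • t.act R.left.right.tot R.right.tot)) *
        Φ.series.evalh (t.act R.left.left.tot R.left.right.tot)
          (t.act R.left.right.tot R.right.tot)
    have e : t.act R.left.left.tot R.right.tot + t.act R.left.right.tot R.right.tot =
        t.act (∑ s : S.carrier ⊕ T.carrier, R.1 (Sum.inl s)) R.right.tot := by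
      rw [Fintype.sum_sum_type, ← t.act_add_left]
      rfl
    refine Eq.trans (congrArg (fun z => _ * exph K ((2 : K)⁻¹ • z)) e.symm) ?_
    rw [key, t.act_swap _ _ (comm_tot₁₃ R).symm, t.act_swap _ _ (comm_tot₂₃ R).symm]
    simp only [mul_assoc, psInv]
    rw [Ring.inverse_mul_cancel_left _ _ u₁]

/-- Naturality has the same reasons as for the associator: total actions are unchanged by
bijections, and series are equivariant for their own strands and local for the others. The instance
is needed in order to apply the general theory of the middle interchange `tensorμ`. -/
noncomputable instance : BraidedCategory (StrandCat A t Φ) where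
  braiding := braid
  braiding_naturality_right S T U f := by
    refine hom_ext (fun s => ?_) fun (R : Fam K L A (S.carrier ⊕ T.carrier)) => ?_
    · rcases s with s | s <;> rfl
    · have e : braidFn t (Fam.push R (Equiv.sumCongr (Equiv.refl S.carrier) f.e)) = braidFn t R :=
        congrArg (fun r => exph K ((2 : K)⁻¹ • t.act _ r)) (Fam.tot_push R.right f.e)
      refine (congrArg (· * _) e).trans (Commute.eq ?_)
      exact commute_exph_left (commute_C_smul _ (commute_C_act
        (fun a => f.isLocal _ _ fun s b => R.comm_tot_left s a b) (f.equivariant _)))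
  braiding_naturality_left {S T} f U := by
    refine hom_ext (fun s => ?_) fun (R : Fam K L A (S.carrier ⊕ U.carrier)) => ?_
    · rcases s with s | s <;> rfl
    · have e : braidFn t (Fam.push R (Equiv.sumCongr f.e (Equiv.refl U.carrier))) = braidFn t R :=
        congrArg (fun r => exph K ((2 : K)⁻¹ • t.act r _)) (Fam.tot_push R.left f.e)
      refine (congrArg (· * _) e).trans (Commute.eq ?_)
      exact commute_exph_left (commute_C_smul _ (commute_C_act
        (f.equivariant _) (fun a => f.isLocal _ _ fun s b => R.comm_tot_right s a b)))
  hexagon_forward := hexagon_forward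
  hexagon_reverse := hexagon_reverse

end StrandCat

end StrandBraided

/-! ### The middle interchange of four cables -/

section Interchange

open PowerSeries (C coeff)
open MonoidalCategory

variable {K : Type u} [Field K] {L : Type v} [LieRing L] [LieAlgebra K L]
  {A : Type w} [Ring A] [Algebra K A] (t : InvTensor K L) (Φ : DrinfeldAssociator K)

/-- The element of the middle interchange `(a b)(c d) → (a c)(b d)`. -/
noncomputable def interchangeElt (a b c d : L →ₗ[K] A) : PowerSeries A :=
  psInv (Φ.series.evalh (t.act a c) (t.act c (b + d))) *
    (Φ.series.evalh (t.act c b) (t.act b d) * exph K ((2 : K)⁻¹ • t.act b c) *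
      psInv (Φ.series.evalh (t.act b c) (t.act c d))) *
    Φ.series.evalh (t.act a b) (t.act b (c + d))

/-- In a shuffle the arguments are the `a`-cables of two words followed by their `b`-cables. The
cases `₁₃` and `₂₄` occur when one of the words is empty. -/
lemma interchangeElt_zero₁₃ (b d : L →ₗ[K] A) : interchangeElt t Φ 0 b 0 d = 1 := by
  simp [interchangeElt, InvTensor.act_zero_left, InvTensor.act_zero_right,
    DrinfeldAssociator.evalh_zero_left, exph_zero, psInv_one]

lemma interchangeElt_zero₂₄ (a c : L →ₗ[K] A) : interchangeElt t Φ a 0 c 0 = 1 := by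
  simp [interchangeElt, InvTensor.act_zero_left, InvTensor.act_zero_right,
    DrinfeldAssociator.evalh_zero_right, exph_zero, psInv_one]

/-- The cases `₁₂` and `₃₄` occur when one of the two modules is trivial. They lead to the unitality
of `ν^p`. -/
lemma interchangeElt_zero₁₂ (c d : L →ₗ[K] A) : interchangeElt t Φ 0 0 c d = 1 := by
  simp [interchangeElt, InvTensor.act_zero_left, InvTensor.act_zero_right,
    DrinfeldAssociator.evalh_zero_left, exph_zero, psInv_one]

lemma interchangeElt_zero₃₄ (a b : L →ₗ[K] A) : interchangeElt t Φ a b 0 0 = 1 := by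
  simp [interchangeElt, InvTensor.act_zero_left, InvTensor.act_zero_right,
    DrinfeldAssociator.evalh_zero_right, exph_zero, psInv_one]

lemma isUnit_psInv {P : PowerSeries A} (h : IsUnit P) : IsUnit (psInv P) := by
  obtain ⟨P, rfl⟩ := h
  rw [psInv, Ring.inverse_unit]
  exact Units.isUnit _

lemma isUnit_interchangeElt (a b c d : L →ₗ[K] A) : IsUnit (interchangeElt t Φ a b c d) :=
  ((isUnit_psInv (Φ.isUnit_evalh _ _)).mul (((Φ.isUnit_evalh _ _).mul (isUnit_exph _)).mul
    (isUnit_psInv (Φ.isUnit_evalh _ _)))).mul (Φ.isUnit_evalh _ _)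

variable {t Φ}

/-- The values of `f` commute with the coefficients of `P`. -/
def CommSeries (f : L →ₗ[K] A) (P : PowerSeries A) : Prop := ∀ a, Commute (C (f a)) P

lemma CommSeries.add {f g : L →ₗ[K] A} {P : PowerSeries A} (hf : CommSeries f P)
    (hg : CommSeries g P) : CommSeries (f + g) P := fun a => commute_C_add (hf a) (hg a)

lemma CommSeries.mul {f : L →ₗ[K] A} {P Q : PowerSeries A} (hP : CommSeries f P)
    (hQ : CommSeries f Q) : CommSeries f (P * Q) := fun a => (hP a).mul_right (hQ a)

lemma CommSeries.one (f : L →ₗ[K] A) : CommSeries f 1 := fun _ => Commute.one_right _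

lemma CommSeries.zero (P : PowerSeries A) : CommSeries (0 : L →ₗ[K] A) P := fun a => by
  rw [LinearMap.zero_apply, map_zero]
  exact Commute.zero_left _

lemma commute_psInv_left {P Q : PowerSeries A} (h : Commute P Q) : Commute (psInv P) Q :=
  (commute_inverse h.symm).symm

lemma commute_interchangeElt {a b c d : L →ₗ[K] A} {P : PowerSeries A} (ha : CommSeries a P)
    (hb : CommSeries b P) (hc : CommSeries c P) (hd : CommSeries d P) :
    Commute (interchangeElt t Φ a b c d) P := by
  have h : ∀ {f g h k : L →ₗ[K] A}, CommSeries f P → CommSeries g P → CommSeries h P →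
      CommSeries k P → Commute (Φ.series.evalh (t.act f g) (t.act h k)) P := fun hf hg hh hk =>
    Φ.series.commute_evalh_left (commute_C_act hf hg) (commute_C_act hh hk)
  refine Commute.mul_left (Commute.mul_left (commute_psInv_left (h ha hc hc (hb.add hd)))
    (Commute.mul_left (Commute.mul_left (h hc hb hb hd) ?_)
      (commute_psInv_left (h hb hc hc hd)))) (h ha hb hb (hc.add hd))
  exact commute_exph_left (commute_C_smul _ (commute_C_act hb hc))

lemma map_act {B : Type x} [Ring B] [Algebra K B] (φ : A →ₐ[K] B) (f g : L →ₗ[K] A) :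
    φ (t.act f g) = t.act (φ.toLinearMap ∘ₗ f) (φ.toLinearMap ∘ₗ g) := (t.act_map φ f g).symm

namespace StrandCat

/-- `interchangeElt` was written so as to be the series of the canonical map `tensorμ` of a braided
category. This makes identities of `tensorμ` available for it. -/
lemma tensorμ_fn (S T U V : StrandCat A t Φ)
    (R : Fam K L A ((S.carrier ⊕ T.carrier) ⊕ (U.carrier ⊕ V.carrier))) :
    (tensorμ S T U V).fn R = interchangeElt t Φ R.left.left.tot R.left.right.tot
      R.right.left.tot R.right.right.tot := by
  change psInv (Φ.series.evalh (t.act R.left.left.tot R.right.left.tot)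
      (t.act R.right.left.tot (∑ s : T.carrier ⊕ V.carrier, R.1 _))) *
    (Φ.series.evalh (t.act R.right.left.tot R.left.right.tot)
      (t.act R.left.right.tot R.right.right.tot)) *
    exph K ((2 : K)⁻¹ • t.act R.left.right.tot R.right.left.tot) *
    psInv (Φ.series.evalh (t.act R.left.right.tot R.right.left.tot)
      (t.act R.right.left.tot R.right.right.tot)) *
    Φ.series.evalh (t.act R.left.left.tot R.left.right.tot)
      (t.act R.left.right.tot (∑ s : U.carrier ⊕ V.carrier, R.1 _)) = _
  -- The two sums that occur run over the cables `T ⊔ V` and `U ⊔ V`.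
  rw [Fintype.sum_sum_type, Fintype.sum_sum_type]
  simp only [mul_assoc]
  rw [interchangeElt]
  simp only [mul_assoc]
  rfl

lemma tensorHom_fn {S S' T T' : StrandCat A t Φ} (f : S ⟶ S') (g : T ⟶ T')
    (R : Fam K L A (S.carrier ⊕ T.carrier)) : (f ⊗ₘ g).fn R = g.fn R.right * f.fn R.left := rfl

variable (A t Φ) in
/-- A single strand. -/
def single : StrandCat A t Φ := ⟨Unit⟩

/-- The labels of six strands. -/
def label₆ : ((Unit ⊕ Unit) ⊕ (Unit ⊕ Unit)) ⊕ (Unit ⊕ Unit) → Fin 6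
  | Sum.inl (Sum.inl (Sum.inl _)) => 0
  | Sum.inl (Sum.inl (Sum.inr _)) => 1
  | Sum.inl (Sum.inr (Sum.inl _)) => 2
  | Sum.inl (Sum.inr (Sum.inr _)) => 3
  | Sum.inr (Sum.inl _) => 4
  | Sum.inr (Sum.inr _) => 5

lemma label₆_injective : Function.Injective label₆ := by decide

lemma sum_unit {M : Type x} [AddCommMonoid M] (f : Unit → M) : ∑ s, f s = f () :=
  Fintype.sum_unique f

lemma sum_unit_unit {M : Type x} [AddCommMonoid M] (f : Unit ⊕ Unit → M) :
    ∑ s, f s = f (Sum.inl ()) + f (Sum.inr ()) := by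
  rw [Fintype.sum_sum_type, sum_unit, sum_unit]

lemma _root_.QuantumFusion.interchangeElt_congr {a b c d a' b' c' d' : L →ₗ[K] A} (ha : a = a')
    (hb : b = b') (hc : c = c') (hd : d = d') :
    interchangeElt t Φ a b c d = interchangeElt t Φ a' b' c' d' := by rw [ha, hb, hc, hd]

lemma _root_.QuantumFusion.evalh_act_congr {a b c d a' b' c' d' : L →ₗ[K] A} (ha : a = a')
    (hb : b = b') (hc : c = c') (hd : d = d') :
    Φ.series.evalh (t.act a b) (t.act c d) = Φ.series.evalh (t.act a' b') (t.act c' d') := by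
  rw [ha, hb, hc, hd]

/-- The middle interchange is associative. -/
lemma _root_.QuantumFusion.interchangeElt_assoc {R : Fin 6 → (L →ₗ[K] A)} (hR : CommFam R) :
    Φ.series.evalh (t.act (R 1) (R 3)) (t.act (R 3) (R 5)) *
        Φ.series.evalh (t.act (R 0) (R 2)) (t.act (R 2) (R 4)) *
        interchangeElt t Φ (R 0 + R 2) (R 1 + R 3) (R 4) (R 5) *
        interchangeElt t Φ (R 0) (R 1) (R 2) (R 3) =
      interchangeElt t Φ (R 0) (R 1) (R 2 + R 4) (R 3 + R 5) *
        interchangeElt t Φ (R 2) (R 3) (R 4) (R 5) *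
        Φ.series.evalh (t.act (R 0 + R 1) (R 2 + R 3)) (t.act (R 2 + R 3) (R 4 + R 5)) := by
  let S := single A t Φ
  let r : Fam K L A (((S ⊗ S) ⊗ (S ⊗ S)) ⊗ (S ⊗ S)).carrier :=
    ⟨R ∘ label₆, hR.comp label₆_injective⟩
  -- An identity which holds in every braided category is applied to six single strands, and its
  -- series is evaluated at the given family. The facts `h₁` to `h₆` compute the factors one by one.
  have key := congrArg (fun f => Hom.fn f r) (tensor_associativity S S S S S S)
  have h₁ : (tensorμ S S S S ▷ (S ⊗ S)).fn r = interchangeElt t Φ (R 0) (R 1) (R 2) (R 3) :=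
    (tensorμ_fn S S S S (Fam.left r)).trans
      (interchangeElt_congr (sum_unit _) (sum_unit _) (sum_unit _) (sum_unit _))
  have h₂ : (tensorμ (S ⊗ S) (S ⊗ S) S S).fn (Fam.push r (tensorμ S S S S ▷ (S ⊗ S)).e) =
      interchangeElt t Φ (R 0 + R 2) (R 1 + R 3) (R 4) (R 5) :=
    (tensorμ_fn (S ⊗ S) (S ⊗ S) S S _).trans
      (interchangeElt_congr (sum_unit_unit _) (sum_unit_unit _) (sum_unit _) (sum_unit _))
  have h₃ : ((α_ S S S).hom ⊗ₘ (α_ S S S).hom).fn (Fam.push (Fam.push r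
      (tensorμ S S S S ▷ (S ⊗ S)).e) (tensorμ (S ⊗ S) (S ⊗ S) S S).e) =
      Φ.series.evalh (t.act (R 1) (R 3)) (t.act (R 3) (R 5)) *
        Φ.series.evalh (t.act (R 0) (R 2)) (t.act (R 2) (R 4)) :=
    (tensorHom_fn _ _ _).trans (congrArg₂ (· * ·)
      (evalh_act_congr (sum_unit _) (sum_unit _) (sum_unit _) (sum_unit _))
      (evalh_act_congr (sum_unit _) (sum_unit _) (sum_unit _) (sum_unit _)))
  have h₄ : (α_ (S ⊗ S) (S ⊗ S) (S ⊗ S)).hom.fn r =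
      Φ.series.evalh (t.act (R 0 + R 1) (R 2 + R 3)) (t.act (R 2 + R 3) (R 4 + R 5)) :=
    evalh_act_congr (sum_unit_unit _) (sum_unit_unit _) (sum_unit_unit _) (sum_unit_unit _)
  have h₅ : ((S ⊗ S) ◁ tensorμ S S S S).fn (Fam.push r (α_ (S ⊗ S) (S ⊗ S) (S ⊗ S)).hom.e) =
      interchangeElt t Φ (R 2) (R 3) (R 4) (R 5) :=
    (tensorμ_fn S S S S _).trans
      (interchangeElt_congr (sum_unit _) (sum_unit _) (sum_unit _) (sum_unit _))
  have h₆ : (tensorμ S S (S ⊗ S) (S ⊗ S)).fn (Fam.push (Fam.push r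
      (α_ (S ⊗ S) (S ⊗ S) (S ⊗ S)).hom.e) ((S ⊗ S) ◁ tensorμ S S S S).e) =
      interchangeElt t Φ (R 0) (R 1) (R 2 + R 4) (R 3 + R 5) :=
    (tensorμ_fn S S (S ⊗ S) (S ⊗ S) _).trans
      (interchangeElt_congr (sum_unit _) (sum_unit _) (sum_unit_unit _) (sum_unit_unit _))
  rw [← h₁, ← h₂, ← h₃, ← h₄, ← h₅, ← h₆]
  exact key

/-- The labels of six strands. -/
def label₆' : ((Unit ⊕ Unit) ⊕ Unit) ⊕ ((Unit ⊕ Unit) ⊕ Unit) → Fin 6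
  | Sum.inl (Sum.inl (Sum.inl _)) => 0
  | Sum.inl (Sum.inl (Sum.inr _)) => 1
  | Sum.inl (Sum.inr _) => 2
  | Sum.inr (Sum.inl (Sum.inl _)) => 3
  | Sum.inr (Sum.inl (Sum.inr _)) => 4
  | Sum.inr (Sum.inr _) => 5

lemma label₆'_injective : Function.Injective label₆' := by decide

/-- The middle interchange is compatible with the associativity constraint. -/
lemma _root_.QuantumFusion.associator_interchangeElt {R : Fin 6 → (L →ₗ[K] A)} (hR : CommFam R) :
    Φ.series.evalh (t.act (R 0 + R 3) (R 1 + R 4)) (t.act (R 1 + R 4) (R 2 + R 5)) *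
        interchangeElt t Φ (R 0) (R 1) (R 3) (R 4) *
        interchangeElt t Φ (R 0 + R 1) (R 2) (R 3 + R 4) (R 5) =
      interchangeElt t Φ (R 1) (R 2) (R 4) (R 5) *
        interchangeElt t Φ (R 0) (R 1 + R 2) (R 3) (R 4 + R 5) *
        (Φ.series.evalh (t.act (R 3) (R 4)) (t.act (R 4) (R 5)) *
        Φ.series.evalh (t.act (R 0) (R 1)) (t.act (R 1) (R 2))) := by
  let S := single A t Φ
  let r : Fam K L A (((S ⊗ S) ⊗ S) ⊗ ((S ⊗ S) ⊗ S)).carrier :=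
    ⟨R ∘ label₆', hR.comp label₆'_injective⟩
  -- The same method, for the fact that the associator is a monoidal transformation between
  -- threefold tensor products.
  have key := congrArg (fun f => Hom.fn f r) (associator_monoidal S S S S S S)
  have h₁ : (tensorμ (S ⊗ S) S (S ⊗ S) S).fn r =
      interchangeElt t Φ (R 0 + R 1) (R 2) (R 3 + R 4) (R 5) :=
    (tensorμ_fn (S ⊗ S) S (S ⊗ S) S _).trans
      (interchangeElt_congr (sum_unit_unit _) (sum_unit _) (sum_unit_unit _) (sum_unit _))
  have h₂ : (tensorμ S S S S ▷ (S ⊗ S)).fn (Fam.push r (tensorμ (S ⊗ S) S (S ⊗ S) S).e) =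
      interchangeElt t Φ (R 0) (R 1) (R 3) (R 4) :=
    (tensorμ_fn S S S S _).trans
      (interchangeElt_congr (sum_unit _) (sum_unit _) (sum_unit _) (sum_unit _))
  have h₃ : (α_ (S ⊗ S) (S ⊗ S) (S ⊗ S)).hom.fn (Fam.push (Fam.push r
      (tensorμ (S ⊗ S) S (S ⊗ S) S).e) (tensorμ S S S S ▷ (S ⊗ S)).e) =
      Φ.series.evalh (t.act (R 0 + R 3) (R 1 + R 4)) (t.act (R 1 + R 4) (R 2 + R 5)) :=
    evalh_act_congr (sum_unit_unit _) (sum_unit_unit _) (sum_unit_unit _) (sum_unit_unit _)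
  have h₄ : ((α_ S S S).hom ⊗ₘ (α_ S S S).hom).fn r =
      Φ.series.evalh (t.act (R 3) (R 4)) (t.act (R 4) (R 5)) *
        Φ.series.evalh (t.act (R 0) (R 1)) (t.act (R 1) (R 2)) :=
    (tensorHom_fn _ _ _).trans (congrArg₂ (· * ·)
      (evalh_act_congr (sum_unit _) (sum_unit _) (sum_unit _) (sum_unit _))
      (evalh_act_congr (sum_unit _) (sum_unit _) (sum_unit _) (sum_unit _)))
  have h₅ : (tensorμ S (S ⊗ S) S (S ⊗ S)).fn
      (Fam.push r ((α_ S S S).hom ⊗ₘ (α_ S S S).hom).e) =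
      interchangeElt t Φ (R 0) (R 1 + R 2) (R 3) (R 4 + R 5) :=
    (tensorμ_fn S (S ⊗ S) S (S ⊗ S) _).trans
      (interchangeElt_congr (sum_unit _) (sum_unit_unit _) (sum_unit _) (sum_unit_unit _))
  have h₆ : ((S ⊗ S) ◁ tensorμ S S S S).fn (Fam.push (Fam.push r
      ((α_ S S S).hom ⊗ₘ (α_ S S S).hom).e) (tensorμ S (S ⊗ S) S (S ⊗ S)).e) =
      interchangeElt t Φ (R 1) (R 2) (R 4) (R 5) :=
    (tensorμ_fn S S S S _).trans
      (interchangeElt_congr (sum_unit _) (sum_unit _) (sum_unit _) (sum_unit _))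
  rw [← h₁, ← h₂, ← h₃, ← h₄, ← h₅, ← h₆]
  exact key

end StrandCat

end Interchange

/-! ### Mac Lane coherence for reparenthesizations -/

section Coherence

open PowerSeries (C coeff)
open MonoidalCategory

variable {K : Type u} [Field K] {L : Type v} [LieRing L] [LieAlgebra K L]
  {A : Type w} [Ring A] [Algebra K A] {t : InvTensor K L} {Φ : DrinfeldAssociator K}
  {S : Type x}

/-- The sum of the actions of the strands in a list. -/
def listRep (R : S → (L →ₗ[K] A)) (l : List S) : L →ₗ[K] A := (l.map R).sum

lemma listRep_singleton (R : S → (L →ₗ[K] A)) (s : S) : listRep R [s] = R s := by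
  simp [listRep]

lemma listRep_append (R : S → (L →ₗ[K] A)) (l l' : List S) :
    listRep R (l ++ l') = listRep R l + listRep R l' := by
  simp [listRep]

lemma act_listRep_left (R : S → (L →ₗ[K] A)) (l : List S) (f : L →ₗ[K] A) :
    t.act (listRep R l) f = (l.map fun s => t.act (R s) f).sum := by
  induction l with
  | nil => exact t.act_zero_left f
  | cons s l ih =>
    rw [List.map_cons, List.sum_cons, ← ih, ← t.act_add_left]
    rfl

lemma act_listRep_right (R : S → (L →ₗ[K] A)) (l : List S) (f : L →ₗ[K] A) :
    t.act f (listRep R l) = (l.map fun s => t.act f (R s)).sum := by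
  induction l with
  | nil => exact t.act_zero_right f
  | cons s l ih =>
    rw [List.map_cons, List.sum_cons, ← ih, ← t.act_add_right]
    rfl

/-- By bilinearity of `t`: the element of a braid depends on the strands only through cables. -/
lemma strandSum_eq (R : S → (L →ₗ[K] A)) (a b : FreeMagma S) :
    strandSum t R a b = t.act (listRep R (leaves a)) (listRep R (leaves b)) := by
  rw [act_listRep_left]
  simp only [act_listRep_right]
  rfl

/-- A parenthesized word as an object of the free monoidal category. -/
def freeObj : FreeMagma S → FreeMonoidalCategory S
  | .of s => .of s
  | .mul a b => .tensor (freeObj a) (freeObj b)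

namespace StrandCat

variable (A t Φ) in
/-- The functor which sends each letter to a single strand. -/
noncomputable def letters (S : Type x) : FreeMonoidalCategory S ⥤ StrandCat A t Φ :=
  FreeMonoidalCategory.project fun _ => single A t Φ

variable (A t Φ) in
/-- The set of the strands of a parenthesized word. -/
noncomputable abbrev strands (a : FreeMagma S) : StrandCat A t Φ :=
  (letters A t Φ S).obj (freeObj a)

variable (A t Φ) in
/-- The letters of the strands. -/
def lab : (a : FreeMagma S) → (strands A t Φ a).carrier → S
  | .of s => fun _ => s
  | .mul a b => Sum.elim (lab a) (lab b)

lemma lab_mem : ∀ (a : FreeMagma S) (x : (strands A t Φ a).carrier), lab A t Φ a x ∈ leaves a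
  | .of _, _ => List.mem_singleton_self _
  | .mul a _, .inl x => List.mem_append_left _ (lab_mem a x)
  | .mul _ b, .inr x => List.mem_append_right _ (lab_mem b x)

/-- Injectivity guarantees that a commuting family indexed by letters pulls back to a commuting
family indexed by strands. -/
lemma lab_injective : ∀ (a : FreeMagma S), (leaves a).Nodup → Function.Injective (lab A t Φ a)
  | .of _, _ => fun _ _ _ => rfl
  | .mul a b, h => by
    have h := List.nodup_append'.1 h
    rintro (x | x) (y | y) hxy
    · exact congrArg Sum.inl (lab_injective a h.1 hxy)
    · refine (h.2.2 (lab_mem a x) ?_).elim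
      rw [show lab A t Φ a x = lab A t Φ b y from hxy]
      exact lab_mem b y
    · refine (h.2.2 (lab_mem a y) ?_).elim
      rw [show lab A t Φ a y = lab A t Φ b x from hxy.symm]
      exact lab_mem b x
    · exact congrArg Sum.inr (lab_injective b h.2.1 hxy)

lemma sum_lab (R : S → (L →ₗ[K] A)) :
    ∀ a : FreeMagma S, ∑ x, R (lab A t Φ a x) = listRep R (leaves a)
  | .of s => (sum_unit _).trans (listRep_singleton R s).symm
  | .mul a b => by
    refine (Fintype.sum_sum_type _).trans (Eq.trans ?_ (listRep_append R _ _).symm)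
    exact congrArg₂ (· + ·) (sum_lab R a) (sum_lab R b)

lemma tot_strands {R : S → (L →ₗ[K] A)} {a : FreeMagma S}
    {r : Fam K L A (strands A t Φ a).carrier} (h : ∀ x, r.1 x = R (lab A t Φ a x)) :
    r.tot = listRep R (leaves a) :=
  (Finset.sum_congr rfl fun x _ => h x).trans (sum_lab R a)

/-- A word without crossings is built from the structure maps of a monoidal category, so it lifts to
the free monoidal category, and the image of the lift in `StrandCat` has the right series. The
clause about labels makes the induction work: in a composite, the second series is evaluated at a
transported family. -/
lemma exists_hom {a b : FreeMagma S} (f : ParBraid a b) (hf : f.NoCross) :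
    ∃ m : freeObj a ⟶ freeObj b,
      (∀ x, lab A t Φ b (((letters A t Φ S).map m).e x) = lab A t Φ a x) ∧
      ∀ (R : S → (L →ₗ[K] A)) (r : Fam K L A (strands A t Φ a).carrier),
        (∀ x, r.1 x = R (lab A t Φ a x)) → ((letters A t Φ S).map m).fn r = f.eval t Φ R := by
  induction f with
  | id a =>
    refine ⟨𝟙 _, fun x => ?_, fun R r _ => ?_⟩
    · rw [CategoryTheory.Functor.map_id]
      rfl
    · rw [CategoryTheory.Functor.map_id]
      rfl
  | comp f g ihf ihg =>
    obtain ⟨m, hm, hm'⟩ := ihf hf.1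
    obtain ⟨n, hn, hn'⟩ := ihg hf.2
    refine ⟨m ≫ n, fun x => ?_, fun R r hr => ?_⟩
    · rw [Functor.map_comp]
      exact (hn _).trans (hm x)
    · rw [Functor.map_comp, comp_fn, hm' R r hr, hn' R]
      · rfl
      · intro x
        -- The bijection of the first factor preserves labels, so the transported family still acts
        -- through the letters.
        refine (hr _).trans ?_
        rw [← hm, Equiv.apply_symm_apply]
  | @tensor a a' b b' f g ihf ihg =>
    obtain ⟨m, hm, hm'⟩ := ihf hf.1
    obtain ⟨n, hn, hn'⟩ := ihg hf.2
    have e : (letters A t Φ S).map (m ⊗ₘ n : freeObj a ⊗ freeObj b ⟶ freeObj a' ⊗ freeObj b') =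
        (letters A t Φ S).map m ⊗ₘ (letters A t Φ S).map n := by
      -- Morphisms of the free category are equivalence classes; on representatives the functor
      -- respects tensor products by definition.
      rcases m with ⟨m⟩
      rcases n with ⟨n⟩
      rfl
    refine ⟨(m ⊗ₘ n : freeObj a ⊗ freeObj b ⟶ freeObj a' ⊗ freeObj b'), fun x => ?_,
      fun R (r : Fam K L A ((strands A t Φ a).carrier ⊕ (strands A t Φ b).carrier)) hr => ?_⟩
    · refine (congrArg (fun k => lab A t Φ (a' * b') (Hom.e k x)) e).trans ?_
      rcases x with x | x
      · exact hm x
      · exact hn x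
    · refine (congrArg (fun k => Hom.fn k r) e).trans ?_
      -- A tensor product of morphisms puts the series of the second factor on the left, whereas
      -- `ParBraid.eval` puts the first one there. The two series commute by locality.
      refine (Commute.eq ?_).trans (congrArg₂ (· * ·) (hm' R r.left fun x => hr (Sum.inl x))
        (hn' R r.right fun x => hr (Sum.inr x)))
      exact commute_of_local ((letters A t Φ S).map n) r.right fun s z =>
        ((letters A t Φ S).map m).isLocal r.left _ fun s' z' =>
        (r.comm_left_right s' s z' z).symm
  | assoc a b c =>
    refine ⟨(α_ (freeObj a) (freeObj b) (freeObj c)).hom, fun x => ?_, fun R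
      (r : Fam K L A (((strands A t Φ a).carrier ⊕ (strands A t Φ b).carrier) ⊕
        (strands A t Φ c).carrier)) hr => ?_⟩
    · rcases x with (x | x) | x <;> rfl
    · change Φ.series.evalh (t.act r.left.left.tot r.left.right.tot)
        (t.act r.left.right.tot r.right.tot) = Φ.series.evalh (strandSum t R a b) (strandSum t R b c)
      rw [strandSum_eq, strandSum_eq]
      exact evalh_act_congr (tot_strands fun x => hr (Sum.inl (Sum.inl x)))
        (tot_strands fun x => hr (Sum.inl (Sum.inr x)))
        (tot_strands fun x => hr (Sum.inl (Sum.inr x))) (tot_strands fun x => hr (Sum.inr x))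
  | assocInv a b c =>
    refine ⟨(α_ (freeObj a) (freeObj b) (freeObj c)).inv, fun x => ?_, fun R
      (r : Fam K L A ((strands A t Φ a).carrier ⊕ ((strands A t Φ b).carrier ⊕
        (strands A t Φ c).carrier))) hr => ?_⟩
    · rcases x with x | x | x <;> rfl
    · change psInv (Φ.series.evalh (t.act r.left.tot r.right.left.tot)
        (t.act r.right.left.tot r.right.right.tot)) =
          psInv (Φ.series.evalh (strandSum t R a b) (strandSum t R b c))
      rw [strandSum_eq, strandSum_eq]
      exact congrArg psInv (evalh_act_congr (tot_strands fun x => hr (Sum.inl x))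
        (tot_strands fun x => hr (Sum.inr (Sum.inl x)))
        (tot_strands fun x => hr (Sum.inr (Sum.inl x)))
        (tot_strands fun x => hr (Sum.inr (Sum.inr x))))
  | cross a b => exact hf.elim

end StrandCat

/-- Coherence: parallel reparenthesizations have the same value. -/
lemma ParBraid.eval_eq_of_noCross {R : S → (L →ₗ[K] A)} (hR : CommFam R) {a b : FreeMagma S}
    (ha : (leaves a).Nodup) {f f' : ParBraid a b} (hf : f.NoCross) (hf' : f'.NoCross) :
    f.eval t Φ R = f'.eval t Φ R := by
  obtain ⟨m, _, hm⟩ := StrandCat.exists_hom (A := A) (t := t) (Φ := Φ) f hf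
  obtain ⟨m', _, hm'⟩ := StrandCat.exists_hom (A := A) (t := t) (Φ := Φ) f' hf'
  let r : Fam K L A (StrandCat.strands A t Φ a).carrier :=
    ⟨R ∘ StrandCat.lab A t Φ a, hR.comp (StrandCat.lab_injective a ha)⟩
  -- The coherence theorem: the free monoidal category is thin, so the two lifts coincide.
  rw [← hm R r fun _ => rfl, ← hm' R r fun _ => rfl, Subsingleton.elim m m']

end Coherence

/-! ### Shuffle elements of possibly empty words -/

section Words

open PowerSeries (C coeff)

variable {K : Type u} [Field K] {L : Type v} [LieRing L] [LieAlgebra K L]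
  {A : Type w} [Ring A] [Algebra K A] {t : InvTensor K L} {Φ : DrinfeldAssociator K}
  {I : Type x}

/-- `f` acts on the values of `a` through the adjoint action. -/
def Ad (f a : L →ₗ[K] A) : Prop := ∀ z y, f z * a y - a y * f z = a ⁅z, y⁆

lemma IsRep.ad {a : L →ₗ[K] A} (h : IsRep a) : Ad a a := h

lemma Ad.add_left {f g a : L →ₗ[K] A} (h : Ad f a) (hg : Comm g a) : Ad (f + g) a := by
  intro z y
  rw [← h z y, LinearMap.add_apply, add_mul, mul_add, (hg z y).eq]
  abel

lemma Ad.add_left' {f g a : L →ₗ[K] A} (h : Ad f a) (hg : Comm g a) : Ad (g + f) a := by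
  rw [add_comm]
  exact h.add_left hg

lemma Ad.add_right {f a b : L →ₗ[K] A} (ha : Ad f a) (hb : Ad f b) : Ad f (a + b) := by
  intro z y
  rw [LinearMap.add_apply, LinearMap.add_apply, ← ha, ← hb]
  noncomm_ring

lemma Ad.commSeries_evalh {f a b c d : L →ₗ[K] A} (ha : Ad f a) (hb : Ad f b) (hc : Ad f c)
    (hd : Ad f d) : CommSeries f (Φ.series.evalh (t.act a b) (t.act c d)) := fun z =>
  commute_C_evalh (t.commute_act_of_lie (ha z) (hb z)) (t.commute_act_of_lie (hc z) (hd z))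

lemma Ad.commSeries_interchangeElt {f a b c d : L →ₗ[K] A} (ha : Ad f a) (hb : Ad f b)
    (hc : Ad f c) (hd : Ad f d) : CommSeries f (interchangeElt t Φ a b c d) := fun z =>
  ((commute_inverse (ha.commSeries_evalh hc hc (hb.add_right hd) z)).mul_right
    (((hc.commSeries_evalh hb hb hd z).mul_right
      (commute_exph ((t.commute_act_of_lie (hb z) (hc z)).smul_right _))).mul_right
      (commute_inverse (hb.commSeries_evalh hc hc hd z)))).mul_right
    (ha.commSeries_evalh hb hb (hc.add_right hd) z)

lemma Comm.commSeries_evalh {f a b c d : L →ₗ[K] A} (ha : Comm f a) (hb : Comm f b)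
    (hc : Comm f c) (hd : Comm f d) :
    CommSeries f (Φ.series.evalh (t.act a b) (t.act c d)) := fun z =>
  commute_C_evalh (t.commute_act (ha z) (hb z)) (t.commute_act (hc z) (hd z))

lemma CommSeries.commute_evalh {a b c d : L →ₗ[K] A} {P : PowerSeries A} (ha : CommSeries a P)
    (hb : CommSeries b P) (hc : CommSeries c P) (hd : CommSeries d P) :
    Commute (Φ.series.evalh (t.act a b) (t.act c d)) P :=
  Φ.series.commute_evalh_left (commute_C_act ha hb) (commute_C_act hc hd)

lemma Comm.listRep {R : I → (L →ₗ[K] A)} {f : L →ₗ[K] A} {l : List I}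
    (h : ∀ i ∈ l, Comm f (R i)) : Comm f (listRep R l) := by
  induction l with
  | nil => exact Comm.zero_right f
  | cons i l ih =>
    exact (h i List.mem_cons_self).add_right (ih fun j hj => h j (List.mem_cons_of_mem _ hj))

lemma CommSeries.listRep {R : I → (L →ₗ[K] A)} {P : PowerSeries A} {l : List I}
    (h : ∀ i ∈ l, CommSeries (R i) P) : CommSeries (listRep R l) P := by
  induction l with
  | nil => exact CommSeries.zero P
  | cons i l ih =>
    exact (h i List.mem_cons_self).add (ih fun j hj => h j (List.mem_cons_of_mem _ hj))

lemma CommSeries.list_prod {f : L →ₗ[K] A} {l : List I} {P : I → PowerSeries A}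
    (h : ∀ i ∈ l, CommSeries f (P i)) : CommSeries f (l.map P).prod := by
  intro a
  refine Commute.list_prod_right _ _ fun y hy => ?_
  obtain ⟨i, hi, rfl⟩ := List.mem_map.1 hy
  exact h i hi a

lemma listRep_add (R R' : I → (L →ₗ[K] A)) (l : List I) :
    listRep (R + R') l = listRep R l + listRep R' l := by
  induction l with
  | nil => simp [QuantumFusion.listRep]
  | cons i l ih =>
    have h : ∀ R : I → (L →ₗ[K] A),
      QuantumFusion.listRep R (i :: l) = R i + QuantumFusion.listRep R l := fun _ => rfl
    rw [h, h, h, ih, Pi.add_apply]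
    abel

lemma listRep_flatMap {J : Type*} (R : I → (L →ₗ[K] A)) (φ : J → List I) (l : List J) :
    listRep R (l.flatMap φ) = listRep (fun j => listRep R (φ j)) l := by
  induction l with
  | nil => rfl
  | cons j l ih =>
    rw [List.flatMap_cons, listRep_append, ih]
    rfl

namespace CommFam

variable {R : I → (L →ₗ[K] A)} (hR : CommFam R)

include hR

lemma comm_listRep {l l' : List I} (h : l.Disjoint l') : Comm (listRep R l) (listRep R l') :=
  Comm.listRep fun i hi => (Comm.listRep fun j hj => hR.comm i j (by
    rintro rfl
    exact h hj hi)).symm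

lemma comm_listRep_of_notMem {i : I} {l : List I} (h : i ∉ l) : Comm (R i) (listRep R l) :=
  Comm.listRep fun j hj => hR.comm i j (by
    rintro rfl
    exact h hj)

/-- Repetitions have to be excluded, since twice an action is not an action in general. -/
lemma isRep_listRep {l : List I} (h : l.Nodup) : IsRep (listRep R l) := by
  induction l with
  | nil => exact IsRep.zero
  | cons i l ih =>
    have h := List.nodup_cons.1 h
    exact (hR.rep i).add (ih h.2) (hR.comm_listRep_of_notMem h.1)

/-- The letter `i` occurs exactly once in the list, and the other letters commute with `R i`. -/
lemma ad_listRep {l : List I} (h : l.Nodup) {i : I} (hi : i ∈ l) : Ad (listRep R l) (R i) := by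
  induction l with
  | nil => exact absurd hi List.not_mem_nil
  | cons j l ih =>
    have h := List.nodup_cons.1 h
    rcases List.mem_cons.1 hi with rfl | hi'
    · exact (hR.rep i).ad.add_left (hR.comm_listRep_of_notMem h.1).symm
    · refine (ih h.2 hi').add_left' (hR.comm j i ?_)
      rintro rfl
      exact h.1 hi'

end CommFam

/-- Two families of actions all of which commute, except possibly for members of the same family
with the same index. -/
structure CommPair (Ra Rb : I → (L →ₗ[K] A)) : Prop where
  left : CommFam Ra
  right : CommFam Rb
  comm : ∀ i j, Comm (Ra i) (Rb j)

lemma CommPair.comm_listRep {Ra Rb : I → (L →ₗ[K] A)} (h : CommPair Ra Rb) (l l' : List I) :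
    Comm (listRep Ra l) (listRep Rb l') :=
  Comm.listRep fun j _ => (Comm.listRep fun i _ => (h.comm i j).symm).symm

/-- The action of a possibly empty word of strands. -/
def repOne (R : I → (L →ₗ[K] A)) (T : WithOne (FreeMagma I)) : L →ₗ[K] A := listRep R (leavesOne T)

lemma repOne_one (R : I → (L →ₗ[K] A)) : repOne R 1 = 0 := rfl

lemma repOne_of (R : I → (L →ₗ[K] A)) (i : I) : repOne R (FreeMagma.of i : FreeMagma I) = R i :=
  listRep_singleton R i

lemma repOne_mul (R : I → (L →ₗ[K] A)) (T T' : WithOne (FreeMagma I)) :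
    repOne R (T * T') = repOne R T + repOne R T' := by
  rw [repOne, leavesOne_mul, listRep_append]
  rfl

/-- Induction on possibly empty parenthesized words. -/
lemma word_induction {P : WithOne (FreeMagma I) → Prop} (one : P 1)
    (of : ∀ i, P (FreeMagma.of i : FreeMagma I)) (mul : ∀ a b, P a → P b → P (a * b))
    (T : WithOne (FreeMagma I)) : P T := by
  induction T using WithOne.recOneCoe with
  | one => exact one
  | coe T =>
    induction T using FreeMagma.recOnMul with
    | ih1 i => exact of i
    | ih2 a b ha hb => exact mul _ _ ha hb

lemma leaves_treeA (T : FreeMagma I) : leaves (treeA T) = (leaves T).map Sum.inl := by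
  induction T using FreeMagma.recOnMul with
  | ih1 i => rfl
  | ih2 a b ha hb =>
    change leaves (treeA a) ++ leaves (treeA b) = (leaves a ++ leaves b).map _
    rw [ha, hb, List.map_append]

lemma leaves_treeB (T : FreeMagma I) : leaves (treeB T) = (leaves T).map Sum.inr := by
  induction T using FreeMagma.recOnMul with
  | ih1 i => rfl
  | ih2 a b ha hb =>
    change leaves (treeB a) ++ leaves (treeB b) = (leaves a ++ leaves b).map _
    rw [ha, hb, List.map_append]

variable (t Φ) in
/-- The element of the shuffle braid of a possibly empty word, where the strands `i^a` and `i^b`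
act through `Ra i` and `Rb i`. -/
noncomputable def shuffleElt (Ra Rb : I → (L →ₗ[K] A)) (T : WithOne (FreeMagma I)) :
    PowerSeries A :=
  WithOne.recOneCoe 1 (fun T => (shuffleBraid T).eval t Φ (Sum.elim Ra Rb)) T

variable {Ra Rb Rc : I → (L →ₗ[K] A)}

lemma shuffleElt_one : shuffleElt t Φ Ra Rb 1 = 1 := rfl

lemma shuffleElt_of (i : I) : shuffleElt t Φ Ra Rb (FreeMagma.of i : FreeMagma I) = 1 := rfl

lemma eval_interchange {S : Type*} (R : S → (L →ₗ[K] A)) (a b c d : FreeMagma S) :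
    (interchange a b c d).eval t Φ R = interchangeElt t Φ (listRep R (leaves a))
      (listRep R (leaves b)) (listRep R (leaves c)) (listRep R (leaves d)) := by
  have h : ∀ a b : FreeMagma S, listRep R (leaves (a * b)) =
    listRep R (leaves a) + listRep R (leaves b) := fun a b => listRep_append R _ _
  simp only [interchange, ParBraid.eval, strandSum_eq, h, interchangeElt, one_mul, mul_one]

lemma shuffleElt_coe_mul (a b : FreeMagma I) :
    shuffleElt t Φ Ra Rb ((a * b : FreeMagma I) : WithOne (FreeMagma I)) =
      shuffleElt t Φ Ra Rb a * shuffleElt t Φ Ra Rb b *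
        interchangeElt t Φ (listRep Ra (leaves a)) (listRep Ra (leaves b)) (listRep Rb (leaves a))
          (listRep Rb (leaves b)) := by
  have hA : ∀ a : FreeMagma I, listRep (Sum.elim Ra Rb) (leaves (treeA a)) =
      listRep Ra (leaves a) := fun a => by
    rw [leaves_treeA, listRep, List.map_map, Sum.elim_comp_inl]
    rfl
  have hB : ∀ a : FreeMagma I, listRep (Sum.elim Ra Rb) (leaves (treeB a)) =
      listRep Rb (leaves a) := fun a => by
    rw [leaves_treeB, listRep, List.map_map, Sum.elim_comp_inr]
    rfl
  rw [← hA, ← hA, ← hB, ← hB, ← eval_interchange]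
  rfl

/-- The recursion behind every induction on words below. It includes empty words, for which the
interchange is `1`, so later proofs need not treat them separately in products. -/
lemma shuffleElt_mul (a b : WithOne (FreeMagma I)) :
    shuffleElt t Φ Ra Rb (a * b) = shuffleElt t Φ Ra Rb a * shuffleElt t Φ Ra Rb b *
      interchangeElt t Φ (repOne Ra a) (repOne Ra b) (repOne Rb a) (repOne Rb b) := by
  induction a using WithOne.recOneCoe with
  | one =>
    rw [repOne_one, repOne_one, interchangeElt_zero₁₃, shuffleElt_one, one_mul, one_mul, mul_one]
  | coe a =>
    induction b using WithOne.recOneCoe with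
    | one => rw [repOne_one, repOne_one, interchangeElt_zero₂₄, shuffleElt_one, mul_one, mul_one,
        mul_one]
    | coe b => exact shuffleElt_coe_mul a b

lemma isUnit_shuffleElt (T : WithOne (FreeMagma I)) : IsUnit (shuffleElt t Φ Ra Rb T) := by
  induction T using word_induction with
  | one => exact isUnit_one
  | of i => exact isUnit_one
  | mul a b ha hb =>
    rw [shuffleElt_mul]
    exact (ha.mul hb).mul (isUnit_interchangeElt _ _ _ _ _ _)

/-- Locality. -/
lemma commute_shuffleElt {P : PowerSeries A} {T : WithOne (FreeMagma I)}
    (ha : ∀ i ∈ leavesOne T, CommSeries (Ra i) P) (hb : ∀ i ∈ leavesOne T, CommSeries (Rb i) P) :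
    Commute (shuffleElt t Φ Ra Rb T) P := by
  induction T using word_induction with
  | one => exact Commute.one_left _
  | of i => exact Commute.one_left _
  | mul x y hx hy =>
    simp only [leavesOne_mul, List.mem_append] at ha hb
    rw [shuffleElt_mul]
    refine Commute.mul_left (Commute.mul_left (hx (fun i hi => ha i (.inl hi))
      fun i hi => hb i (.inl hi)) (hy (fun i hi => ha i (.inr hi)) fun i hi => hb i (.inr hi))) ?_
    exact commute_interchangeElt (CommSeries.listRep fun i hi => ha i (.inl hi))
      (CommSeries.listRep fun i hi => ha i (.inr hi))
      (CommSeries.listRep fun i hi => hb i (.inl hi))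
      (CommSeries.listRep fun i hi => hb i (.inr hi))

lemma commSeries_C {f g : L →ₗ[K] A} (h : Comm f g) (z : L) : CommSeries f (C (g z)) := fun a =>
  ((h a z).map (C (R := A)) :)

lemma commSeries_shuffleElt {f : L →ₗ[K] A} {T : WithOne (FreeMagma I)}
    (ha : ∀ i ∈ leavesOne T, Comm f (Ra i)) (hb : ∀ i ∈ leavesOne T, Comm f (Rb i)) :
    CommSeries f (shuffleElt t Φ Ra Rb T) := fun z =>
  (commute_shuffleElt (fun i hi => commSeries_C (ha i hi).symm z)
    fun i hi => commSeries_C (hb i hi).symm z).symm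

/-- Equivariance. -/
lemma commSeries_shuffleElt_tot (h : CommPair Ra Rb) {T : WithOne (FreeMagma I)}
    (hT : (leavesOne T).Nodup) :
    CommSeries (repOne Ra T + repOne Rb T) (shuffleElt t Φ Ra Rb T) := by
  induction T using word_induction with
  | one => exact CommSeries.one _
  | of i => exact CommSeries.one _
  | mul x y hx hy =>
    rw [leavesOne_mul, List.nodup_append'] at hT
    obtain ⟨hx', hy', hxy⟩ := hT
    have caa := h.left.comm_listRep hxy
    have cbb := h.right.comm_listRep hxy
    have cab := h.comm_listRep
    rw [repOne_mul, repOne_mul, shuffleElt_mul]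
    have ex : CommSeries (repOne Ra x + repOne Rb x) (shuffleElt t Φ Ra Rb y) :=
      commSeries_shuffleElt
        (fun i hi => Comm.add_left (h.left.comm_listRep_of_notMem fun hi' => hxy hi' hi).symm
          (Comm.listRep fun j _ => h.comm i j).symm)
        (fun i hi => Comm.add_left (Comm.listRep fun j _ => (h.comm j i).symm).symm
          (h.right.comm_listRep_of_notMem fun hi' => hxy hi' hi).symm)
    have ey : CommSeries (repOne Ra y + repOne Rb y) (shuffleElt t Φ Ra Rb x) :=
      commSeries_shuffleElt
        (fun i hi => Comm.add_left (h.left.comm_listRep_of_notMem fun hi' => hxy hi hi').symm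
          (Comm.listRep fun j _ => h.comm i j).symm)
        (fun i hi => Comm.add_left (Comm.listRep fun j _ => (h.comm j i).symm).symm
          (h.right.comm_listRep_of_notMem fun hi' => hxy hi hi').symm)
    -- The total action is regrouped by words. The part of a word commutes with the shuffle of that
    -- word by induction, and with the shuffle of the other one by locality.
    have e : repOne Ra x + repOne Ra y + (repOne Rb x + repOne Rb y) =
        (repOne Ra x + repOne Rb x) + (repOne Ra y + repOne Rb y) := by abel
    refine CommSeries.mul (CommSeries.mul ?_ ?_) ?_
    · rw [e]
      exact (hx hx').add ey
    · rw [e]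
      exact ex.add (hy hy')
    -- On each of the four cables the total action is the adjoint action of that cable, since the
    -- remaining three commute with it.
    · refine Ad.commSeries_interchangeElt ?_ ?_ ?_ ?_
      · exact ((h.left.isRep_listRep hx').ad.add_left caa.symm).add_left
          ((cab _ _).symm.add_left (cab _ _).symm)
      · exact ((h.left.isRep_listRep hy').ad.add_left' caa).add_left
          ((cab _ _).symm.add_left (cab _ _).symm)
      · exact ((h.right.isRep_listRep hx').ad.add_left cbb.symm).add_left'
          ((cab _ _).add_left (cab _ _))
      · exact ((h.right.isRep_listRep hy').ad.add_left' cbb).add_left'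
          ((cab _ _).add_left (cab _ _))

end Words

/-! ### Shuffle elements and the associators of three modules -/

section Associativity

open PowerSeries (C coeff)

variable {K : Type u} [Field K] {L : Type v} [LieRing L] [LieAlgebra K L]
  {A : Type w} [Ring A] [Algebra K A] {t : InvTensor K L} {Φ : DrinfeldAssociator K}
  {I : Type x} {Ra Rb Rc : I → (L →ₗ[K] A)}

/-- The rearrangement of commuting factors behind the compatibility of the shuffle braids with
associators. -/
lemma shuffle_rearrange {M : Type*} [Monoid M] {Px Py Sx Sy sx sy Ux Uy ux uy Fx Fy I₁ I₂ J₁ J₂ F : M}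
    (hx : Px * Sx * sx = Ux * ux * Fx) (hy : Py * Sy * sy = Uy * uy * Fy)
    (hI : Fy * Fx * I₁ * I₂ = J₁ * J₂ * F) (hF : Commute Fx Fy)
    (h₁ : Commute Sx Py) (h₂ : Commute sx Py) (h₃ : Commute sx Sy)
    (h₄ : Commute sx I₁) (h₅ : Commute sy I₁) (h₆ : Commute Fx Uy) (h₇ : Commute Fx uy)
    (h₈ : Commute ux Uy) (h₉ : Commute ux J₁) (h₀ : Commute uy J₁) :
    Px * Py * (Sx * Sy * I₁) * (sx * sy * I₂) =
      Ux * Uy * J₁ * (ux * uy * J₂) * F := by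
  calc Px * Py * (Sx * Sy * I₁) * (sx * sy * I₂)
      = (Px * Sx * sx) * (Py * Sy * sy) * I₁ * I₂ := by
        simp only [mul_assoc]
        rw [h₅.left_comm, h₄.symm.left_comm, h₃.symm.left_comm, h₁.symm.left_comm, h₂.symm.left_comm]
    _ = Ux * Uy * ux * uy * (Fy * Fx * I₁ * I₂) := by
        rw [hx, hy, ← hF.eq]
        simp only [mul_assoc]
        rw [h₆.left_comm, h₇.left_comm, h₈.left_comm]
    _ = _ := by
        rw [hI]
        simp only [mul_assoc]
        rw [h₀.left_comm, h₉.left_comm]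

lemma commFam_six (hab : CommPair Ra Rb) (hac : CommPair Ra Rc) (hbc : CommPair Rb Rc)
    {x y : WithOne (FreeMagma I)} (hx : (leavesOne x).Nodup) (hy : (leavesOne y).Nodup)
    (hxy : (leavesOne x).Disjoint (leavesOne y)) :
    CommFam ![repOne Ra x, repOne Ra y, repOne Rb x, repOne Rb y, repOne Rc x, repOne Rc y] where
  rep i := by
    fin_cases i
    exacts [hab.left.isRep_listRep hx, hab.left.isRep_listRep hy, hab.right.isRep_listRep hx,
      hab.right.isRep_listRep hy, hac.right.isRep_listRep hx, hac.right.isRep_listRep hy]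
  comm := by
    have h : ∀ i j : Fin 6, i < j → Comm (![repOne Ra x, repOne Ra y, repOne Rb x, repOne Rb y,
        repOne Rc x, repOne Rc y] i) (![repOne Ra x, repOne Ra y, repOne Rb x, repOne Rb y,
        repOne Rc x, repOne Rc y] j) := by
      intro i j hij
      fin_cases i <;> fin_cases j <;> first
        | exact absurd hij (by decide)
        | exact hab.left.comm_listRep hxy
        | exact hab.right.comm_listRep hxy
        | exact hac.right.comm_listRep hxy
        | exact hab.comm_listRep _ _
        | exact hac.comm_listRep _ _
        | exact hbc.comm_listRep _ _
    intro i j hij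
    rcases lt_or_gt_of_ne hij with h' | h'
    · exact h i j h'
    · exact (h j i h').symm

/-- The actions are six variables instead of values of one function. In this form the identity can
be instantiated with cables. -/
lemma interchangeElt_assoc' {a b c d e f : L →ₗ[K] A} (h : CommFam ![a, b, c, d, e, f]) :
    Φ.series.evalh (t.act b d) (t.act d f) * Φ.series.evalh (t.act a c) (t.act c e) *
      interchangeElt t Φ (a + c) (b + d) e f * interchangeElt t Φ a b c d =
    interchangeElt t Φ a b (c + e) (d + f) * interchangeElt t Φ c d e f *
      Φ.series.evalh (t.act (a + b) (c + d)) (t.act (c + d) (e + f)) := by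
  obtain ⟨R, hR⟩ : ∃ R : Fin 6 → (L →ₗ[K] A), ![a, b, c, d, e, f] = R := ⟨_, rfl⟩
  have e₀ : a = R 0 := congrFun hR 0
  have e₁ : b = R 1 := congrFun hR 1
  have e₂ : c = R 2 := congrFun hR 2
  have e₃ : d = R 3 := congrFun hR 3
  have e₄ : e = R 4 := congrFun hR 4
  have e₅ : f = R 5 := congrFun hR 5
  rw [e₀, e₁, e₂, e₃, e₄, e₅]
  rw [hR] at h
  exact interchangeElt_assoc h

lemma interchangeElt_six (hab : CommPair Ra Rb) (hac : CommPair Ra Rc) (hbc : CommPair Rb Rc)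
    {x y : WithOne (FreeMagma I)} (hx : (leavesOne x).Nodup) (hy : (leavesOne y).Nodup)
    (hxy : (leavesOne x).Disjoint (leavesOne y)) :
    Φ.series.evalh (t.act (repOne Ra y) (repOne Rb y)) (t.act (repOne Rb y) (repOne Rc y)) *
      Φ.series.evalh (t.act (repOne Ra x) (repOne Rb x)) (t.act (repOne Rb x) (repOne Rc x)) *
      interchangeElt t Φ (repOne Ra x + repOne Rb x) (repOne Ra y + repOne Rb y) (repOne Rc x)
        (repOne Rc y) * interchangeElt t Φ (repOne Ra x) (repOne Ra y) (repOne Rb x) (repOne Rb y) =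
    interchangeElt t Φ (repOne Ra x) (repOne Ra y) (repOne Rb x + repOne Rc x)
        (repOne Rb y + repOne Rc y) *
      interchangeElt t Φ (repOne Rb x) (repOne Rb y) (repOne Rc x) (repOne Rc y) *
      Φ.series.evalh
        (t.act (repOne Ra x + repOne Ra y) (repOne Rb x + repOne Rb y))
        (t.act (repOne Rb x + repOne Rb y) (repOne Rc x + repOne Rc y)) :=
  interchangeElt_assoc' (commFam_six hab hac hbc hx hy hxy)

variable (t Φ) in
/-- The action of the associators on the strands of a word. -/
noncomputable def assocElt (Ra Rb Rc : I → (L →ₗ[K] A)) (l : List I) : PowerSeries A :=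
  (l.map fun i => Φ.series.evalh (t.act (Ra i) (Rb i)) (t.act (Rb i) (Rc i))).prod

lemma assocElt_append (l l' : List I) :
    assocElt t Φ Ra Rb Rc (l ++ l') = assocElt t Φ Ra Rb Rc l * assocElt t Φ Ra Rb Rc l' := by
  rw [assocElt, List.map_append, List.prod_append]
  rfl

lemma assocElt_singleton (i : I) : assocElt t Φ Ra Rb Rc (leavesOne (FreeMagma.of i : FreeMagma I)) =
    Φ.series.evalh (t.act (Ra i) (Rb i)) (t.act (Rb i) (Rc i)) := List.prod_singleton

lemma commSeries_assocElt {f : L →ₗ[K] A} {l : List I} (ha : ∀ i ∈ l, Comm f (Ra i))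
    (hb : ∀ i ∈ l, Comm f (Rb i)) (hc : ∀ i ∈ l, Comm f (Rc i)) :
    CommSeries f (assocElt t Φ Ra Rb Rc l) :=
  CommSeries.list_prod fun i hi => (ha i hi).commSeries_evalh (hb i hi) (hb i hi) (hc i hi)

lemma repOne_add (R R' : I → (L →ₗ[K] A)) (T : WithOne (FreeMagma I)) :
    repOne (R + R') T = repOne R T + repOne R' T := listRep_add R R' _

/-- Compatibility of the shuffle braids with associators. -/
lemma assocElt_shuffleElt (hab : CommPair Ra Rb) (hac : CommPair Ra Rc) (hbc : CommPair Rb Rc)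
    {T : WithOne (FreeMagma I)} (hT : (leavesOne T).Nodup) :
    assocElt t Φ Ra Rb Rc (leavesOne T) * shuffleElt t Φ (Ra + Rb) Rc T * shuffleElt t Φ Ra Rb T =
      shuffleElt t Φ Ra (Rb + Rc) T * shuffleElt t Φ Rb Rc T *
        Φ.series.evalh (t.act (repOne Ra T) (repOne Rb T)) (t.act (repOne Rb T) (repOne Rc T)) := by
  induction T using word_induction with
  | one =>
    rw [repOne_one, repOne_one, InvTensor.act_zero_left, InvTensor.act_zero_left,
      DrinfeldCat.evalh_zero]
    simp only [shuffleElt_one, mul_one]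
    rfl
  | of i =>
    rw [repOne_of, repOne_of, repOne_of]
    simp only [shuffleElt_of, mul_one, one_mul]
    exact assocElt_singleton i
  | mul x y ihx ihy =>
    rw [leavesOne_mul, List.nodup_append'] at hT
    obtain ⟨hx, hy, hxy⟩ := hT
    -- The inductive step reduces to the associativity of the middle interchange for the six cables
    -- of `x` and `y` in the three modules. The rest consists of moving commuting factors past each
    -- other.
    have hI := interchangeElt_six (t := t) (Φ := Φ) hab hac hbc hx hy hxy
    have ca : ∀ i ∈ leavesOne x, (∀ j ∈ leavesOne y, Comm (Ra i) (Ra j)) ∧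
        (∀ j ∈ leavesOne y, Comm (Ra i) (Rb j)) ∧ (∀ j ∈ leavesOne y, Comm (Ra i) (Rc j)) :=
      fun i hi => ⟨fun j hj => hab.left.comm i j fun e => hxy hi (e ▸ hj), fun j _ => hab.comm i j,
        fun j _ => hac.comm i j⟩
    have cb : ∀ i ∈ leavesOne x, (∀ j ∈ leavesOne y, Comm (Rb i) (Ra j)) ∧
        (∀ j ∈ leavesOne y, Comm (Rb i) (Rb j)) ∧ (∀ j ∈ leavesOne y, Comm (Rb i) (Rc j)) :=
      fun i hi => ⟨fun j _ => (hab.comm j i).symm,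
        fun j hj => hab.right.comm i j fun e => hxy hi (e ▸ hj), fun j _ => hbc.comm i j⟩
    have cc : ∀ i ∈ leavesOne x, (∀ j ∈ leavesOne y, Comm (Rc i) (Ra j)) ∧
        (∀ j ∈ leavesOne y, Comm (Rc i) (Rb j)) ∧ (∀ j ∈ leavesOne y, Comm (Rc i) (Rc j)) :=
      fun i hi => ⟨fun j _ => (hac.comm j i).symm, fun j _ => (hbc.comm j i).symm,
        fun j hj => hac.right.comm i j fun e => hxy hi (e ▸ hj)⟩
    -- The four series attached to `x` commute with any series which is local to the strands of `y`.
    -- This is proved once and applied to the five series attached to `y`.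
    have key : ∀ Q : PowerSeries A, (∀ f : L →ₗ[K] A, (∀ j ∈ leavesOne y, Comm f (Ra j)) ∧
        (∀ j ∈ leavesOne y, Comm f (Rb j)) ∧ (∀ j ∈ leavesOne y, Comm f (Rc j)) → CommSeries f Q) →
        Commute (shuffleElt t Φ (Ra + Rb) Rc x) Q ∧ Commute (shuffleElt t Φ Ra Rb x) Q ∧
        Commute (shuffleElt t Φ Rb Rc x) Q ∧ Commute (Φ.series.evalh (t.act (repOne Ra x)
          (repOne Rb x)) (t.act (repOne Rb x) (repOne Rc x))) Q := by
      intro Q hQ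
      have a : ∀ i ∈ leavesOne x, CommSeries (Ra i) Q := fun i hi => hQ _ (ca i hi)
      have b : ∀ i ∈ leavesOne x, CommSeries (Rb i) Q := fun i hi => hQ _ (cb i hi)
      have c : ∀ i ∈ leavesOne x, CommSeries (Rc i) Q := fun i hi => hQ _ (cc i hi)
      exact ⟨commute_shuffleElt (fun i hi => (a i hi).add (b i hi)) c, commute_shuffleElt a b,
        commute_shuffleElt b c, CommSeries.commute_evalh (CommSeries.listRep a)
          (CommSeries.listRep b) (CommSeries.listRep b) (CommSeries.listRep c)⟩
    have kP := key (assocElt t Φ Ra Rb Rc (leavesOne y)) fun f h =>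
      commSeries_assocElt h.1 h.2.1 h.2.2
    have kS := key (shuffleElt t Φ (Ra + Rb) Rc y) fun f h =>
      commSeries_shuffleElt (fun i hi => (h.1 i hi).add_right (h.2.1 i hi)) h.2.2
    have kU := key (shuffleElt t Φ Ra (Rb + Rc) y) fun f h =>
      commSeries_shuffleElt h.1 (fun i hi => (h.2.1 i hi).add_right (h.2.2 i hi))
    have ku := key (shuffleElt t Φ Rb Rc y) fun f h => commSeries_shuffleElt h.2.1 h.2.2
    have kΦ := key (Φ.series.evalh (t.act (repOne Ra y) (repOne Rb y))
      (t.act (repOne Rb y) (repOne Rc y))) fun f h => Comm.commSeries_evalh (Comm.listRep h.1)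
        (Comm.listRep h.2.1) (Comm.listRep h.2.1) (Comm.listRep h.2.2)
    rw [leavesOne_mul, assocElt_append, shuffleElt_mul, shuffleElt_mul, shuffleElt_mul,
      shuffleElt_mul]
    simp only [repOne_mul, repOne_add]
    have yx : ∀ {Ra Rb Rc : I → (L →ₗ[K] A)}, (∀ j ∈ leavesOne y, ∀ i ∈ leavesOne x,
        Comm (Rc j) (Ra i) ∧ Comm (Rc j) (Rb i)) →
        CommSeries (repOne Rc y) (shuffleElt t Φ Ra Rb x) := fun h =>
      CommSeries.listRep fun j hj => commSeries_shuffleElt (fun i hi => (h j hj i hi).1)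
        fun i hi => (h j hj i hi).2
    have xy : ∀ {Ra Rb Rc : I → (L →ₗ[K] A)}, (∀ i ∈ leavesOne x, ∀ j ∈ leavesOne y,
        Comm (Rc i) (Ra j) ∧ Comm (Rc i) (Rb j)) →
        CommSeries (repOne Rc x) (shuffleElt t Φ Ra Rb y) := fun h =>
      CommSeries.listRep fun j hj => commSeries_shuffleElt (fun i hi => (h j hj i hi).1)
        fun i hi => (h j hj i hi).2
    have zz : ∀ {z z' : WithOne (FreeMagma I)},
        CommSeries (repOne Rc z) (shuffleElt t Φ Ra Rb z') := fun {_ _} =>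
      CommSeries.listRep fun j _ => commSeries_shuffleElt (fun i _ => (hac.comm i j).symm)
        fun i _ => (hbc.comm i j).symm
    have zz' : ∀ {z z' : WithOne (FreeMagma I)},
        CommSeries (repOne Ra z) (shuffleElt t Φ Rb Rc z') := fun {_ _} =>
      CommSeries.listRep fun j _ => commSeries_shuffleElt (fun i _ => hab.comm j i)
        fun i _ => hac.comm j i
    refine shuffle_rearrange (ihx hx) (ihy hy) hI kΦ.2.2.2 kP.1 kP.2.1 kS.2.1 ?_ ?_
      kU.2.2.2 ku.2.2.2 kU.2.2.1 ?_ ?_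
    -- A shuffle commutes with an interchange in which its own strands occur only as a whole cable
    -- `a + b` or `b + c`: by equivariance for that cable, by locality for the others. The next
    -- three goals are of the same kind.
    · refine (commute_interchangeElt (commSeries_shuffleElt_tot hab hx)
        ((yx fun j hj i hi => ?_).add (yx fun j hj i hi => ?_)) zz zz).symm
      · exact ⟨((ca i hi).1 j hj).symm, ((cb i hi).1 j hj).symm⟩
      · exact ⟨((ca i hi).2.1 j hj).symm, ((cb i hi).2.1 j hj).symm⟩
    · refine (commute_interchangeElt ((xy fun j hj i hi => ?_).add (xy fun j hj i hi => ?_))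
        (commSeries_shuffleElt_tot hab hy) zz zz).symm
      · exact ⟨(ca j hj).1 i hi, (ca j hj).2.1 i hi⟩
      · exact ⟨(cb j hj).1 i hi, (cb j hj).2.1 i hi⟩
    · refine (commute_interchangeElt zz' zz' (commSeries_shuffleElt_tot hbc hx)
        ((yx fun j hj i hi => ?_).add (yx fun j hj i hi => ?_))).symm
      · exact ⟨((cb i hi).2.1 j hj).symm, ((cc i hi).2.1 j hj).symm⟩
      · exact ⟨((cb i hi).2.2 j hj).symm, ((cc i hi).2.2 j hj).symm⟩
    · refine (commute_interchangeElt zz' zz' ((xy fun j hj i hi => ?_).add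
        (xy fun j hj i hi => ?_)) (commSeries_shuffleElt_tot hbc hy)).symm
      · exact ⟨(cb j hj).2.1 i hi, (cb j hj).2.2 i hi⟩
      · exact ⟨(cc j hj).2.1 i hi, (cc j hj).2.2 i hi⟩

end Associativity

/-! ### Functoriality in the algebra, and naturality under reparenthesization -/

section Naturality

open PowerSeries (C coeff)

variable {K : Type u} [Field K] {L : Type v} [LieRing L] [LieAlgebra K L]
  {A : Type w} [Ring A] [Algebra K A] {t : InvTensor K L} {Φ : DrinfeldAssociator K}
  {I : Type x} {R Ra Rb Rc : I → (L →ₗ[K] A)}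

lemma repOne_zero (T : WithOne (FreeMagma I)) : repOne (0 : I → (L →ₗ[K] A)) T = 0 := by
  induction T using word_induction with
  | one => rfl
  | of i => exact repOne_of _ i
  | mul a b ha hb => rw [repOne_mul, ha, hb, add_zero]

/-- The case of a trivial first module: every interchange in the recursion has vanishing `a`-cables.
-/
lemma shuffleElt_zero_left (T : WithOne (FreeMagma I)) : shuffleElt t Φ 0 Rb T = 1 := by
  induction T using word_induction with
  | one => rfl
  | of i => rfl
  | mul a b ha hb =>
    rw [shuffleElt_mul, ha, hb, repOne_zero, repOne_zero, interchangeElt_zero₁₂, one_mul, one_mul]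

lemma shuffleElt_zero_right (T : WithOne (FreeMagma I)) : shuffleElt t Φ Ra 0 T = 1 := by
  induction T using word_induction with
  | one => rfl
  | of i => rfl
  | mul a b ha hb =>
    rw [shuffleElt_mul, ha, hb, repOne_zero, repOne_zero, interchangeElt_zero₃₄, one_mul, one_mul]

section Map

variable {B : Type*} [Ring B] [Algebra K B] (φ : A →ₐ[K] B)

lemma map_listRep (R : I → (L →ₗ[K] A)) (l : List I) :
    φ.toLinearMap ∘ₗ listRep R l = listRep (fun i => φ.toLinearMap ∘ₗ R i) l := by
  induction l with
  | nil => exact LinearMap.comp_zero _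
  | cons i l ih =>
    change φ.toLinearMap ∘ₗ (R i + listRep R l) = _
    rw [LinearMap.comp_add, ih]
    rfl

/-- The element is given by a formula in the actions, hence is compatible with homomorphisms of
algebras. This serves to pass from enveloping algebras to modules, from one module to a tensor
product, and to both projections of the algebra of intertwined pairs. -/
lemma ParBraid.map_eval {a b : FreeMagma I} (f : ParBraid a b) :
    PowerSeries.map φ.toRingHom (f.eval t Φ R) = f.eval t Φ fun i => φ.toLinearMap ∘ₗ R i := by
  have h : ∀ a b : FreeMagma I, φ (strandSum t R a b) =
      strandSum t (fun i => φ.toLinearMap ∘ₗ R i) a b := fun a b => by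
    rw [strandSum_eq, strandSum_eq, map_act, map_listRep, map_listRep]
  induction f with
  | id a => exact map_one _
  | comp f g hf hg => rw [ParBraid.eval, ParBraid.eval, map_mul, hf, hg]
  | tensor f g hf hg => rw [ParBraid.eval, ParBraid.eval, map_mul, hf, hg]
  | assoc a b c => rw [ParBraid.eval, ParBraid.eval, NCSeries.map_evalh, h, h]
  | assocInv a b c =>
    rw [ParBraid.eval, ParBraid.eval, map_psInv _ (Φ.isUnit_evalh _ _), NCSeries.map_evalh, h, h]
  | cross a b => rw [ParBraid.eval, ParBraid.eval, map_exph, map_smul, h]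

lemma map_shuffleElt (T : WithOne (FreeMagma I)) :
    PowerSeries.map φ.toRingHom (shuffleElt t Φ Ra Rb T) =
      shuffleElt t Φ (fun i => φ.toLinearMap ∘ₗ Ra i) (fun i => φ.toLinearMap ∘ₗ Rb i) T := by
  induction T using WithOne.recOneCoe with
  | one => exact map_one _
  | coe T =>
    refine ((shuffleBraid T).map_eval φ).trans ?_
    refine congrArg (fun R => (shuffleBraid T).eval t Φ R) ?_
    funext s
    rcases s with i | i <;> rfl

end Map

/-- Locality. -/
lemma ParBraid.commute_eval_series {P : PowerSeries A} {a b : FreeMagma I} (f : ParBraid a b)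
    (h : ∀ i ∈ leaves a, CommSeries (R i) P) : Commute (f.eval t Φ R) P := by
  have hs : ∀ a b : FreeMagma I, (∀ i ∈ leaves a, CommSeries (R i) P) →
      (∀ i ∈ leaves b, CommSeries (R i) P) → Commute (C (strandSum t R a b)) P := by
    intro a b ha hb
    rw [strandSum_eq]
    exact commute_C_act (CommSeries.listRep ha) (CommSeries.listRep hb)
  induction f with
  | id a => exact Commute.one_left _
  | comp f g hf hg => exact (hg fun i hi => h i ((f.mem_leaves i).1 hi)).mul_left (hf h)
  | tensor f g hf hg =>
    exact (hf fun i hi => h i (List.mem_append_left _ hi)).mul_left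
      (hg fun i hi => h i (List.mem_append_right _ hi))
  | assoc a b c =>
    have ha : ∀ i ∈ leaves a, CommSeries (R i) P :=
      fun i hi => h i (List.mem_append_left _ (List.mem_append_left _ hi))
    have hb : ∀ i ∈ leaves b, CommSeries (R i) P :=
      fun i hi => h i (List.mem_append_left _ (List.mem_append_right _ hi))
    have hc : ∀ i ∈ leaves c, CommSeries (R i) P := fun i hi => h i (List.mem_append_right _ hi)
    exact Φ.series.commute_evalh_left (hs a b ha hb) (hs b c hb hc)
  | assocInv a b c =>
    have ha : ∀ i ∈ leaves a, CommSeries (R i) P := fun i hi => h i (List.mem_append_left _ hi)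
    have hb : ∀ i ∈ leaves b, CommSeries (R i) P :=
      fun i hi => h i (List.mem_append_right _ (List.mem_append_left _ hi))
    have hc : ∀ i ∈ leaves c, CommSeries (R i) P :=
      fun i hi => h i (List.mem_append_right _ (List.mem_append_right _ hi))
    exact commute_psInv_left (Φ.series.commute_evalh_left (hs a b ha hb) (hs b c hb hc))
  | cross a b =>
    exact commute_exph_left (commute_C_smul _ (hs a b (fun i hi => h i (List.mem_append_left _ hi))
      fun i hi => h i (List.mem_append_right _ hi)))

lemma ParBraid.commSeries_eval {f : L →ₗ[K] A} {a b : FreeMagma I} (β : ParBraid a b)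
    (h : ∀ i ∈ leaves a, Comm f (R i)) : CommSeries f (β.eval t Φ R) := fun z =>
  (β.commute_eval_series fun i hi => commSeries_C (h i hi).symm z).symm

/-- Equivariance. -/
lemma ParBraid.commSeries_eval_tot (hR : CommFam R) {a b : FreeMagma I} (β : ParBraid a b)
    (ha : (leaves a).Nodup) : CommSeries (listRep R (leaves a)) (β.eval t Φ R) := fun z =>
  (commute_C_iff _ _).2 fun n => β.commute_eval (fun _ hi _ hj =>
    t.commute_act_of_lie (hR.ad_listRep ha hi z) (hR.ad_listRep ha hj z)) n

lemma ParBraid.NoCross.leaves_eq {a b : FreeMagma I} {f : ParBraid a b} (hf : f.NoCross) :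
    leaves b = leaves a := by
  induction f with
  | id a => rfl
  | comp f g ihf ihg => rw [ihg hf.2, ihf hf.1]
  | tensor f g ihf ihg =>
    change leaves _ ++ leaves _ = leaves _ ++ leaves _
    rw [ihf hf.1, ihg hf.2]
  | assoc a b c => exact (List.append_assoc _ _ _).symm
  | assocInv a b c => exact List.append_assoc _ _ _
  | cross a b => exact hf.elim

lemma associator_interchangeElt' {a b c d e f : L →ₗ[K] A} (h : CommFam ![a, b, c, d, e, f]) :
    Φ.series.evalh (t.act (a + d) (b + e)) (t.act (b + e) (c + f)) *
        interchangeElt t Φ a b d e * interchangeElt t Φ (a + b) c (d + e) f =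
      interchangeElt t Φ b c e f * interchangeElt t Φ a (b + c) d (e + f) *
        (Φ.series.evalh (t.act d e) (t.act e f) * Φ.series.evalh (t.act a b) (t.act b c)) := by
  obtain ⟨R, hR⟩ : ∃ R : Fin 6 → (L →ₗ[K] A), ![a, b, c, d, e, f] = R := ⟨_, rfl⟩
  have e₀ : a = R 0 := congrFun hR 0
  have e₁ : b = R 1 := congrFun hR 1
  have e₂ : c = R 2 := congrFun hR 2
  have e₃ : d = R 3 := congrFun hR 3
  have e₄ : e = R 4 := congrFun hR 4
  have e₅ : f = R 5 := congrFun hR 5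
  rw [e₀, e₁, e₂, e₃, e₄, e₅]
  rw [hR] at h
  exact associator_interchangeElt h

/-- By the recursion both sides contain the shuffles of `x`, `y` and `z` and two interchanges. The
interchanges and associators match by the monoidality of the associator for six cables. -/
lemma shuffleElt_assoc (h : CommPair Ra Rb) {x y z : WithOne (FreeMagma I)}
    (hT : (leavesOne (x * y * z)).Nodup) :
    shuffleElt t Φ Ra Rb (x * (y * z)) *
      (Φ.series.evalh (t.act (repOne Ra x) (repOne Ra y)) (t.act (repOne Ra y) (repOne Ra z)) *
        Φ.series.evalh (t.act (repOne Rb x) (repOne Rb y)) (t.act (repOne Rb y) (repOne Rb z))) =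
    Φ.series.evalh (t.act (repOne (Ra + Rb) x) (repOne (Ra + Rb) y))
        (t.act (repOne (Ra + Rb) y) (repOne (Ra + Rb) z)) *
      shuffleElt t Φ Ra Rb (x * y * z) := by
  rw [leavesOne_mul, leavesOne_mul, List.nodup_append', List.nodup_append',
    List.disjoint_append_left] at hT
  obtain ⟨⟨hx, hy, hxy⟩, hz, hxz, hyz⟩ := hT
  have hF : CommFam ![repOne Ra x, repOne Ra y, repOne Ra z, repOne Rb x, repOne Rb y,
      repOne Rb z] := by
    constructor
    · intro i
      fin_cases i
      exacts [h.left.isRep_listRep hx, h.left.isRep_listRep hy, h.left.isRep_listRep hz,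
        h.right.isRep_listRep hx, h.right.isRep_listRep hy, h.right.isRep_listRep hz]
    · have key : ∀ i j : Fin 6, i < j → Comm (![repOne Ra x, repOne Ra y, repOne Ra z, repOne Rb x,
          repOne Rb y, repOne Rb z] i) (![repOne Ra x, repOne Ra y, repOne Ra z, repOne Rb x,
          repOne Rb y, repOne Rb z] j) := by
        intro i j hij
        fin_cases i <;> fin_cases j <;> first
          | exact absurd hij (by decide)
          | exact h.comm_listRep _ _
          | exact h.left.comm_listRep hxy
          | exact h.left.comm_listRep hxz
          | exact h.left.comm_listRep hyz
          | exact h.right.comm_listRep hxy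
          | exact h.right.comm_listRep hxz
          | exact h.right.comm_listRep hyz
      intro i j hij
      rcases lt_or_gt_of_ne hij with h' | h'
      · exact key i j h'
      · exact (key j i h').symm
  have key := associator_interchangeElt' (t := t) (Φ := Φ) hF
  have comm : ∀ {z z' : WithOne (FreeMagma I)}, (leavesOne z).Disjoint (leavesOne z') →
      CommSeries (repOne Ra z) (shuffleElt t Φ Ra Rb z') ∧
      CommSeries (repOne Rb z) (shuffleElt t Φ Ra Rb z') := by
    intro z z' hd
    constructor
    · exact CommSeries.listRep fun j hj => commSeries_shuffleElt
        (fun i hi => h.left.comm j i fun e => hd hj (e ▸ hi)) fun i hi => h.comm j i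
    · exact CommSeries.listRep fun j hj => commSeries_shuffleElt
        (fun i hi => (h.comm i j).symm) fun i hi => h.right.comm j i fun e => hd hj (e ▸ hi)
  have tot : ∀ {z : WithOne (FreeMagma I)}, (leavesOne z).Nodup →
      CommSeries (repOne (Ra + Rb) z) (shuffleElt t Φ Ra Rb z) := fun hz => by
    rw [repOne_add]
    exact commSeries_shuffleElt_tot h hz
  have comm' : ∀ {z z' : WithOne (FreeMagma I)}, (leavesOne z).Disjoint (leavesOne z') →
      CommSeries (repOne (Ra + Rb) z) (shuffleElt t Φ Ra Rb z') := fun hd => by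
    rw [repOne_add]
    exact (comm hd).1.add (comm hd).2
  -- The associator of the doubled cables commutes with each of the three shuffles: equivariance
  -- applies to the slot with the same strands, locality to the other slots.
  have c₁ := CommSeries.commute_evalh (t := t) (Φ := Φ) (tot hx) (comm' hxy.symm) (comm' hxy.symm)
    (comm' hxz.symm)
  have c₂ := CommSeries.commute_evalh (t := t) (Φ := Φ) (comm' hxy) (tot hy) (tot hy)
    (comm' hyz.symm)
  have c₃ := CommSeries.commute_evalh (t := t) (Φ := Φ) (comm' hxz) (comm' hyz) (comm' hyz)
    (tot hz)
  have c₄ := commute_interchangeElt (t := t) (Φ := Φ) (comm hxz).1 (comm hyz).1 (comm hxz).2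
    (comm hyz).2
  have c₅ : Commute (Φ.series.evalh (t.act (repOne Ra x) (repOne Ra y))
      (t.act (repOne Ra y) (repOne Ra z))) (Φ.series.evalh (t.act (repOne Rb x) (repOne Rb y))
      (t.act (repOne Rb y) (repOne Rb z))) := by
    have h' : ∀ w, CommSeries (repOne Ra w) (Φ.series.evalh (t.act (repOne Rb x) (repOne Rb y))
      (t.act (repOne Rb y) (repOne Rb z))) := fun w =>
      Comm.commSeries_evalh (h.comm_listRep _ _) (h.comm_listRep _ _) (h.comm_listRep _ _)
        (h.comm_listRep _ _)
    exact CommSeries.commute_evalh (h' x) (h' y) (h' y) (h' z)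
  simp only [shuffleElt_mul, repOne_mul]
  rw [c₅.eq]
  simp only [← repOne_add, mul_assoc] at key c₁ c₂ c₃ c₄ ⊢
  rw [c₄.left_comm, c₁.left_comm, c₂.left_comm, c₃.left_comm, key]

lemma CommPair.commute_eval (h : CommPair Ra Rb) {a b a' b' : FreeMagma I} (f : ParBraid a b)
    (f' : ParBraid a' b') : Commute (f.eval t Φ Ra) (f'.eval t Φ Rb) :=
  f.commute_eval_series fun i _ => f'.commSeries_eval fun j _ => h.comm i j

/-- It turns naturality for a reparenthesization `(AB)C → A(BC)` into naturality for the inverse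
one. -/
lemma psInv_rearrange {P Q D S S' : PowerSeries A} (hP : IsUnit P) (hQ : IsUnit Q) (hD : IsUnit D)
    (hPQ : Commute P Q) (h : S' * (P * Q) = D * S) :
    S * (psInv P * psInv Q) = psInv D * S' := by
  have hc : Commute (psInv P) (psInv Q) := commute_psInv_left (commute_inverse hPQ)
  calc S * (psInv P * psInv Q) = psInv D * (D * S) * (psInv Q * psInv P) := by
        rw [← mul_assoc (psInv D), psInv, psInv, psInv, Ring.inverse_mul_cancel _ hD, one_mul]
        exact congrArg (S * ·) hc.eq
    _ = psInv D * S' * (P * (Q * psInv Q) * psInv P) := by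
        rw [← h]
        simp only [mul_assoc]
    _ = psInv D * S' := by
        have hp : P * psInv P = 1 := Ring.mul_inverse_cancel _ hP
        have hq : Q * psInv Q = 1 := Ring.mul_inverse_cancel _ hQ
        rw [hq, mul_one, hp, mul_one]

/-- Naturality of the shuffle braids with respect to reparenthesizations. -/
lemma ParBraid.NoCross.shuffleElt_eval (h : CommPair Ra Rb) {a b : FreeMagma I} {f : ParBraid a b}
    (hf : f.NoCross) (ha : (leaves a).Nodup) :
    shuffleElt t Φ Ra Rb (b : WithOne (FreeMagma I)) * (f.eval t Φ Ra * f.eval t Φ Rb) =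
      f.eval t Φ (Ra + Rb) * shuffleElt t Φ Ra Rb (a : WithOne (FreeMagma I)) := by
  induction f with
  | id a => simp only [ParBraid.eval, mul_one, one_mul]
  | comp f g ihf ihg =>
    have ihf := ihf hf.1 ha
    have ihg := ihg hf.2 (hf.1.leaves_eq ▸ ha)
    simp only [ParBraid.eval]
    rw [mul_assoc (g.eval t Φ (Ra + Rb)), ← ihf, ← mul_assoc (g.eval t Φ (Ra + Rb)), ← ihg]
    simp only [mul_assoc]
    rw [(h.commute_eval f g).left_comm]
  | @tensor a a' b b' f g ihf ihg =>
    obtain ⟨ha, hb, hab⟩ := List.nodup_append'.1 ha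
    have ihf := ihf hf.1 ha
    have ihg := ihg hf.2 hb
    have hd : ∀ i ∈ leaves a, ∀ j ∈ leaves b, i ≠ j := fun i hi j hj e => hab hi (e ▸ hj)
    have e₁ : leaves a' = leaves a := hf.1.leaves_eq
    have e₂ : leaves b' = leaves b := hf.2.leaves_eq
    -- The interchange of the cables commutes with reparenthesizations inside a cable: equivariance
    -- in the slot of that cable, locality in the other three.
    have f₁ : Commute (interchangeElt t Φ (repOne Ra a) (repOne Ra b) (repOne Rb a) (repOne Rb b))
        (f.eval t Φ Ra) := commute_interchangeElt (f.commSeries_eval_tot h.left ha)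
      (CommSeries.listRep fun j hj => f.commSeries_eval fun i hi => (h.left.comm i j (hd i hi j hj)).symm)
      (CommSeries.listRep fun j _ => f.commSeries_eval fun i _ => (h.comm i j).symm)
      (CommSeries.listRep fun j _ => f.commSeries_eval fun i _ => (h.comm i j).symm)
    have f₂ : Commute (interchangeElt t Φ (repOne Ra a) (repOne Ra b) (repOne Rb a) (repOne Rb b))
        (f.eval t Φ Rb) := commute_interchangeElt
      (CommSeries.listRep fun j _ => f.commSeries_eval fun i _ => h.comm j i)
      (CommSeries.listRep fun j _ => f.commSeries_eval fun i _ => h.comm j i)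
      (f.commSeries_eval_tot h.right ha)
      (CommSeries.listRep fun j hj => f.commSeries_eval fun i hi => (h.right.comm i j (hd i hi j hj)).symm)
    have g₁ : Commute (interchangeElt t Φ (repOne Ra a) (repOne Ra b) (repOne Rb a) (repOne Rb b))
        (g.eval t Φ Ra) := commute_interchangeElt
      (CommSeries.listRep fun j hj => g.commSeries_eval fun i hi => h.left.comm j i (hd j hj i hi))
      (g.commSeries_eval_tot h.left hb)
      (CommSeries.listRep fun j _ => g.commSeries_eval fun i _ => (h.comm i j).symm)
      (CommSeries.listRep fun j _ => g.commSeries_eval fun i _ => (h.comm i j).symm)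
    have g₂ : Commute (interchangeElt t Φ (repOne Ra a) (repOne Ra b) (repOne Rb a) (repOne Rb b))
        (g.eval t Φ Rb) := commute_interchangeElt
      (CommSeries.listRep fun j _ => g.commSeries_eval fun i _ => h.comm j i)
      (CommSeries.listRep fun j _ => g.commSeries_eval fun i _ => h.comm j i)
      (CommSeries.listRep fun j hj => g.commSeries_eval fun i hi => h.right.comm j i (hd j hj i hi))
      (g.commSeries_eval_tot h.right hb)
    have k₁ : Commute (f.eval t Φ Ra) (shuffleElt t Φ Ra Rb (b' : WithOne (FreeMagma I))) :=
      f.commute_eval_series fun i hi => commSeries_shuffleElt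
        (fun j hj => h.left.comm i j (hd i hi j (e₂ ▸ hj))) fun j _ => h.comm i j
    have k₂ : Commute (f.eval t Φ Rb) (shuffleElt t Φ Ra Rb (b' : WithOne (FreeMagma I))) :=
      f.commute_eval_series fun i hi => commSeries_shuffleElt
        (fun j _ => (h.comm j i).symm) fun j hj => h.right.comm i j (hd i hi j (e₂ ▸ hj))
    have k₃ : Commute (shuffleElt t Φ Ra Rb (a : WithOne (FreeMagma I))) (g.eval t Φ (Ra + Rb)) :=
      commute_shuffleElt
        (fun i hi => g.commSeries_eval fun j hj => (h.left.comm i j (hd i hi j hj)).add_right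
          (h.comm i j))
        (fun i hi => g.commSeries_eval fun j hj => (h.comm j i).symm.add_right
          (h.right.comm i j (hd i hi j hj)))
    have k₄ : Commute (f.eval t Φ Rb) (g.eval t Φ Ra) := (h.commute_eval g f).symm
    -- A reparenthesization keeps the letters, so source and target have the same cables and the
    -- same interchange.
    have r : ∀ R : I → (L →ₗ[K] A), repOne R (a' : WithOne (FreeMagma I)) = repOne R a ∧
        repOne R (b' : WithOne (FreeMagma I)) = repOne R b := fun R =>
      ⟨congrArg (listRep R) e₁, congrArg (listRep R) e₂⟩
    simp only [ParBraid.eval, WithOne.coe_mul, shuffleElt_mul]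
    rw [(r Ra).1, (r Ra).2, (r Rb).1, (r Rb).2]
    simp only [mul_assoc] at ihf ihg ⊢
    rw [← k₃.left_comm, ← mul_assoc (g.eval t Φ (Ra + Rb)), ← ihg]
    simp only [← mul_assoc] at ihf ⊢
    rw [← ihf]
    simp only [mul_assoc]
    rw [f₁.left_comm, g₁.left_comm, f₂.left_comm, g₂.eq, k₁.symm.left_comm, k₄.symm.left_comm,
      k₂.symm.left_comm]
  | assoc a b c =>
    have := shuffleElt_assoc (t := t) (Φ := Φ) h (x := a) (y := b) (z := c) ha
    simp only [ParBraid.eval, strandSum_eq]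
    exact this
  | assocInv a b c =>
    have := shuffleElt_assoc (t := t) (Φ := Φ) h (x := a) (y := b) (z := c) (by
      change ((leaves a ++ leaves b) ++ leaves c).Nodup
      rw [List.append_assoc]
      exact ha)
    simp only [ParBraid.eval, strandSum_eq]
    refine psInv_rearrange (Φ.isUnit_evalh _ _) (Φ.isUnit_evalh _ _) (Φ.isUnit_evalh _ _) ?_ this
    have h' : ∀ w : FreeMagma I, CommSeries (listRep Ra (leaves w)) (Φ.series.evalh
        (t.act (listRep Rb (leaves a)) (listRep Rb (leaves b)))
        (t.act (listRep Rb (leaves b)) (listRep Rb (leaves c)))) := fun w =>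
      Comm.commSeries_evalh (h.comm_listRep _ _) (h.comm_listRep _ _) (h.comm_listRep _ _)
        (h.comm_listRep _ _)
    exact CommSeries.commute_evalh (h' a) (h' b) (h' b) (h' c)
  | cross a b => exact hf.elim

end Naturality

/-! ### Substitution of words, and reparenthesizations of possibly empty words -/

section Substitution

open PowerSeries (C coeff)

variable {K : Type u} [Field K] {L : Type v} [LieRing L] [LieAlgebra K L]
  {A : Type w} [Ring A] [Algebra K A] {t : InvTensor K L} {Φ : DrinfeldAssociator K}
  {I J : Type x} {R Ra Rb : I → (L →ₗ[K] A)}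

/-- A cable of cables is the cable of all their strands. Hence a composite morphism can be computed
by letting the outer word act through inner cables. -/
lemma repOne_substOne (R : I → (L →ₗ[K] A)) (φ : J → WithOne (FreeMagma I))
    (T : WithOne (FreeMagma J)) : repOne R (substOne φ T) = repOne (fun j => repOne R (φ j)) T := by
  rw [repOne, leavesOne_substOne]
  exact listRep_flatMap R _ _

lemma nodup_substOne_mul {φ : J → WithOne (FreeMagma I)} {x y : WithOne (FreeMagma J)}
    (h : (leavesOne (substOne φ (x * y))).Nodup) :
    (leavesOne (substOne φ x)).Nodup ∧ (leavesOne (substOne φ y)).Nodup ∧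
      ∀ j ∈ leavesOne x, ∀ j' ∈ leavesOne y, ∀ i ∈ leavesOne (φ j), ∀ i' ∈ leavesOne (φ j'),
        i ≠ i' := by
  rw [map_mul, leavesOne_mul, List.nodup_append'] at h
  refine ⟨h.1, h.2.1, fun j hj j' hj' i hi i' hi' e => ?_⟩
  have h₁ : i ∈ leavesOne (substOne φ x) := by
    rw [leavesOne_substOne]
    exact List.mem_flatMap.2 ⟨j, hj, hi⟩
  have h₂ : i ∈ leavesOne (substOne φ y) := by
    rw [leavesOne_substOne]
    exact List.mem_flatMap.2 ⟨j', hj', e ▸ hi'⟩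
  exact h.2.2 h₁ h₂

/-- The shuffle braids of words which are substituted into each other. -/
lemma shuffleElt_substOne (h : CommPair Ra Rb) (φ : J → WithOne (FreeMagma I))
    {T : WithOne (FreeMagma J)} (hT : (leavesOne (substOne φ T)).Nodup) :
    shuffleElt t Φ Ra Rb (substOne φ T) =
      ((leavesOne T).map fun j => shuffleElt t Φ Ra Rb (φ j)).prod *
        shuffleElt t Φ (fun j => repOne Ra (φ j)) (fun j => repOne Rb (φ j)) T := by
  induction T using word_induction with
  | one => exact (mul_one _).symm
  | of j =>
    rw [shuffleElt_of, mul_one]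
    exact (mul_one _).symm
  | mul x y ihx ihy =>
    obtain ⟨hx, hy, hxy⟩ := nodup_substOne_mul hT
    rw [map_mul, shuffleElt_mul, ihx hx, ihy hy, shuffleElt_mul, leavesOne_mul, List.map_append,
      List.prod_append, repOne_substOne, repOne_substOne, repOne_substOne, repOne_substOne]
    -- The outer shuffle of `x` only involves strands substituted into `x`, so it commutes with the
    -- inner shuffles of the letters of `y`.
    have hc : Commute (shuffleElt t Φ (fun j => repOne Ra (φ j)) (fun j => repOne Rb (φ j)) x)
        ((leavesOne y).map fun j => shuffleElt t Φ Ra Rb (φ j)).prod := by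
      refine commute_shuffleElt (fun j hj => CommSeries.listRep fun i hi =>
        CommSeries.list_prod fun j' hj' => commSeries_shuffleElt ?_ ?_)
        (fun j hj => CommSeries.listRep fun i hi =>
        CommSeries.list_prod fun j' hj' => commSeries_shuffleElt ?_ ?_)
      · exact fun i' hi' => h.left.comm i i' (hxy j hj j' hj' i hi i' hi')
      · exact fun i' hi' => h.comm i i'
      · exact fun i' hi' => (h.comm i' i).symm
      · exact fun i' hi' => h.right.comm i i' (hxy j hj j' hj' i hi i' hi')
    simp only [mul_assoc]
    rw [hc.left_comm]

variable (t Φ) in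
/-- The element of a reparenthesization, where the strand `i` acts through `R i`. -/
noncomputable def Reparen.evalRep (R : I → (L →ₗ[K] A)) : {T T' : WithOne (FreeMagma I)} →
    Reparen T T' → PowerSeries A
  | _, _, .empty => 1
  | _, _, .word f _ => f.eval t Φ R

variable (t Φ) in
/-- `P` is the element of a reparenthesization from `T` to `T'`. -/
def IsReparen (R : I → (L →ₗ[K] A)) (T T' : WithOne (FreeMagma I)) (P : PowerSeries A) : Prop :=
  ∃ r : Reparen T T', r.evalRep t Φ R = P

/-- The case distinction is stated with equations, so that it can be used for two parallel
reparenthesizations and for composite words, where the indices are not free variables. -/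
lemma Reparen.evalRep_cases {T T' : WithOne (FreeMagma I)} (r : Reparen T T') :
    (T = 1 ∧ T' = 1 ∧ r.evalRep t Φ R = 1) ∨
      ∃ (a b : FreeMagma I) (f : ParBraid a b), f.NoCross ∧ T = a ∧ T' = b ∧
        r.evalRep t Φ R = f.eval t Φ R := by
  cases r with
  | empty => exact .inl ⟨rfl, rfl, rfl⟩
  | word f hf => exact .inr ⟨_, _, f, hf, rfl, rfl, rfl⟩

/-- Coherence: the element does not depend on the choice of the reparenthesization. -/
lemma Reparen.evalRep_eq (hR : CommFam R) {T T' : WithOne (FreeMagma I)}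
    (hT : (leavesOne T).Nodup) (r r' : Reparen T T') : r.evalRep t Φ R = r'.evalRep t Φ R := by
  rcases r.evalRep_cases (t := t) (Φ := Φ) (R := R) with ⟨e, e', h⟩ | ⟨a, b, f, hf, e, e', h⟩
  · rcases r'.evalRep_cases (t := t) (Φ := Φ) (R := R) with ⟨_, _, h'⟩ | ⟨a, b, f, hf, e₁, e₂, h'⟩
    · rw [h, h']
    · exact (WithOne.coe_ne_one (e₁.symm.trans e)).elim
  · rcases r'.evalRep_cases (t := t) (Φ := Φ) (R := R) with ⟨e₁, _, h'⟩ | ⟨a', b', f', hf', e₁, e₂, h'⟩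
    · exact (WithOne.coe_ne_one (e.symm.trans e₁)).elim
    · obtain rfl : a = a' := WithOne.coe_inj.1 (e.symm.trans e₁)
      obtain rfl : b = b' := WithOne.coe_inj.1 (e'.symm.trans e₂)
      rw [e] at hT
      rw [h, h', ParBraid.eval_eq_of_noCross hR hT hf hf']

namespace IsReparen

lemma refl (T : WithOne (FreeMagma I)) : IsReparen t Φ R T T 1 := by
  induction T using WithOne.recOneCoe with
  | one => exact ⟨.empty, rfl⟩
  | coe T => exact ⟨.word (.id T) trivial, rfl⟩

lemma cases {T T' : WithOne (FreeMagma I)} {P : PowerSeries A} (h : IsReparen t Φ R T T' P) :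
    (T = 1 ∧ T' = 1 ∧ P = 1) ∨ ∃ (a b : FreeMagma I) (f : ParBraid a b), f.NoCross ∧ T = a ∧
      T' = b ∧ P = f.eval t Φ R := by
  obtain ⟨r, rfl⟩ := h
  rcases r.evalRep_cases (t := t) (Φ := Φ) (R := R) with ⟨e, e', h⟩ | ⟨a, b, f, hf, e, e', h⟩
  · exact .inl ⟨e, e', h⟩
  · exact .inr ⟨a, b, f, hf, e, e', h⟩

lemma trans {a b c : WithOne (FreeMagma I)} {P Q : PowerSeries A} (h : IsReparen t Φ R a b P)
    (h' : IsReparen t Φ R b c Q) : IsReparen t Φ R a c (Q * P) := by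
  rcases h.cases with ⟨rfl, rfl, rfl⟩ | ⟨a, b, f, hf, rfl, rfl, rfl⟩
  · rwa [mul_one]
  · rcases h'.cases with ⟨e, _, _⟩ | ⟨b', c, f', hf', e, rfl, rfl⟩
    · exact (WithOne.coe_ne_one e).elim
    · obtain rfl := WithOne.coe_inj.1 e
      exact ⟨.word (.comp f f') ⟨hf, hf'⟩, rfl⟩

lemma mul {a a' b b' : WithOne (FreeMagma I)} {P Q : PowerSeries A} (h : IsReparen t Φ R a a' P)
    (h' : IsReparen t Φ R b b' Q) : IsReparen t Φ R (a * b) (a' * b') (P * Q) := by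
  rcases h.cases with ⟨rfl, rfl, rfl⟩ | ⟨a, a', f, hf, rfl, rfl, rfl⟩
  · rwa [one_mul, one_mul, one_mul]
  · rcases h'.cases with ⟨rfl, rfl, rfl⟩ | ⟨b, b', f', hf', rfl, rfl, rfl⟩
    · rwa [mul_one, mul_one, mul_one]
    · exact ⟨.word (.tensor f f') ⟨hf, hf'⟩, rfl⟩

/-- If one of the words is empty, the two products are equal and the associator is `1`, because it
has a vanishing argument. So elementary reparenthesizations remain legitimate after words have been
replaced by empty ones. -/
lemma assoc_aux (a b c : WithOne (FreeMagma I)) :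
    (IsReparen t Φ R (a * b * c) (a * (b * c))
      (Φ.series.evalh (t.act (repOne R a) (repOne R b)) (t.act (repOne R b) (repOne R c)))) ∧
    IsReparen t Φ R (a * (b * c)) (a * b * c)
      (psInv (Φ.series.evalh (t.act (repOne R a) (repOne R b))
        (t.act (repOne R b) (repOne R c)))) := by
  induction a using WithOne.recOneCoe with
  | one =>
    rw [repOne_one, InvTensor.act_zero_left, DrinfeldAssociator.evalh_zero_left, psInv_one,
      one_mul, one_mul]
    exact ⟨refl _, refl _⟩
  | coe a =>
    induction b using WithOne.recOneCoe with
    | one =>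
      rw [repOne_one, InvTensor.act_zero_left, DrinfeldAssociator.evalh_zero_right, psInv_one,
        mul_one, one_mul]
      exact ⟨refl _, refl _⟩
    | coe b =>
      induction c using WithOne.recOneCoe with
      | one =>
        rw [repOne_one, InvTensor.act_zero_right, DrinfeldAssociator.evalh_zero_right, psInv_one,
          mul_one, mul_one]
        exact ⟨refl _, refl _⟩
      | coe c =>
        refine ⟨⟨.word (.assoc a b c) trivial, ?_⟩, ⟨.word (.assocInv a b c) trivial, ?_⟩⟩
        · simp only [Reparen.evalRep, ParBraid.eval, strandSum_eq]
          rfl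
        · simp only [Reparen.evalRep, ParBraid.eval, strandSum_eq]
          rfl

/-- Substitution into a reparenthesization. -/
lemma substOne_outer (φ : J → WithOne (FreeMagma I)) {a b : FreeMagma J} {f : ParBraid a b}
    (hf : f.NoCross) : IsReparen t Φ R (substOne φ a) (substOne φ b)
      (f.eval t Φ fun j => repOne R (φ j)) := by
  have e : ∀ a : FreeMagma J, listRep (fun j => repOne R (φ j)) (leaves a) =
      repOne R (substOne φ a) := fun a => (repOne_substOne R φ a).symm
  induction f with
  | id a => exact refl _
  | comp f g ihf ihg => exact (ihf hf.1).trans (ihg hf.2)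
  | tensor f g ihf ihg =>
    rw [substOne_mul, substOne_mul]
    exact (ihf hf.1).mul (ihg hf.2)
  | assoc a b c =>
    rw [substOne_mul, substOne_mul, substOne_mul, substOne_mul, ParBraid.eval, strandSum_eq,
      strandSum_eq, e, e, e]
    exact (assoc_aux _ _ _).1
  | assocInv a b c =>
    rw [substOne_mul, substOne_mul, substOne_mul, substOne_mul, ParBraid.eval, strandSum_eq,
      strandSum_eq, e, e, e]
    exact (assoc_aux _ _ _).2
  | cross a b => exact hf.elim

/-- Substitution of reparenthesizations. -/
lemma substOne_inner {φ φ' : J → WithOne (FreeMagma I)} {P : J → PowerSeries A}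
    (h : ∀ j, IsReparen t Φ R (φ j) (φ' j) (P j)) (T : WithOne (FreeMagma J)) :
    IsReparen t Φ R (substOne φ T) (substOne φ' T) ((leavesOne T).map P).prod := by
  induction T using word_induction with
  | one => exact refl 1
  | of j =>
    have : ((leavesOne (FreeMagma.of j : FreeMagma J)).map P).prod = P j := List.prod_singleton
    rw [this]
    exact h j
  | mul x y hx hy =>
    rw [leavesOne_mul, List.map_append, List.prod_append, map_mul, map_mul]
    exact hx.mul hy

end IsReparen

/-- The right comb of a list. -/
def comb (l : List I) : WithOne (FreeMagma I) :=
  l.foldr (fun i T => (FreeMagma.of i : FreeMagma I) * T) 1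

variable (t Φ) in
-- The right comb is a normal form which depends only on the letters. Both directions are needed in
-- order to connect two words through it.
lemma exists_isReparen_comb (R : I → (L →ₗ[K] A)) (T : WithOne (FreeMagma I)) :
    (∃ P, IsReparen t Φ R T (comb (leavesOne T)) P) ∧
      ∃ P, IsReparen t Φ R (comb (leavesOne T)) T P := by
  induction T using word_induction with
  | one => exact ⟨⟨_, .refl 1⟩, ⟨_, .refl 1⟩⟩
  | of i =>
    have : comb [i] = ((FreeMagma.of i : FreeMagma I) : WithOne (FreeMagma I)) := mul_one _
    change (∃ P, IsReparen t Φ R _ (comb [i]) P) ∧ ∃ P, IsReparen t Φ R (comb [i]) _ P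
    rw [this]
    exact ⟨⟨_, .refl _⟩, ⟨_, .refl _⟩⟩
  | mul x y hx hy =>
    obtain ⟨⟨P, hP⟩, P', hP'⟩ := hx
    obtain ⟨⟨Q, hQ⟩, Q', hQ'⟩ := hy
    -- The product of two combs becomes a comb by moving the letters of the first one out, one
    -- reassociation for each.
    have key : ∀ l l' : List I, (∃ P, IsReparen t Φ R (comb l * comb l') (comb (l ++ l')) P) ∧
        ∃ P, IsReparen t Φ R (comb (l ++ l')) (comb l * comb l') P := by
      intro l l'
      induction l with
      | nil =>
        have : comb ([] : List I) * comb l' = comb l' := one_mul _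
        rw [this]
        exact ⟨⟨_, .refl _⟩, ⟨_, .refl _⟩⟩
      | cons i l ih =>
        obtain ⟨⟨P, hP⟩, P', hP'⟩ := ih
        have h := IsReparen.assoc_aux (t := t) (Φ := Φ) (R := R)
          ((FreeMagma.of i : FreeMagma I) : WithOne (FreeMagma I)) (comb l) (comb l')
        exact ⟨⟨_, h.1.trans ((IsReparen.refl _).mul hP)⟩,
          ⟨_, ((IsReparen.refl _).mul hP').trans h.2⟩⟩
    obtain ⟨⟨S, hS⟩, S', hS'⟩ := key (leavesOne x) (leavesOne y)
    rw [leavesOne_mul]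
    exact ⟨⟨_, (hP.mul hQ).trans hS⟩, ⟨_, hS'.trans (hP'.mul hQ')⟩⟩

lemma Reparen.nonempty {T T' : WithOne (FreeMagma I)} (h : leavesOne T = leavesOne T')
    (t : InvTensor K L) (Φ : DrinfeldAssociator K) : Nonempty (Reparen T T') := by
  -- The algebra `K[X]` and the zero actions are dummies: only the underlying reparenthesization is
  -- extracted, not its value.
  obtain ⟨P, hP⟩ := (exists_isReparen_comb t Φ (0 : I → (L →ₗ[K] Polynomial K)) T).1
  obtain ⟨Q, hQ⟩ := (exists_isReparen_comb t Φ (0 : I → (L →ₗ[K] Polynomial K)) T').2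
  rw [h] at hP
  exact ⟨(hP.trans hQ).choose⟩

lemma Reparen.map_evalRep {B : Type*} [Ring B] [Algebra K B] (φ : A →ₐ[K] B)
    {T T' : WithOne (FreeMagma I)} (r : Reparen T T') :
    PowerSeries.map φ.toRingHom (r.evalRep t Φ R) =
      r.evalRep t Φ fun i => φ.toLinearMap ∘ₗ R i := by
  cases r with
  | empty => exact map_one _
  | word f hf => exact f.map_eval φ

lemma Reparen.leaves_eq {T T' : WithOne (FreeMagma I)} (r : Reparen T T') :
    leavesOne T' = leavesOne T := by
  cases r with
  | empty => rfl
  | word f hf => exact hf.leaves_eq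

/-- Locality. -/
lemma Reparen.commute_evalRep {P : PowerSeries A} {T T' : WithOne (FreeMagma I)} (r : Reparen T T')
    (h : ∀ i ∈ leavesOne T, CommSeries (R i) P) : Commute (r.evalRep t Φ R) P := by
  cases r with
  | empty => exact Commute.one_left P
  | word f hf => exact f.commute_eval_series h

lemma Reparen.commSeries_evalRep {f : L →ₗ[K] A} {T T' : WithOne (FreeMagma I)}
    (r : Reparen T T') (h : ∀ i ∈ leavesOne T, Comm f (R i)) :
    CommSeries f (r.evalRep t Φ R) := by
  cases r with
  | empty => exact CommSeries.one f
  | word β hf => exact β.commSeries_eval h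

/-- Equivariance. -/
lemma Reparen.commSeries_evalRep_tot (hR : CommFam R) {T T' : WithOne (FreeMagma I)}
    (r : Reparen T T') (hT : (leavesOne T).Nodup) : CommSeries (repOne R T) (r.evalRep t Φ R) := by
  cases r with
  | empty => exact CommSeries.one _
  | word β hf => exact β.commSeries_eval_tot hR hT

/-- Naturality of the shuffle braids with respect to reparenthesizations. -/
lemma Reparen.shuffleElt_evalRep (h : CommPair Ra Rb) {T T' : WithOne (FreeMagma I)}
    (r : Reparen T T') (hT : (leavesOne T).Nodup) :
    shuffleElt t Φ Ra Rb T' * (r.evalRep t Φ Ra * r.evalRep t Φ Rb) =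
      r.evalRep t Φ (Ra + Rb) * shuffleElt t Φ Ra Rb T := by
  cases r with
  | empty => simp only [shuffleElt_one, Reparen.evalRep, mul_one]
  | word β hf => exact hf.shuffleElt_eval h hT

end Substitution

/-! ### Products over the fibres -/

section Families

open PowerSeries (C coeff)

/-- With this lemma a product formula is proved fibre by fibre: only factors with different indices
have to commute. -/
lemma list_prod_map_mul {M J : Type*} [Monoid M] {f g : J → M} {l : List J} (hl : l.Nodup)
    (h : ∀ j j', j ≠ j' → Commute (g j) (f j')) :
    (l.map fun j => f j * g j).prod = (l.map f).prod * (l.map g).prod := by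
  induction l with
  | nil => exact (mul_one _).symm
  | cons j l ih =>
    obtain ⟨hj, hl⟩ := List.nodup_cons.1 hl
    have hc : Commute (g j) (l.map f).prod := Commute.list_prod_right _ _ fun y hy => by
      obtain ⟨j', hj', rfl⟩ := List.mem_map.1 hy
      exact h j j' fun e => hj (e ▸ hj')
    simp only [List.map_cons, List.prod_cons]
    rw [ih hl]
    simp only [mul_assoc]
    rw [hc.left_comm]

lemma list_prod_flatMap {M I J : Type*} [Monoid M] (f : I → M) (φ : J → List I) (l : List J) :
    ((l.flatMap φ).map f).prod = (l.map fun j => ((φ j).map f).prod).prod := by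
  induction l with
  | nil => rfl
  | cons j l ih =>
    rw [List.flatMap_cons, List.map_append, List.prod_append, ih]
    rfl

lemma list_prod_perm {M I : Type*} [Monoid M] {f : I → M} {l l' : List I} (h : l.Perm l')
    (hl : l.Nodup) (hc : ∀ i j, i ≠ j → Commute (f i) (f j)) :
    (l.map f).prod = (l'.map f).prod := by
  refine (h.map f).prod_eq' (List.pairwise_map.2 (hl.imp fun {i j} hij => hc i j hij))

/-- The commuting product is replaced by a list product in an arbitrary order, which carries no
commutation proof and is easier to rewrite. -/
lemma noncommProd_univ_eq {M J : Type*} [Monoid M] [Fintype J] (f : J → M) (h) :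
    (Finset.univ : Finset J).noncommProd f h = (Finset.univ.toList.map f).prod := by
  classical
  have e := Finset.noncommProd_toFinset (Finset.univ : Finset J).toList f
    (by rw [Finset.toList_toFinset]; exact h) (Finset.nodup_toList _)
  rw [← e]
  congr 1
  exact (Finset.toList_toFinset _).symm

lemma ParMor.nodup_paren {I J : Type w} (p : ParMor I J) (j : J) : (leavesOne (p.paren j)).Nodup :=
  p.leaves_paren j ▸ p.nodup j

/-- The fibres partition `I`. A commuting product over `I` can therefore be regrouped along them. -/
lemma ParMor.perm_univ {I J : Type w} [Fintype I] [Fintype J] (p : ParMor I J) :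
    ((Finset.univ : Finset J).toList.flatMap fun j => leavesOne (p.paren j)).Perm
      (Finset.univ : Finset I).toList ∧
    ((Finset.univ : Finset J).toList.flatMap fun j => leavesOne (p.paren j)).Nodup := by
  have hn : ((Finset.univ : Finset J).toList.flatMap fun j => leavesOne (p.paren j)).Nodup := by
    refine List.nodup_flatMap.2 ⟨fun j _ => p.nodup_paren j, (Finset.nodup_toList _).imp ?_⟩
    intro j j' hj i hi hi'
    exact p.leaves_disjoint hj i hi hi'
  refine ⟨(List.perm_ext_iff_of_nodup hn (Finset.nodup_toList _)).2 fun i => ?_, hn⟩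
  simp only [List.mem_flatMap, Finset.mem_toList, Finset.mem_univ, true_and, p.leaves_paren, p.mem]
  simp

variable {K : Type u} [Field K] {L : Type v} [LieRing L] [LieAlgebra K L]
  {A : Type w} [Ring A] [Algebra K A] {t : InvTensor K L} {Φ : DrinfeldAssociator K}

/-- `P` commutes with every series which commutes with the values of the members of `T`. -/
def Supp (T : Set (L →ₗ[K] A)) (P : PowerSeries A) : Prop :=
  ∀ Q, (∀ f ∈ T, CommSeries f Q) → Commute P Q

/-- A double commutant argument: the values of members of `T` commute with those of `T'`, hence with
`P'`, hence `P` commutes with `P'`. This settles all commutations between different fibres at once.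
-/
lemma Supp.commute {T T' : Set (L →ₗ[K] A)} {P P' : PowerSeries A} (hP : Supp T P)
    (hP' : Supp T' P') (h : ∀ f ∈ T, ∀ f' ∈ T', Comm f f') : Commute P P' :=
  hP _ fun f hf z => (hP' _ fun f' hf' => commSeries_C (h f hf f' hf').symm z).symm

lemma Supp.list_prod {S : Type*} {T : Set (L →ₗ[K] A)} {P : S → PowerSeries A} {l : List S}
    (h : ∀ s ∈ l, Supp T (P s)) : Supp T (l.map P).prod := fun Q hQ => by
  refine Commute.list_prod_left _ _ fun y hy => ?_
  obtain ⟨s, hs, rfl⟩ := List.mem_map.1 hy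
  exact h s hs Q hQ

variable {I J J' : Type x} {R Ra Rb Rc : I → (L →ₗ[K] A)}

/-- The values at the members of `l` of one of three families. -/
def tripleSet (Ra Rb Rc : I → (L →ₗ[K] A)) (l : List I) : Set (L →ₗ[K] A) :=
  {f | ∃ i ∈ l, f = Ra i ∨ f = Rb i ∨ f = Rc i}

lemma tripleSet_comm (hab : CommPair Ra Rb) (hac : CommPair Ra Rc) (hbc : CommPair Rb Rc)
    {l l' : List I} (hl : ∀ i ∈ l, i ∉ l') :
    ∀ f ∈ tripleSet Ra Rb Rc l, ∀ f' ∈ tripleSet Ra Rb Rc l', Comm f f' := by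
  rintro f ⟨i, hi, hf⟩ f' ⟨i', hi', hf'⟩
  have hii : i ≠ i' := fun e => hl i hi (e ▸ hi')
  rcases hf with rfl | rfl | rfl <;> rcases hf' with rfl | rfl | rfl
  exacts [hab.left.comm _ _ hii, hab.comm _ _, hac.comm _ _, (hab.comm _ _).symm,
    hab.right.comm _ _ hii, hbc.comm _ _, (hac.comm _ _).symm, (hbc.comm _ _).symm,
    hac.right.comm _ _ hii]

section

variable {Q : PowerSeries A} {l : List I} (h : ∀ f ∈ tripleSet Ra Rb Rc l, CommSeries f Q)
  {i : I} (hi : i ∈ l)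

include h hi

lemma tripleSet_left : CommSeries (Ra i) Q := h _ ⟨i, hi, .inl rfl⟩
lemma tripleSet_mid : CommSeries (Rb i) Q := h _ ⟨i, hi, .inr (.inl rfl)⟩
lemma tripleSet_right : CommSeries (Rc i) Q := h _ ⟨i, hi, .inr (.inr rfl)⟩

end

variable (t Φ) in
/-- The action of `ν^p`. -/
noncomputable def nuRep [Fintype J] (p : ParMor I J) (Ra Rb : I → (L →ₗ[K] A)) : PowerSeries A :=
  ((Finset.univ : Finset J).toList.map fun j => shuffleElt t Φ Ra Rb (p.paren j)).prod

/-- The actions of the words which are the fibres of `p`. -/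
noncomputable def fibreRep (p : ParMor I J) (R : I → (L →ₗ[K] A)) (j : J) : L →ₗ[K] A :=
  repOne R (p.paren j)

lemma isUnit_nuRep [Fintype J] (p : ParMor I J) : IsUnit (nuRep t Φ p Ra Rb) := by
  unfold nuRep
  induction (Finset.univ : Finset J).toList with
  | nil => exact isUnit_one
  | cons j l ih => exact (isUnit_shuffleElt _).mul ih

/-- With its counterpart on the right this gives the compatibility of `ν^p` with the unit
constraints. -/
lemma nuRep_zero_left [Fintype J] (p : ParMor I J) : nuRep t Φ p 0 Rb = 1 := by
  refine List.prod_eq_one fun y hy => ?_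
  obtain ⟨j, _, rfl⟩ := List.mem_map.1 hy
  exact shuffleElt_zero_left _

lemma nuRep_zero_right [Fintype J] (p : ParMor I J) : nuRep t Φ p Ra 0 = 1 := by
  refine List.prod_eq_one fun y hy => ?_
  obtain ⟨j, _, rfl⟩ := List.mem_map.1 hy
  exact shuffleElt_zero_right _

lemma map_nuRep [Fintype J] {B : Type*} [Ring B] [Algebra K B] (φ : A →ₐ[K] B) (p : ParMor I J) :
    PowerSeries.map φ.toRingHom (nuRep t Φ p Ra Rb) =
      nuRep t Φ p (fun i => φ.toLinearMap ∘ₗ Ra i) (fun i => φ.toLinearMap ∘ₗ Rb i) := by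
  rw [nuRep, map_list_prod, List.map_map]
  exact congrArg List.prod (List.map_congr_left fun j _ => map_shuffleElt φ _)

lemma nuRep_id [Fintype I] : nuRep t Φ (ParMor.id I) Ra Rb = 1 := by
  refine List.prod_eq_one fun y hy => ?_
  obtain ⟨j, _, rfl⟩ := List.mem_map.1 hy
  rfl

/-- Compatibility of `ν^p` with the associators. -/
lemma assocElt_nuRep [Fintype I] [Fintype J] (p : ParMor I J) (hab : CommPair Ra Rb)
    (hac : CommPair Ra Rc) (hbc : CommPair Rb Rc) :
    assocElt t Φ Ra Rb Rc Finset.univ.toList * nuRep t Φ p (Ra + Rb) Rc * nuRep t Φ p Ra Rb =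
      nuRep t Φ p Ra (Rb + Rc) * nuRep t Φ p Rb Rc *
        assocElt t Φ (fibreRep p Ra) (fibreRep p Rb) (fibreRep p Rc) Finset.univ.toList := by
  have dis : ∀ {P P' : J → PowerSeries A},
      (∀ j, Supp (tripleSet Ra Rb Rc (leavesOne (p.paren j))) (P j)) →
      (∀ j, Supp (tripleSet Ra Rb Rc (leavesOne (p.paren j))) (P' j)) →
      ∀ j j', j ≠ j' → Commute (P j) (P' j') := fun hP hP' j j' hj =>
    (hP j).commute (hP' j') (tripleSet_comm hab hac hbc (p.leaves_disjoint hj))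
  have sE : ∀ j, Supp (tripleSet Ra Rb Rc (leavesOne (p.paren j)))
      (assocElt t Φ Ra Rb Rc (leavesOne (p.paren j))) := fun j => Supp.list_prod fun i hi Q h =>
    CommSeries.commute_evalh (tripleSet_left h hi) (tripleSet_mid h hi) (tripleSet_mid h hi)
      (tripleSet_right h hi)
  have sS : ∀ j, Supp (tripleSet Ra Rb Rc (leavesOne (p.paren j)))
      (shuffleElt t Φ (Ra + Rb) Rc (p.paren j)) := fun j Q h => commute_shuffleElt
    (fun i hi => (tripleSet_left h hi).add (tripleSet_mid h hi)) fun i hi => tripleSet_right h hi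
  have ss : ∀ j, Supp (tripleSet Ra Rb Rc (leavesOne (p.paren j)))
      (shuffleElt t Φ Ra Rb (p.paren j)) := fun j Q h => commute_shuffleElt
    (fun i hi => tripleSet_left h hi) fun i hi => tripleSet_mid h hi
  have sU : ∀ j, Supp (tripleSet Ra Rb Rc (leavesOne (p.paren j)))
      (shuffleElt t Φ Ra (Rb + Rc) (p.paren j)) := fun j Q h => commute_shuffleElt
    (fun i hi => tripleSet_left h hi) fun i hi => (tripleSet_mid h hi).add (tripleSet_right h hi)
  have su : ∀ j, Supp (tripleSet Ra Rb Rc (leavesOne (p.paren j)))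
      (shuffleElt t Φ Rb Rc (p.paren j)) := fun j Q h => commute_shuffleElt
    (fun i hi => tripleSet_mid h hi) fun i hi => tripleSet_right h hi
  have sF : ∀ j, Supp (tripleSet Ra Rb Rc (leavesOne (p.paren j)))
      (Φ.series.evalh (t.act (fibreRep p Ra j) (fibreRep p Rb j))
        (t.act (fibreRep p Rb j) (fibreRep p Rc j))) := fun j Q h =>
    CommSeries.commute_evalh (CommSeries.listRep fun i hi => tripleSet_left h hi)
      (CommSeries.listRep fun i hi => tripleSet_mid h hi)
      (CommSeries.listRep fun i hi => tripleSet_mid h hi)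
      (CommSeries.listRep fun i hi => tripleSet_right h hi)
  -- The product of the associators over `I` is regrouped along the fibres of `p`.
  have e : assocElt t Φ Ra Rb Rc Finset.univ.toList = ((Finset.univ : Finset J).toList.map fun j =>
      assocElt t Φ Ra Rb Rc (leavesOne (p.paren j))).prod := by
    refine (list_prod_perm p.perm_univ.1 p.perm_univ.2 ?_).symm.trans (list_prod_flatMap _ _ _)
    intro i i' hi
    have key : ∀ f, Comm f (Ra i') → Comm f (Rb i') → Comm f (Rc i') →
        CommSeries f (Φ.series.evalh (t.act (Ra i') (Rb i')) (t.act (Rb i') (Rc i'))) :=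
      fun f ha hb hc => Comm.commSeries_evalh ha hb hb hc
    have hb := key _ (hab.comm i' i).symm (hab.right.comm i i' hi) (hbc.comm i i')
    exact CommSeries.commute_evalh
      (key _ (hab.left.comm i i' hi) (hab.comm i i') (hac.comm i i')) hb hb
      (key _ (hac.comm i' i).symm (hbc.comm i' i).symm (hac.right.comm i i' hi))
  have hn := Finset.nodup_toList (Finset.univ : Finset J)
  -- Each side is merged into a single product over `J`, whose factors agree by the statement for
  -- one word.
  rw [e, nuRep, nuRep, nuRep, nuRep, assocElt, ← list_prod_map_mul hn (dis sS sE),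
    ← list_prod_map_mul hn (fun j j' hj => (dis ss sE j j' hj).mul_right (dis ss sS j j' hj)),
    ← list_prod_map_mul hn (dis su sU),
    ← list_prod_map_mul hn (fun j j' hj => (dis sF sU j j' hj).mul_right (dis sF su j j' hj))]
  exact congrArg List.prod (List.map_congr_left fun j _ =>
    assocElt_shuffleElt hab hac hbc (p.nodup_paren j))

lemma commute_C_nuRep [Fintype J] (p : ParMor I J) {z : A} (ha : ∀ i a, Commute z (Ra i a))
    (hb : ∀ i a, Commute z (Rb i a)) : Commute (C z) (nuRep t Φ p Ra Rb) := by
  refine Commute.list_prod_right _ _ fun y hy => ?_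
  obtain ⟨j, _, rfl⟩ := List.mem_map.1 hy
  exact (commute_shuffleElt (fun i _ a => ((ha i a).symm.map (C (R := A)) :))
    fun i _ a => ((hb i a).symm.map (C (R := A)) :)).symm

/-- Equivariance of `ν^p`. -/
lemma commSeries_nuRep [Fintype J] (p : ParMor I J) (h : CommPair Ra Rb) (j : J) :
    CommSeries (fibreRep p Ra j + fibreRep p Rb j) (nuRep t Φ p Ra Rb) := by
  refine CommSeries.list_prod fun j' _ => ?_
  -- Equivariance handles the factor of the same fibre, locality those of the other fibres.
  by_cases hj : j = j'
  · subst hj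
    exact commSeries_shuffleElt_tot h (p.nodup_paren j)
  · have hd : ∀ i ∈ leavesOne (p.paren j), ∀ i' ∈ leavesOne (p.paren j'), i ≠ i' :=
      fun i hi i' hi' e => p.leaves_disjoint hj i hi (e ▸ hi')
    refine CommSeries.add (CommSeries.listRep fun i hi => ?_) (CommSeries.listRep fun i hi => ?_)
    · exact commSeries_shuffleElt (fun i' hi' => h.left.comm i i' (hd i hi i' hi'))
        fun i' _ => h.comm i i'
    · exact commSeries_shuffleElt (fun i' _ => (h.comm i' i).symm)
        fun i' hi' => h.right.comm i i' (hd i hi i' hi')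

/-- A fibre of the composite is a fibre of `q` with the fibres of `p` substituted into it, so
`shuffleElt_substOne` applies to each. The inner factors, grouped along the fibres of `q`, make up
`ν^p`; the outer ones make up `ν^q`, acting through cables. -/
lemma nuRep_comp [Fintype J] [Fintype J'] (p : ParMor I J) (q : ParMor J J')
    (h : CommPair Ra Rb) :
    nuRep t Φ (p.comp q) Ra Rb = nuRep t Φ p Ra Rb *
      nuRep t Φ q (fibreRep p Ra) (fibreRep p Rb) := by
  have e : nuRep t Φ p Ra Rb = ((Finset.univ : Finset J').toList.map fun k =>
      ((leavesOne (q.paren k)).map fun j => shuffleElt t Φ Ra Rb (p.paren j)).prod).prod := by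
    refine (list_prod_perm q.perm_univ.1 q.perm_univ.2 ?_).symm.trans (list_prod_flatMap _ _ _)
    intro j j' hj
    have hd : ∀ i ∈ leavesOne (p.paren j), ∀ i' ∈ leavesOne (p.paren j'), i ≠ i' :=
      fun i hi i' hi' e => p.leaves_disjoint hj i hi (e ▸ hi')
    exact commute_shuffleElt
      (fun i hi => commSeries_shuffleElt (fun i' hi' => h.left.comm i i' (hd i hi i' hi'))
        fun i' _ => h.comm i i')
      (fun i hi => commSeries_shuffleElt (fun i' _ => (h.comm i' i).symm)
        fun i' hi' => h.right.comm i i' (hd i hi i' hi'))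
  rw [e, nuRep, nuRep, ← list_prod_map_mul (Finset.nodup_toList _)]
  · refine congrArg List.prod (List.map_congr_left fun k _ => ?_)
    exact shuffleElt_substOne h p.paren ((p.comp q).nodup_paren k)
  · intro k k' hk
    refine commute_shuffleElt (fun j hj => ?_) (fun j hj => ?_)
    · refine CommSeries.listRep fun i hi => CommSeries.list_prod fun j' hj' => ?_
      have hjj : j ≠ j' := fun e => q.leaves_disjoint hk j hj (e ▸ hj')
      exact commSeries_shuffleElt
        (fun i' hi' => h.left.comm i i' fun e => p.leaves_disjoint hjj i hi (e ▸ hi'))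
        fun i' _ => h.comm i i'
    · refine CommSeries.listRep fun i hi => CommSeries.list_prod fun j' hj' => ?_
      have hjj : j ≠ j' := fun e => q.leaves_disjoint hk j hj (e ▸ hj')
      exact commSeries_shuffleElt (fun i' _ => (h.comm i' i).symm)
        (fun i' hi' => h.right.comm i i' fun e => p.leaves_disjoint hjj i hi (e ▸ hi'))

variable (t Φ) in
/-- The action of the higher associator. -/
noncomputable def higherRep [Fintype J] {p p' : ParMor I J}
    (r : ∀ j, Reparen (p.paren j) (p'.paren j)) (R : I → (L →ₗ[K] A)) : PowerSeries A :=
  ((Finset.univ : Finset J).toList.map fun j => (r j).evalRep t Φ R).prod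

lemma map_higherRep [Fintype J] {B : Type*} [Ring B] [Algebra K B] (φ : A →ₐ[K] B)
    {p p' : ParMor I J} (r : ∀ j, Reparen (p.paren j) (p'.paren j)) :
    PowerSeries.map φ.toRingHom (higherRep t Φ r R) =
      higherRep t Φ r (fun i => φ.toLinearMap ∘ₗ R i) := by
  rw [higherRep, map_list_prod, List.map_map]
  exact congrArg List.prod (List.map_congr_left fun j _ => (r j).map_evalRep φ)

lemma higherRep_eq [Fintype J] {p p' : ParMor I J} (hR : CommFam R)
    (r r' : ∀ j, Reparen (p.paren j) (p'.paren j)) : higherRep t Φ r R = higherRep t Φ r' R :=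
  congrArg List.prod (List.map_congr_left fun j _ =>
    Reparen.evalRep_eq hR (p.nodup_paren j) (r j) (r' j))

lemma Reparen.commute_of_disjoint (hR : CommFam R) {T₁ T₁' T₂ T₂' : WithOne (FreeMagma I)}
    (r₁ : Reparen T₁ T₁') (r₂ : Reparen T₂ T₂') (h : ∀ i ∈ leavesOne T₁, i ∉ leavesOne T₂) :
    Commute (r₁.evalRep t Φ R) (r₂.evalRep t Φ R) :=
  r₁.commute_evalRep fun i hi => r₂.commSeries_evalRep fun j hj =>
    hR.comm i j fun e => h i hi (e ▸ hj)

/-- The product is the value of the composed reparenthesizations, and by coherence any `r''` has the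
same value. This is vertical functoriality. -/
lemma higherRep_comp [Fintype J] {p p' p'' : ParMor I J} (hR : CommFam R)
    (r : ∀ j, Reparen (p.paren j) (p'.paren j)) (r' : ∀ j, Reparen (p'.paren j) (p''.paren j))
    (r'' : ∀ j, Reparen (p.paren j) (p''.paren j)) :
    higherRep t Φ r' R * higherRep t Φ r R = higherRep t Φ r'' R := by
  rw [higherRep, higherRep, ← list_prod_map_mul (Finset.nodup_toList _)]
  · refine congrArg List.prod (List.map_congr_left fun j _ => ?_)
    obtain ⟨s, hs⟩ := IsReparen.trans (t := t) (Φ := Φ) (R := R) ⟨r j, rfl⟩ ⟨r' j, rfl⟩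
    rw [← hs]
    exact Reparen.evalRep_eq hR (p.nodup_paren j) _ _
  · intro j j' hj
    refine (r j).commute_of_disjoint hR (r' j') ?_
    rw [(r j').leaves_eq]
    exact p.leaves_disjoint hj

lemma higherRep_refl [Fintype J] {p : ParMor I J} (hR : CommFam R)
    (r : ∀ j, Reparen (p.paren j) (p.paren j)) : higherRep t Φ r R = 1 := by
  refine List.prod_eq_one fun y hy => ?_
  obtain ⟨j, _, rfl⟩ := List.mem_map.1 hy
  obtain ⟨s, hs⟩ := IsReparen.refl (t := t) (Φ := Φ) (R := R) (p.paren j)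
  rw [← hs]
  exact Reparen.evalRep_eq hR (p.nodup_paren j) _ _

lemma commute_C_higherRep [Fintype J] {p p' : ParMor I J}
    (r : ∀ j, Reparen (p.paren j) (p'.paren j)) {z : A} (h : ∀ i a, Commute z (R i a)) :
    Commute (C z) (higherRep t Φ r R) := by
  refine Commute.list_prod_right _ _ fun y hy => ?_
  obtain ⟨j, _, rfl⟩ := List.mem_map.1 hy
  exact ((r j).commute_evalRep fun i _ a => ((h i a).symm.map (C (R := A)) :)).symm

/-- Equivariance of the higher associator. -/
lemma commSeries_higherRep [Fintype J] {p p' : ParMor I J} (hR : CommFam R)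
    (r : ∀ j, Reparen (p.paren j) (p'.paren j)) (j : J) :
    CommSeries (fibreRep p R j) (higherRep t Φ r R) := by
  refine CommSeries.list_prod fun j' _ => ?_
  by_cases hj : j = j'
  · subst hj
    exact (r j).commSeries_evalRep_tot hR (p.nodup_paren j)
  · exact CommSeries.listRep fun i hi => (r j').commSeries_evalRep fun i' hi' =>
      hR.comm i i' fun e => p.leaves_disjoint hj i hi (e ▸ hi')

/-- The higher associators are compatible with `ν^p`. -/
lemma nuRep_higherRep [Fintype J] {p p' : ParMor I J} (h : CommPair Ra Rb)
    (r : ∀ j, Reparen (p.paren j) (p'.paren j)) :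
    nuRep t Φ p' Ra Rb * (higherRep t Φ r Ra * higherRep t Φ r Rb) =
      higherRep t Φ r (Ra + Rb) * nuRep t Φ p Ra Rb := by
  -- Only two families occur here; the third slot of `tripleSet` repeats the second.
  have dis : ∀ {P P' : J → PowerSeries A},
      (∀ j, Supp (tripleSet Ra Rb Rb (leavesOne (p.paren j))) (P j)) →
      (∀ j, Supp (tripleSet Ra Rb Rb (leavesOne (p.paren j))) (P' j)) →
      ∀ j j', j ≠ j' → Commute (P j) (P' j') := by
    intro P P' hP hP' j j' hj
    refine (hP j).commute (hP' j') ?_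
    rintro f ⟨i, hi, hf⟩ f' ⟨i', hi', hf'⟩
    have hii : i ≠ i' := fun e => p.leaves_disjoint hj i hi (e ▸ hi')
    rcases hf with rfl | rfl | rfl <;> rcases hf' with rfl | rfl | rfl
    exacts [h.left.comm _ _ hii, h.comm _ _, h.comm _ _, (h.comm _ _).symm,
      h.right.comm _ _ hii, h.right.comm _ _ hii, (h.comm _ _).symm, h.right.comm _ _ hii,
      h.right.comm _ _ hii]
  have sS : ∀ j, Supp (tripleSet Ra Rb Rb (leavesOne (p.paren j)))
      (shuffleElt t Φ Ra Rb (p.paren j)) := fun j Q h => commute_shuffleElt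
    (fun i hi => tripleSet_left h hi) fun i hi => tripleSet_mid h hi
  have sS' : ∀ j, Supp (tripleSet Ra Rb Rb (leavesOne (p.paren j)))
      (shuffleElt t Φ Ra Rb (p'.paren j)) := fun j Q h => commute_shuffleElt
    (fun i hi => tripleSet_left h ((r j).leaves_eq ▸ hi))
    fun i hi => tripleSet_mid h ((r j).leaves_eq ▸ hi)
  have sa : ∀ j, Supp (tripleSet Ra Rb Rb (leavesOne (p.paren j))) ((r j).evalRep t Φ Ra) :=
    fun j Q h => (r j).commute_evalRep fun i hi => tripleSet_left h hi
  have sb : ∀ j, Supp (tripleSet Ra Rb Rb (leavesOne (p.paren j))) ((r j).evalRep t Φ Rb) :=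
    fun j Q h => (r j).commute_evalRep fun i hi => tripleSet_mid h hi
  have sab : ∀ j, Supp (tripleSet Ra Rb Rb (leavesOne (p.paren j)))
      ((r j).evalRep t Φ (Ra + Rb)) := fun j Q h =>
    (r j).commute_evalRep fun i hi => (tripleSet_left h hi).add (tripleSet_mid h hi)
  have hn := Finset.nodup_toList (Finset.univ : Finset J)
  rw [nuRep, nuRep, higherRep, higherRep, higherRep, ← list_prod_map_mul hn (dis sb sa),
    ← list_prod_map_mul hn
      (fun j j' hj => (dis sa sS' j j' hj).mul_left (dis sb sS' j j' hj)),
    ← list_prod_map_mul hn (dis sS sab)]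
  exact congrArg List.prod (List.map_congr_left fun j _ =>
    (r j).shuffleElt_evalRep h (p.nodup_paren j))

/-- Substitution of the fibres of a fixed morphism into a reparenthesization. -/
lemma higherRep_whiskerLeft [Fintype J'] (p : ParMor I J) {q q' : ParMor J J'} (hR : CommFam R)
    (r : ∀ k, Reparen (q.paren k) (q'.paren k))
    (r' : ∀ k, Reparen ((p.comp q).paren k) ((p.comp q').paren k)) :
    higherRep t Φ r' R = higherRep t Φ r (fibreRep p R) := by
  refine congrArg List.prod (List.map_congr_left fun k _ => ?_)
  have key : ∀ {T T' : WithOne (FreeMagma J)} (s : Reparen T T'),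
      IsReparen t Φ R (substOne p.paren T) (substOne p.paren T')
        (s.evalRep t Φ (fibreRep p R)) := by
    intro T T' s
    cases s with
    | empty => exact .refl 1
    | word f hf => exact .substOne_outer p.paren hf
  obtain ⟨s, hs⟩ := key (r k)
  rw [← hs]
  exact Reparen.evalRep_eq hR ((p.comp q).nodup_paren k) _ _

/-- Substitution of reparenthesizations into the fibres of a fixed morphism. -/
lemma higherRep_whiskerRight [Fintype J] [Fintype J'] {p p' : ParMor I J} (q : ParMor J J')
    (hR : CommFam R) (r : ∀ j, Reparen (p.paren j) (p'.paren j))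
    (r' : ∀ k, Reparen ((p.comp q).paren k) ((p'.comp q).paren k)) :
    higherRep t Φ r' R = higherRep t Φ r R := by
  have e : higherRep t Φ r R = ((Finset.univ : Finset J').toList.map fun k =>
      ((leavesOne (q.paren k)).map fun j => (r j).evalRep t Φ R).prod).prod :=
    (list_prod_perm q.perm_univ.1 q.perm_univ.2 fun j j' hj =>
      (r j).commute_of_disjoint hR (r j') (p.leaves_disjoint hj)).symm.trans
        (list_prod_flatMap _ _ _)
  rw [e]
  refine congrArg List.prod (List.map_congr_left fun k _ => ?_)
  obtain ⟨s, hs⟩ := IsReparen.substOne_inner (t := t) (Φ := Φ) (R := R) (P := fun j =>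
    (r j).evalRep t Φ R) (fun j => ⟨r j, rfl⟩) (q.paren k)
  rw [← hs]
  exact Reparen.evalRep_eq hR ((p.comp q).nodup_paren k) _ _

end Families

/-! ### Actions of `g^I ⊕ h` and their associators -/

section FusionAlgebra

open PowerSeries (C coeff)

variable {K : Type u} [Field K] {g : Type v} [LieRing g] [LieAlgebra K g]
  {h : Type x} [LieRing h] [LieAlgebra K h] {I J : Type w}
  {A : Type*} [Ring A] [Algebra K A]

/-- The action of the `i`-th copy of `g`. -/
noncomputable def strands (f : ((I → g) × h) →ₗ⁅K⁆ A) (i : I) : g →ₗ[K] A :=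
  (f.comp ((LieHom.inl K (I → g) h).comp (single K g i)) : g →ₗ⁅K⁆ A)

/-- The action of `h`. -/
noncomputable def hPart (f : ((I → g) × h) →ₗ⁅K⁆ A) : h →ₗ[K] A :=
  (f.comp (LieHom.inr K (I → g) h) : h →ₗ⁅K⁆ A)

lemma strands_apply (f : ((I → g) × h) →ₗ⁅K⁆ A) (i : I) (a : g) :
    strands f i a = f (single K g i a, 0) := rfl

lemma commute_of_lie_eq_zero {L : Type*} [LieRing L] [LieAlgebra K L] (f : L →ₗ⁅K⁆ A) {a b : L}
    (hab : ⁅a, b⁆ = 0) : Commute (f a) (f b) := by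
  have h := f.map_lie a b
  rw [hab, map_zero, LieRing.of_associative_ring_bracket, eq_comm, sub_eq_zero] at h
  exact h

lemma commFam_strands (f : ((I → g) × h) →ₗ⁅K⁆ A) : CommFam (strands f) where
  rep _ := isRep_lieHom _
  comm _ _ hij a b := commute_of_lie_eq_zero (K := K) f
    (Prod.ext (single_bracket_single (K := K) hij a b) (lie_zero _))

lemma commPair_strands {f f' : ((I → g) × h) →ₗ⁅K⁆ A} (hf : ∀ a b, Commute (f a) (f' b)) :
    CommPair (strands f) (strands f') where
  left := commFam_strands f
  right := commFam_strands f'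
  comm _ _ _ _ := hf _ _

lemma commute_hPart_strands (f : ((I → g) × h) →ₗ⁅K⁆ A) (b : h) (i : I) (a : g) :
    Commute (hPart f b) (strands f i a) :=
  commute_of_lie_eq_zero f (Prod.ext (zero_lie _) (lie_zero _))

lemma mul'_map_map {L L' : Type*} [LieRing L] [LieAlgebra K L] [LieRing L'] [LieAlgebra K L']
    (t : InvTensor K L) (e : L →ₗ[K] L') (f f' : L' →ₗ[K] A) :
    LinearMap.mul' K A (TensorProduct.map f f' (TensorProduct.map e e t.val)) =
      t.act (f ∘ₗ e) (f' ∘ₗ e) := by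
  rw [InvTensor.act, TensorProduct.map_comp]
  rfl

lemma act_fusionTensor [Fintype I] (tg : InvTensor K g) (th : InvTensor K h)
    (f f' : ((I → g) × h) →ₗ⁅K⁆ A) :
    (fusionTensor tg th I).act (f : ((I → g) × h) →ₗ[K] A) (f' : ((I → g) × h) →ₗ[K] A) =
      ∑ i, tg.act (strands f i) (strands f' i) + th.act (hPart f) (hPart f') := by
  rw [InvTensor.act, fusionTensor, map_add, map_add, map_sum, map_sum, mul'_map_map]
  simp only [mul'_map_map]
  rfl

lemma sum_strands [Fintype I] (f : ((I → g) × h) →ₗ⁅K⁆ A) (ξ : I → g) (η : h) :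
    f (ξ, η) = ∑ i, strands f i (ξ i) + hPart f η := by
  classical
  have e : (ξ, η) = ∑ i, ((single K g i (ξ i), 0) : (I → g) × h) + (0, η) := by
    refine Prod.ext ?_ ?_
    · simp only [Prod.fst_add, Prod.fst_sum, add_zero, single_apply]
      exact (Finset.univ_sum_single ξ).symm
    · simp only [Prod.snd_add, Prod.snd_sum, Finset.sum_const_zero, zero_add]
  rw [e, map_add, map_sum]
  rfl

/-- Pulling back along `p` sends the `j`-th copy of `g` diagonally into the copies indexed by the
fibre over `j`. Restriction of modules is therefore cabling. -/
lemma strands_pullback (f : ((I → g) × h) →ₗ⁅K⁆ A) (p : ParMor I J) :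
    strands (f.comp (pullback p.map)) = fibreRep p (strands f) := by
  classical
  -- The action of a cable is the action of the function which is constant on its letters and zero
  -- elsewhere.
  have key : ∀ (a : g) (l : List I), l.Nodup →
      listRep (strands f) l a = f ((fun i => if i ∈ l then a else 0), 0) := by
    intro a l hl
    induction l with
    | nil =>
      simp only [List.not_mem_nil, if_false]
      exact (map_zero f).symm
    | cons i l ih =>
      obtain ⟨hi, hl⟩ := List.nodup_cons.1 hl
      change strands f i a + listRep (strands f) l a = _
      rw [ih hl, strands_apply, ← map_add]
      refine congrArg f (Prod.ext (funext fun i' => ?_) (add_zero 0))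
      change (single K g i a) i' + (if i' ∈ l then a else 0) = if i' ∈ i :: l then a else 0
      rw [single_apply]
      by_cases e : i' = i
      · subst e
        simp [hi]
      · simp [e]
  funext j
  refine LinearMap.ext fun a => ?_
  change f (single K g j a ∘ p.map, 0) = listRep (strands f) (leavesOne (p.paren j)) a
  rw [key a _ (p.nodup_paren j)]
  refine congrArg f (Prod.ext (funext fun i => ?_) rfl)
  change (single K g j a) (p.map i) = if i ∈ leavesOne (p.paren j) then a else 0
  rw [single_apply]
  simp only [p.leaves_paren, p.mem]
  by_cases e : p.map i = j
  · simp [e]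
  · simp [e]

lemma hPart_pullback (f : ((I → g) × h) →ₗ⁅K⁆ A) (p : I → J) :
    hPart (f.comp (pullback p)) = hPart f := rfl

variable {Φ : DrinfeldAssociator K}

/-- Iterated group-likeness. Arguments with the same index need not commute. -/
lemma evalh_list_sum {S : Type*} {X Y : S → A} {l : List S} (hl : l.Nodup)
    (hXX : ∀ i j, i ≠ j → Commute (X i) (X j)) (hXY : ∀ i j, i ≠ j → Commute (X i) (Y j))
    (hYY : ∀ i j, i ≠ j → Commute (Y i) (Y j)) :
    Φ.series.evalh (l.map X).sum (l.map Y).sum = (l.map fun i => Φ.series.evalh (X i) (Y i)).prod := by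
  induction l with
  | nil => exact DrinfeldCat.evalh_zero
  | cons i l ih =>
    obtain ⟨hi, hl⟩ := List.nodup_cons.1 hl
    have hs : ∀ {Z W : S → A}, (∀ i j, i ≠ j → Commute (Z i) (W j)) →
        Commute (Z i) (l.map W).sum := fun hZW => Commute.list_sum_right _ _ fun y hy => by
      obtain ⟨j, hj, rfl⟩ := List.mem_map.1 hy
      exact hZW i j fun e => hi (e ▸ hj)
    simp only [List.map_cons, List.sum_cons, List.prod_cons]
    rw [DrinfeldAssociator.evalh_add _ (hs hXX) (hs hXY) (hs fun i j hij => (hXY j i hij.symm).symm)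
      (hs hYY), ih hl]

/-- The action of the associator for `g^I ⊕ h`. -/
lemma evalh_fusionTensor [Fintype I] (tg : InvTensor K g) (th : InvTensor K h)
    {f₁ f₂ f₃ : ((I → g) × h) →ₗ⁅K⁆ A} (h₁₂ : ∀ a b, Commute (f₁ a) (f₂ b))
    (h₁₃ : ∀ a b, Commute (f₁ a) (f₃ b)) (h₂₃ : ∀ a b, Commute (f₂ a) (f₃ b)) :
    Φ.series.evalh
        ((fusionTensor tg th I).act (f₁ : ((I → g) × h) →ₗ[K] A) (f₂ : ((I → g) × h) →ₗ[K] A))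
        ((fusionTensor tg th I).act (f₂ : ((I → g) × h) →ₗ[K] A) (f₃ : ((I → g) × h) →ₗ[K] A)) =
      assocElt tg Φ (strands f₁) (strands f₂) (strands f₃) Finset.univ.toList *
        Φ.series.evalh (th.act (hPart f₁) (hPart f₂)) (th.act (hPart f₂) (hPart f₃)) := by
  have p₁₂ := commPair_strands h₁₂
  have p₁₃ := commPair_strands h₁₃
  have p₂₃ := commPair_strands h₂₃
  have hs : ∀ {z : A}, (∀ i a, Commute z (strands f₁ i a)) → (∀ i a, Commute z (strands f₂ i a)) →
      (∀ i a, Commute z (strands f₃ i a)) →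
      Commute z (∑ i, tg.act (strands f₁ i) (strands f₂ i)) ∧
      Commute z (∑ i, tg.act (strands f₂ i) (strands f₃ i)) := fun h₁ h₂ h₃ =>
    ⟨Commute.sum_right _ _ _ fun i _ => tg.commute_act (h₁ i) (h₂ i),
      Commute.sum_right _ _ _ fun i _ => tg.commute_act (h₂ i) (h₃ i)⟩
  have H₁ := fun b => hs (z := hPart f₁ b) (fun i a => commute_hPart_strands f₁ b i a)
    (fun i a => h₁₂ _ _) (fun i a => h₁₃ _ _)
  have H₂ := fun b => hs (z := hPart f₂ b) (fun i a => (h₁₂ _ _).symm)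
    (fun i a => commute_hPart_strands f₂ b i a) (fun i a => h₂₃ _ _)
  have H₃ := fun b => hs (z := hPart f₃ b) (fun i a => (h₁₃ _ _).symm) (fun i a => (h₂₃ _ _).symm)
    (fun i a => commute_hPart_strands f₃ b i a)
  -- The `h`-part commutes with all the copies of `g`, so it splits off first; afterwards the sum
  -- over the copies of `g` is split.
  rw [act_fusionTensor, act_fusionTensor, DrinfeldAssociator.evalh_add _
    (th.commute_act (fun b => (H₁ b).1.symm) (fun b => (H₂ b).1.symm))
    (th.commute_act (fun b => (H₂ b).1.symm) (fun b => (H₃ b).1.symm))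
    (th.commute_act (fun b => (H₁ b).2.symm) (fun b => (H₂ b).2.symm))
    (th.commute_act (fun b => (H₂ b).2.symm) (fun b => (H₃ b).2.symm)),
    ← Finset.sum_map_toList, ← Finset.sum_map_toList, evalh_list_sum (Finset.nodup_toList _)]
  · rfl
  · intro i j hij
    have k₁ := fun a => tg.commute_act (fun b => p₁₂.left.comm i j hij a b) (fun b => p₁₂.comm i j a b)
    have k₂ := fun a => tg.commute_act (fun b => (p₁₂.comm j i b a).symm)
      (fun b => p₁₂.right.comm i j hij a b)
    exact (tg.commute_act (fun a => (k₁ a).symm) (fun a => (k₂ a).symm)).symm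
  · intro i j hij
    have k₁ := fun a => tg.commute_act (fun b => p₁₂.comm i j a b) (fun b => p₁₃.comm i j a b)
    have k₂ := fun a => tg.commute_act (fun b => p₁₂.right.comm i j hij a b)
      (fun b => p₂₃.comm i j a b)
    exact (tg.commute_act (fun a => (k₁ a).symm) (fun a => (k₂ a).symm)).symm
  · intro i j hij
    have k₁ := fun a => tg.commute_act (fun b => p₁₂.right.comm i j hij a b)
      (fun b => p₂₃.comm i j a b)
    have k₂ := fun a => tg.commute_act (fun b => (p₂₃.comm j i b a).symm)
      (fun b => p₂₃.right.comm i j hij a b)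
    exact (tg.commute_act (fun a => (k₁ a).symm) (fun a => (k₂ a).symm)).symm

end FusionAlgebra

/-! ### The algebra of intertwined pairs of endomorphisms -/

section Intertwining

variable {K : Type u} [Field K] {L : Type v} [LieRing L] [LieAlgebra K L]
  {M : Type w} [Category.{x} M] [Preadditive M] [Linear K M] {V V' : M}

variable (K) in
/-- The pairs of endomorphisms which are intertwined by `e`. -/
def intertwiners (e : V ⟶ V') : Subalgebra K (End V × End V') where
  carrier := {p | e ≫ p.2.asHom = p.1.asHom ≫ e}
  mul_mem' {p q} hp hq := by
    change e ≫ q.2.asHom ≫ p.2.asHom = (q.1.asHom ≫ p.1.asHom) ≫ e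
    rw [← Category.assoc, hq, Category.assoc, hp, Category.assoc]
  add_mem' {p q} hp hq := by
    change e ≫ (p.2.asHom + q.2.asHom) = (p.1.asHom + q.1.asHom) ≫ e
    rw [Preadditive.comp_add, Preadditive.add_comp, hp, hq]
  algebraMap_mem' c := by
    rw [Algebra.algebraMap_eq_smul_one]
    change e ≫ (c • 𝟙 V') = (c • 𝟙 V) ≫ e
    rw [Linear.comp_smul, Linear.smul_comp, Category.comp_id, Category.id_comp]

variable {e : V ⟶ V'} {I : Type*}

variable (K e) in
/-- The projection to the endomorphisms of the source. -/
def intertwiners.fst : intertwiners K e →ₐ[K] End V :=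
  (AlgHom.fst K (End V) (End V')).comp (intertwiners K e).val

variable (K e) in
/-- The projection to the endomorphisms of the target. -/
def intertwiners.snd : intertwiners K e →ₐ[K] End V' :=
  (AlgHom.snd K (End V) (End V')).comp (intertwiners K e).val

/-- Intertwined families of actions. -/
def intertwiners.family {R : I → (L →ₗ[K] End V)} {R' : I → (L →ₗ[K] End V')}
    (hR : ∀ i a, e ≫ (R' i a).asHom = (R i a).asHom ≫ e) (i : I) : L →ₗ[K] intertwiners K e :=
  ((R i).prod (R' i)).codRestrict (Subalgebra.toSubmodule (intertwiners K e)) (hR i)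

/-- Series which come from the intertwiners are intertwined. -/
lemma intertwine_of_map {P : PowerSeries (End V)} {P' : PowerSeries (End V')}
    (Q : PowerSeries (intertwiners K e))
    (h : PowerSeries.map (intertwiners.fst K e).toRingHom Q = P)
    (h' : PowerSeries.map (intertwiners.snd K e).toRingHom Q = P') (n : ℕ) :
    e ≫ endCoeff P' n = endCoeff P n ≫ e := by
  rw [← h, ← h']
  -- The coefficients of `Q` lie in the subalgebra, and membership in it is the required equation.
  exact (PowerSeries.coeff n Q).2

end Intertwining

/-! ### The action of `ν^p` and `Φ^{p,p'}` on modules -/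

section Modules

open PowerSeries (C coeff)
open MonoidalCategory

section Intertwine

variable {K : Type u} [Field K] {L : Type v} [LieRing L] [LieAlgebra K L]
  {M : Type*} [Category* M] [Preadditive M] [Linear K M] {V V' : M} {e : V ⟶ V'}
  {I J : Type w} {t : InvTensor K L} {Φ : DrinfeldAssociator K}

/-- The formula for `ν^p` is evaluated in the algebra of intertwined pairs; its two projections are
the series on the source and on the target. -/
lemma intertwine_nuRep [Fintype J] (p : ParMor I J) {Ra Rb : I → (L →ₗ[K] End V)}
    {Ra' Rb' : I → (L →ₗ[K] End V')} (ha : ∀ i a, e ≫ (Ra' i a).asHom = (Ra i a).asHom ≫ e)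
    (hb : ∀ i a, e ≫ (Rb' i a).asHom = (Rb i a).asHom ≫ e) (n : ℕ) :
    e ≫ endCoeff (nuRep t Φ p Ra' Rb') n = endCoeff (nuRep t Φ p Ra Rb) n ≫ e :=
  intertwine_of_map (nuRep t Φ p (intertwiners.family ha) (intertwiners.family hb))
    (map_nuRep _ _) (map_nuRep _ _) n

lemma intertwine_higherRep [Fintype J] {p p' : ParMor I J}
    (r : ∀ j, Reparen (p.paren j) (p'.paren j)) {R : I → (L →ₗ[K] End V)}
    {R' : I → (L →ₗ[K] End V')} (hR : ∀ i a, e ≫ (R' i a).asHom = (R i a).asHom ≫ e) (n : ℕ) :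
    e ≫ endCoeff (higherRep t Φ r R') n = endCoeff (higherRep t Φ r R) n ≫ e :=
  intertwine_of_map (higherRep t Φ r (intertwiners.family hR)) (map_higherRep _ _)
    (map_higherRep _ _) n

end Intertwine

section SerHom

variable {K : Type u} [Field K] {L : Type v} [LieRing L] [LieAlgebra K L] {t : InvTensor K L}
  {Φ : DrinfeldAssociator K} {V : ModuleCat.{u} K} {ρ σ : L →ₗ⁅K⁆ End V}

/-- A morphism of modules with the same underlying action, given by a formal power series of
endomorphisms. -/
noncomputable def serHom (e : ∀ a, ρ a = σ a) (P : PowerSeries (End V))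
    (hP : ∀ a, Commute (C (ρ a)) P) : (⟨V, ρ⟩ : DrinfeldCat t Φ) ⟶ ⟨V, σ⟩ where
  coeff := endCoeff P
  equivariant n a := by
    refine Eq.trans ?_ (congrArg (fun z => endCoeff P n ≫ End.asHom z) (e a))
    exact ((commute_C_iff _ _).1 (hP a) n).symm

lemma isIso_serHom (e : ∀ a, ρ a = σ a) {P : PowerSeries (End V)}
    (hP : ∀ a, Commute (C (ρ a)) P) (hu : IsUnit P) :
    IsIso (serHom (t := t) (Φ := Φ) e P hP) := by
  have h₁ : psInv P * P = 1 := Ring.inverse_mul_cancel _ hu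
  have h₂ : P * psInv P = 1 := Ring.mul_inverse_cancel _ hu
  refine ⟨serHom (fun a => (e a).symm) (psInv P) fun a => ?_, ?_, ?_⟩
  · rw [← e]
    exact commute_inverse (hP a)
  · refine DrinfeldCat.hom_ext ((conv_coeff _ _).trans ?_)
    rw [h₁]
    exact endCoeff_one
  · refine DrinfeldCat.hom_ext ((conv_coeff _ _).trans ?_)
    rw [h₂]
    exact endCoeff_one

end SerHom

variable {K : Type u} [Field K] {g : Type v} [LieRing g] [LieAlgebra K g]
  {h : Type x} [LieRing h] [LieAlgebra K h] {I J J' : Type w}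

lemma commute_of_strands {A : Type*} [Ring A] [Algebra K A] [Fintype J]
    {f : ((J → g) × h) →ₗ⁅K⁆ A} {P : PowerSeries A} (h₁ : ∀ j, CommSeries (strands f j) P)
    (h₂ : CommSeries (hPart f) P) (a : (J → g) × h) : Commute (C (f a)) P := by
  obtain ⟨ξ, η⟩ := a
  rw [sum_strands, map_add, map_sum]
  exact (Commute.sum_left _ _ _ fun j _ => h₁ j _).add_left (h₂ η)

variable {tg : InvTensor K g} {th : InvTensor K h} {Φ : DrinfeldAssociator K}

lemma braidElement_eq (T : WithOne (FreeMagma I)) : braidElement tg Φ T =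
    shuffleElt tg Φ (fun i => strandTwo K g (.inl i)) (fun i => strandTwo K g (.inr i)) T := by
  have e : strandTwo K g = Sum.elim (fun i : I => strandTwo K g (.inl i))
      (fun i => strandTwo K g (.inr i)) := by
    funext s
    rcases s with i | i <;> rfl
  rw [braidElement, e]
  rfl

lemma fibreRep_add {L : Type*} [LieRing L] [LieAlgebra K L] {A : Type*} [Ring A] [Algebra K A]
    (p : ParMor I J) (R R' : I → (L →ₗ[K] A)) :
    fibreRep p (R + R') = fibreRep p R + fibreRep p R' :=
  funext fun _ => repOne_add R R' _

lemma Reparen.eval_eq_evalRep {T T' : WithOne (FreeMagma I)} (r : Reparen T T') :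
    r.eval tg Φ = r.evalRep tg Φ (strand K g) := by
  cases r <;> rfl

section

variable [Fintype I] [Fintype J] [Fintype J']

lemma actOne_strand (X : FusionCat tg th Φ I) :
    (fun i => (actOne X).toLinearMap ∘ₗ strand K g i) = strands X.ρ := by
  funext i
  refine LinearMap.ext fun a => ?_
  exact UniversalEnvelopingAlgebra.lift_ι_apply' K _ _

/-- The bridge between the element of `U(g^I) ⊗ U(g^I)` and the calculus of commuting actions: `i^a`
becomes the action on `X` and `i^b` the action on `Y`. -/
lemma map_actTwo_nu (p : ParMor I J) (X Y : FusionCat tg th Φ I) :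
    PowerSeries.map (actTwo X Y : _ →+* End (X.V ⊗ Y.V)) (nu tg Φ p) =
      nuRep tg Φ p (strands (repL X.ρ Y.V)) (strands (repR X.V Y.ρ)) := by
  have e : nu tg Φ p = nuRep tg Φ p (fun i => strandTwo K g (.inl i))
      (fun i => strandTwo K g (.inr i)) := by
    refine (noncommProd_univ_eq _ _).trans ?_
    exact congrArg List.prod (List.map_congr_left fun j _ => braidElement_eq _)
  have ha : (fun i => (actTwo X Y).toLinearMap ∘ₗ strandTwo K g (.inl i)) =
      strands (repL X.ρ Y.V) := by
    funext i
    refine LinearMap.ext fun a => ?_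
    refine (Algebra.TensorProduct.lift_tmul _ _
      (fun _ _ => commute_rAlg_lAlg (K := K) _ _) _ _).trans ?_
    rw [map_one, map_one, mul_one]
    exact congrArg (rAlg K X.V Y.V) (LinearMap.congr_fun (congrFun (actOne_strand X) i) a)
  have hb : (fun i => (actTwo X Y).toLinearMap ∘ₗ strandTwo K g (.inr i)) =
      strands (repR X.V Y.ρ) := by
    funext i
    refine LinearMap.ext fun a => ?_
    refine (Algebra.TensorProduct.lift_tmul _ _
      (fun _ _ => commute_rAlg_lAlg (K := K) _ _) _ _).trans ?_
    rw [map_one, map_one, one_mul]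
    exact congrArg (lAlg K X.V Y.V) (LinearMap.congr_fun (congrFun (actOne_strand Y) i) a)
  rw [e, ← ha, ← hb]
  exact map_nuRep (actTwo X Y) p

lemma map_actOne_higherAssoc {p p' : ParMor I J} (r : ∀ j, Reparen (p.paren j) (p'.paren j))
    (X : FusionCat tg th Φ I) :
    PowerSeries.map (actOne X : _ →+* End X.V) (higherAssoc tg Φ r) =
      higherRep tg Φ r (strands X.ρ) := by
  have e : higherAssoc tg Φ r = higherRep tg Φ r (strand K g) := by
    refine (noncommProd_univ_eq _ _).trans ?_
    exact congrArg List.prod (List.map_congr_left fun j _ => (r j).eval_eq_evalRep)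
  rw [e, ← actOne_strand]
  exact map_higherRep (actOne X) r

lemma strands_tensorRep (X Y : FusionCat tg th Φ I) : strands (tensorRep X.ρ Y.ρ) =
    strands (repL X.ρ Y.V) + strands (repR X.V Y.ρ) := rfl

lemma commPair_repL_repR (X Y : FusionCat tg th Φ I) :
    CommPair (strands (repL X.ρ Y.V)) (strands (repR X.V Y.ρ)) :=
  commPair_strands (commute_repL_repR X.ρ Y.ρ)

/-- This is the linearity of the coherence map. It holds for the copies of `g` by equivariance under
the cables of the fibres, and for `h` because `h` commutes with all strands. -/
lemma commute_nuTwo (p : ParMor I J) (X Y : FusionCat tg th Φ I) (a : (J → g) × h) :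
    Commute (C (tensorRep X.ρ Y.ρ (pullback (K := K) p.map a)))
      (nuRep tg Φ p (strands (repL X.ρ Y.V)) (strands (repR X.V Y.ρ))) := by
  refine commute_of_strands (K := K) (f := (tensorRep X.ρ Y.ρ).comp (pullback p.map)) (fun j => ?_) ?_ a
  · rw [strands_pullback, strands_tensorRep, fibreRep_add]
    exact commSeries_nuRep p (commPair_repL_repR X Y) j
  · rw [hPart_pullback]
    refine fun b => commute_C_nuRep p (fun i a => Commute.add_left ?_ ?_)
      fun i a => Commute.add_left ?_ ?_
    · exact commute_hPart_strands (repL X.ρ Y.V) b i a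
    · exact (commute_repL_repR X.ρ Y.ρ _ _).symm
    · exact commute_repL_repR X.ρ Y.ρ _ _
    · exact commute_hPart_strands (repR X.V Y.ρ) b i a

lemma commute_higherOne {p p' : ParMor I J} (r : ∀ j, Reparen (p.paren j) (p'.paren j))
    (X : FusionCat tg th Φ I) (a : (J → g) × h) :
    Commute (C (X.ρ (pullback (K := K) p.map a))) (higherRep tg Φ r (strands X.ρ)) := by
  refine commute_of_strands (K := K) (f := X.ρ.comp (pullback p.map)) (fun j => ?_) ?_ a
  · rw [strands_pullback]
    exact commSeries_higherRep (commFam_strands X.ρ) r j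
  · exact fun b => commute_C_higherRep r fun i a => commute_hPart_strands X.ρ b i a

/-- The coherence map of `F^p`. -/
noncomputable def fusionMu (p : ParMor I J) (X Y : FusionCat tg th Φ I) :
    (fusionFunctor p.map).obj X ⊗ (fusionFunctor p.map).obj Y ⟶
      (fusionFunctor (tg := tg) (th := th) (Φ := Φ) p.map).obj (X ⊗ Y) :=
  serHom (ρ := tensorRep (X.ρ.comp (pullback p.map)) (Y.ρ.comp (pullback p.map)))
    (σ := (tensorRep X.ρ Y.ρ).comp (pullback p.map)) (fun _ => rfl)
    (nuRep tg Φ p (strands (repL X.ρ Y.V)) (strands (repR X.V Y.ρ))) (commute_nuTwo p X Y)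

end

end Modules

/-! ### The monoidal structure of the fusion functors -/

section Structure

open PowerSeries (C coeff)
open MonoidalCategory

variable {K : Type u} [Field K] {g : Type v} [LieRing g] [LieAlgebra K g]
  {h : Type x} [LieRing h] [LieAlgebra K h] {I J J' : Type w} [Fintype I] [Fintype J] [Fintype J']
  {tg : InvTensor K g} {th : InvTensor K h} {Φ : DrinfeldAssociator K}

lemma isIso_fusionMu (p : ParMor I J) (X Y : FusionCat tg th Φ I) : IsIso (fusionMu p X Y) := by
  unfold fusionMu
  exact isIso_serHom (ρ := tensorRep (X.ρ.comp (pullback p.map)) (Y.ρ.comp (pullback p.map)))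
    (σ := (tensorRep X.ρ Y.ρ).comp (pullback p.map)) (fun _ => rfl)
    (P := nuRep tg Φ p (strands (repL X.ρ Y.V)) (strands (repR X.V Y.ρ))) (commute_nuTwo p X Y)
    (isUnit_nuRep p)

lemma fusionMu_natural_left (p : ParMor I J) {X Y : FusionCat tg th Φ I} (f : X ⟶ Y)
    (Z : FusionCat tg th Φ I) :
    (fusionFunctor p.map).map f ▷ (fusionFunctor p.map).obj Z ≫ fusionMu p Y Z =
      fusionMu p X Z ≫ (fusionFunctor p.map).map (f ▷ Z) := by
  refine DrinfeldCat.hom_ext (conv_swap _ _ _ _ fun i j => ?_)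
  refine intertwine_nuRep (e := f.coeff i ▷ Z.V) p (fun k a => ?_) (fun k a => ?_) j
  · change f.coeff i ▷ Z.V ≫ (Y.ρ _).asHom ▷ Z.V = (X.ρ _).asHom ▷ Z.V ≫ f.coeff i ▷ Z.V
    rw [← comp_whiskerRight, ← comp_whiskerRight, f.equivariant]
  · exact (whisker_exchange _ _).symm

lemma fusionMu_natural_right (p : ParMor I J) {X Y : FusionCat tg th Φ I}
    (Z : FusionCat tg th Φ I) (f : X ⟶ Y) :
    (fusionFunctor p.map).obj Z ◁ (fusionFunctor p.map).map f ≫ fusionMu p Z Y =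
      fusionMu p Z X ≫ (fusionFunctor p.map).map (Z ◁ f) := by
  refine DrinfeldCat.hom_ext (conv_swap _ _ _ _ fun i j => ?_)
  refine intertwine_nuRep (e := Z.V ◁ f.coeff i) p (fun k a => ?_) (fun k a => ?_) j
  · exact whisker_exchange _ _
  · change Z.V ◁ f.coeff i ≫ Z.V ◁ (Y.ρ _).asHom = Z.V ◁ (X.ρ _).asHom ≫ Z.V ◁ f.coeff i
    rw [← whiskerLeft_comp, ← whiskerLeft_comp, f.equivariant]

/-- The core of the hexagon for the coherence maps. The associators over `I` and `J` have the same
`h`-factor, and it commutes with `ν^p`. The remaining factors satisfy `assocElt_nuRep`. -/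
lemma assocSeries_nuRep (p : ParMor I J) (X Y Z : FusionCat tg th Φ I) :
    assocSeries X.ρ Y.ρ Z.ρ (fusionTensor tg th I) Φ *
        nuRep tg Φ p (strands (rep₁ X.ρ Y.V Z.V) + strands (rep₂ X.V Y.ρ Z.V))
          (strands (rep₃ X.V Y.V Z.ρ)) *
        nuRep tg Φ p (strands (rep₁ X.ρ Y.V Z.V)) (strands (rep₂ X.V Y.ρ Z.V)) =
      nuRep tg Φ p (strands (rep₁ X.ρ Y.V Z.V))
          (strands (rep₂ X.V Y.ρ Z.V) + strands (rep₃ X.V Y.V Z.ρ)) *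
        nuRep tg Φ p (strands (rep₂ X.V Y.ρ Z.V)) (strands (rep₃ X.V Y.V Z.ρ)) *
        assocSeries (X.ρ.comp (pullback p.map)) (Y.ρ.comp (pullback p.map))
          (Z.ρ.comp (pullback p.map)) (fusionTensor tg th J) Φ := by
  have c₁₂ := commute_rep₁_rep₂ (X := Z.V) X.ρ Y.ρ
  have c₁₃ := commute_rep₁_rep₃ (W := Y.V) X.ρ Z.ρ
  have c₂₃ := commute_rep₂_rep₃ (V := X.V) Y.ρ Z.ρ
  have e := evalh_fusionTensor (Φ := Φ) tg th c₁₂ c₁₃ c₂₃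
  have e' := evalh_fusionTensor (Φ := Φ) tg th
    (f₁ := (rep₁ X.ρ Y.V Z.V).comp (pullback p.map))
    (f₂ := (rep₂ X.V Y.ρ Z.V).comp (pullback p.map))
    (f₃ := (rep₃ X.V Y.V Z.ρ).comp (pullback p.map))
    (fun a b => c₁₂ _ _) (fun a b => c₁₃ _ _) (fun a b => c₂₃ _ _)
  rw [strands_pullback, strands_pullback, strands_pullback, hPart_pullback, hPart_pullback,
    hPart_pullback] at e'
  have key := assocElt_nuRep (t := tg) (Φ := Φ) p (commPair_strands c₁₂) (commPair_strands c₁₃)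
    (commPair_strands c₂₃)
  -- The factor of `h` commutes with every strand of the three modules, hence with `ν^p`.
  have hc : Commute (Φ.series.evalh
      (th.act (hPart (rep₁ X.ρ Y.V Z.V)) (hPart (rep₂ X.V Y.ρ Z.V)))
      (th.act (hPart (rep₂ X.V Y.ρ Z.V)) (hPart (rep₃ X.V Y.V Z.ρ))))
      (nuRep tg Φ p (strands (rep₁ X.ρ Y.V Z.V) + strands (rep₂ X.V Y.ρ Z.V))
          (strands (rep₃ X.V Y.V Z.ρ)) *
        nuRep tg Φ p (strands (rep₁ X.ρ Y.V Z.V)) (strands (rep₂ X.V Y.ρ Z.V))) := by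
    have hz : ∀ {z : End ((X.V ⊗ Y.V) ⊗ Z.V)},
        (∀ i a, Commute z (strands (rep₁ X.ρ Y.V Z.V) i a)) →
        (∀ i a, Commute z (strands (rep₂ X.V Y.ρ Z.V) i a)) →
        (∀ i a, Commute z (strands (rep₃ X.V Y.V Z.ρ) i a)) → Commute (C z)
        (nuRep tg Φ p (strands (rep₁ X.ρ Y.V Z.V) + strands (rep₂ X.V Y.ρ Z.V))
          (strands (rep₃ X.V Y.V Z.ρ)) *
        nuRep tg Φ p (strands (rep₁ X.ρ Y.V Z.V)) (strands (rep₂ X.V Y.ρ Z.V))) :=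
      fun h₁ h₂ h₃ => (commute_C_nuRep p (fun i a => (h₁ i a).add_right (h₂ i a)) h₃).mul_right
        (commute_C_nuRep p h₁ h₂)
    have z₁ := fun b => hz (z := hPart (rep₁ X.ρ Y.V Z.V) b)
      (fun i a => commute_hPart_strands _ b i a) (fun i a => c₁₂ _ _) (fun i a => c₁₃ _ _)
    have z₂ := fun b => hz (z := hPart (rep₂ X.V Y.ρ Z.V) b)
      (fun i a => (c₁₂ _ _).symm) (fun i a => commute_hPart_strands _ b i a) (fun i a => c₂₃ _ _)
    have z₃ := fun b => hz (z := hPart (rep₃ X.V Y.V Z.ρ) b)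
      (fun i a => (c₁₃ _ _).symm) (fun i a => (c₂₃ _ _).symm)
      (fun i a => commute_hPart_strands _ b i a)
    exact Φ.series.commute_evalh_left (commute_C_act z₁ z₂) (commute_C_act z₂ z₃)
  refine (congrArg (fun z => z * _ * _) e).trans (Eq.trans ?_ (congrArg (_ * ·) e'.symm))
  rw [mul_assoc, mul_assoc, hc.eq, ← mul_assoc, ← mul_assoc, key, mul_assoc]

/-- The maps after the reassociation `e` are transported back to the source, which turns the diagram
into an equation between products in one endomorphism algebra. -/
lemma conv_hexagon {M : Type*} [Category* M] [Preadditive M] {W₁ W₂ : M} {e : W₁ ⟶ W₂}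
    {m₁ m₂ : ℕ → (W₁ ⟶ W₁)} {c d : ℕ → (W₂ ⟶ W₂)} {A B P₁ P₂ Q₁ Q₂ : PowerSeries (End W₁)}
    (h₁ : m₁ = endCoeff P₁) (h₂ : m₂ = endCoeff P₂) (h₃ : ∀ n, e ≫ c n = endCoeff Q₁ n ≫ e)
    (h₄ : ∀ n, e ≫ d n = endCoeff Q₂ n ≫ e) (h : A * P₂ * P₁ = Q₂ * Q₁ * B) :
    conv m₁ (conv m₂ fun n => endCoeff A n ≫ e) = conv (fun n => endCoeff B n ≫ e) (conv c d) := by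
  rw [← conv_assoc _ c, conv_push h₃, conv_push h₄, h₁, h₂, ← conv_cst_right, ← conv_assoc,
    ← conv_assoc, conv_coeff, conv_coeff, conv_cst_right, ← mul_assoc, ← mul_assoc, h]

lemma fusionMu_associativity (p : ParMor I J) (X Y Z : FusionCat tg th Φ I) :
    fusionMu p X Y ▷ (fusionFunctor p.map).obj Z ≫ fusionMu p (X ⊗ Y) Z ≫
        (fusionFunctor p.map).map (α_ X Y Z).hom =
      (α_ ((fusionFunctor p.map).obj X) ((fusionFunctor p.map).obj Y)
        ((fusionFunctor p.map).obj Z)).hom ≫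
        (fusionFunctor p.map).obj X ◁ fusionMu p Y Z ≫ fusionMu p X (Y ⊗ Z) := by
  let F₁ := rep₁ X.ρ Y.V Z.V
  let F₂ := rep₂ X.V Y.ρ Z.V
  let F₃ := rep₃ X.V Y.V Z.ρ
  let e := (α_ X.V Y.V Z.V).hom
  have c₁ : (fun n => (fusionMu p X Y).coeff n ▷ Z.V) =
      endCoeff (nuRep tg Φ p (strands F₁) (strands F₂)) :=
    congrArg endCoeff (map_nuRep (t := tg) (Φ := Φ) (rAlg K (X.V ⊗ Y.V : ModuleCat.{u} K) Z.V) p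
      (Ra := strands (repL X.ρ Y.V)) (Rb := strands (repR X.V Y.ρ)))
  have s : strands (repL (tensorRep X.ρ Y.ρ) Z.V) = strands F₁ + strands F₂ := by
    funext i
    refine LinearMap.ext fun a => ?_
    exact map_add (rAlg K (X.V ⊗ Y.V : ModuleCat.{u} K) Z.V) _ _
  have c₂ : (fusionMu p (X ⊗ Y) Z).coeff =
      endCoeff (nuRep tg Φ p (strands F₁ + strands F₂) (strands F₃)) := by
    rw [← s]
    rfl
  have c₃ : ∀ n, e ≫ X.V ◁ (fusionMu p Y Z).coeff n =
      endCoeff (nuRep tg Φ p (strands F₂) (strands F₃)) n ≫ e := by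
    intro n
    have := congrArg (fun P => endCoeff P n) (map_nuRep (t := tg) (Φ := Φ)
      (lAlg K X.V (Y.V ⊗ Z.V : ModuleCat.{u} K)) p (Ra := strands (repL Y.ρ Z.V)) (Rb := strands (repR Y.V Z.ρ)))
    refine (congrArg (e ≫ ·) this).trans (intertwine_nuRep (e := e) p (fun i a => ?_)
      (fun i a => ?_) n)
    · exact (associator_naturality_middle _ _ _).symm
    · exact (associator_naturality_right _ _ _).symm
  -- On a tensor product a strand acts by the sum of its actions on the factors, which gives the
  -- cables `b + c` here and `a + b` in `c₂`.
  have c₄ : ∀ n, e ≫ (fusionMu p X (Y ⊗ Z)).coeff n =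
      endCoeff (nuRep tg Φ p (strands F₁) (strands F₂ + strands F₃)) n ≫ e := by
    intro n
    refine intertwine_nuRep (e := e) p (fun i a => ?_) (fun i a => ?_) n
    · exact (associator_naturality_left _ _ _).symm
    · change e ≫ X.V ◁ ((Y.ρ _).asHom ▷ Z.V + Y.V ◁ (Z.ρ _).asHom) =
        ((X.V ◁ (Y.ρ _).asHom) ▷ Z.V + (X.V ⊗ Y.V) ◁ (Z.ρ _).asHom) ≫ e
      rw [MonoidalPreadditive.whiskerLeft_add, Preadditive.comp_add, Preadditive.add_comp,
        ← associator_naturality_middle, ← associator_naturality_right]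
  exact DrinfeldCat.hom_ext (conv_hexagon c₁ c₂ c₃ c₄ (assocSeries_nuRep p X Y Z))

/-- The unit coherence map of `F^p`. -/
noncomputable def fusionEps (p : ParMor I J) : 𝟙_ (FusionCat tg th Φ J) ⟶
    (fusionFunctor (tg := tg) (th := th) (Φ := Φ) p.map).obj (𝟙_ (FusionCat tg th Φ I)) :=
  DrinfeldCat.Hom.const (𝟙 (𝟙_ (ModuleCat.{u} K))) fun _ =>
    (Category.comp_id _).trans (Category.id_comp _).symm

lemma isIso_fusionEps (p : ParMor I J) : IsIso (fusionEps (tg := tg) (th := th) (Φ := Φ) p) := by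
  refine ⟨DrinfeldCat.Hom.const (𝟙 (𝟙_ (ModuleCat.{u} K))) fun _ =>
    (Category.comp_id _).trans (Category.id_comp _).symm, ?_, ?_⟩ <;>
  exact DrinfeldCat.hom_ext ((conv_cst_left _ _).trans (funext fun n => Category.id_comp _))

/-- All strands of the trivial module act by `0`. -/
lemma fusionMu_unit_left (p : ParMor I J) (X : FusionCat tg th Φ I) :
    (fusionMu p (𝟙_ _) X).coeff = cst (𝟙 (𝟙_ (ModuleCat.{u} K) ⊗ X.V)) := by
  have e : strands (repL (DrinfeldCat.unit (t := fusionTensor tg th I) (Φ := Φ)).ρ X.V) = 0 := by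
    funext i
    refine LinearMap.ext fun a => ?_
    change (0 : 𝟙_ (ModuleCat.{u} K) ⟶ _) ▷ X.V = 0
    exact MonoidalPreadditive.zero_whiskerRight
  have e' := (congrArg (fun R => nuRep tg Φ p R (strands (repR (𝟙_ (ModuleCat.{u} K)) X.ρ))) e).trans
    (nuRep_zero_left p)
  exact (congrArg endCoeff e').trans endCoeff_one

lemma fusionMu_unit_right (p : ParMor I J) (X : FusionCat tg th Φ I) :
    (fusionMu p X (𝟙_ _)).coeff = cst (𝟙 (X.V ⊗ 𝟙_ (ModuleCat.{u} K))) := by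
  have e : strands (repR X.V (DrinfeldCat.unit (t := fusionTensor tg th I) (Φ := Φ)).ρ) = 0 := by
    funext i
    refine LinearMap.ext fun a => ?_
    change X.V ◁ (0 : 𝟙_ (ModuleCat.{u} K) ⟶ _) = 0
    exact MonoidalPreadditive.whiskerLeft_zero
  have e' := (congrArg (nuRep tg Φ p (strands (repL X.ρ (𝟙_ (ModuleCat.{u} K))))) e).trans
    (nuRep_zero_right p)
  exact (congrArg endCoeff e').trans endCoeff_one

lemma fusion_left_unitality (p : ParMor I J) (X : FusionCat tg th Φ I) :
    (λ_ ((fusionFunctor p.map).obj X)).hom = fusionEps p ▷ (fusionFunctor p.map).obj X ≫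
      fusionMu p (𝟙_ _) X ≫ (fusionFunctor p.map).map (λ_ X).hom := by
  refine DrinfeldCat.hom_ext ?_
  have e : (fun n => cst (𝟙 (𝟙_ (ModuleCat.{u} K))) n ▷ X.V) =
      cst (𝟙 (𝟙_ (ModuleCat.{u} K) ⊗ X.V)) := by
    funext n
    unfold cst
    split_ifs <;> simp
  have key : conv (cst (𝟙 (𝟙_ (ModuleCat.{u} K) ⊗ X.V))) (conv (cst (𝟙 (𝟙_ (ModuleCat.{u} K) ⊗ X.V)))
      (cst (λ_ X.V).hom)) = cst (λ_ X.V).hom := by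
    rw [conv_cst_left, conv_cst_left]
    simp only [Category.id_comp]
  exact ((congrArg₂ conv e (congrArg (fun c => conv c (cst (λ_ X.V).hom))
    (fusionMu_unit_left p X))).trans key).symm

lemma fusion_right_unitality (p : ParMor I J) (X : FusionCat tg th Φ I) :
    (ρ_ ((fusionFunctor p.map).obj X)).hom = (fusionFunctor p.map).obj X ◁ fusionEps p ≫
      fusionMu p X (𝟙_ _) ≫ (fusionFunctor p.map).map (ρ_ X).hom := by
  refine DrinfeldCat.hom_ext ?_
  have e : (fun n => X.V ◁ cst (𝟙 (𝟙_ (ModuleCat.{u} K))) n) =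
      cst (𝟙 (X.V ⊗ 𝟙_ (ModuleCat.{u} K))) := by
    funext n
    unfold cst
    split_ifs <;> simp
  have key : conv (cst (𝟙 (X.V ⊗ 𝟙_ (ModuleCat.{u} K)))) (conv (cst (𝟙 (X.V ⊗ 𝟙_ (ModuleCat.{u} K))))
      (cst (ρ_ X.V).hom)) = cst (ρ_ X.V).hom := by
    rw [conv_cst_left, conv_cst_left]
    simp only [Category.id_comp]
  exact ((congrArg₂ conv e (congrArg (fun c => conv c (cst (ρ_ X.V).hom))
    (fusionMu_unit_right p X))).trans key).symm

variable (tg th Φ) in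
/-- Quantum fusion is monoidal. -/
noncomputable def fusionStructure (p : ParMor I J) : FusionStructure tg th Φ p where
  lax :=
    { ε := fusionEps p
      μ := fusionMu p
      μ_natural_left := fusionMu_natural_left p
      μ_natural_right := fusionMu_natural_right p
      associativity := fusionMu_associativity p
      left_unitality := fusion_left_unitality p
      right_unitality := fusion_right_unitality p }
  isIso_ε := isIso_fusionEps p
  isIso_μ := isIso_fusionMu p
  ε_coeff := rfl
  μ_coeff X Y := congrArg endCoeff (map_actTwo_nu p X Y).symm

end Structure

/-! ### The higher associators as monoidal transformations -/

section Transformation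

open PowerSeries (C coeff)
open MonoidalCategory

/-- Compatibility with `ν`, applied to zero actions, says that this series is idempotent. It is also
a unit, being inverse to the value of a reparenthesization in the opposite direction. This yields
the unit axiom for `Φ^{p,p'}`. -/
lemma higherRep_zero {K : Type u} [Field K] {I J : Type w} [Fintype J] {L : Type v} [LieRing L] [LieAlgebra K L] {A : Type*} [Ring A] [Algebra K A]
    {t : InvTensor K L}
    {Φ : DrinfeldAssociator K} {p p' : ParMor I J} (r : ∀ j, Reparen (p.paren j) (p'.paren j)) :
    higherRep t Φ r (0 : I → (L →ₗ[K] A)) = 1 := by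
  have hR : CommPair (0 : I → (L →ₗ[K] A)) 0 := by
    have h0 : CommFam (0 : I → (L →ₗ[K] A)) :=
      ⟨fun s a b => by simp, fun s s' _ a b => Commute.zero_left _⟩
    exact ⟨h0, h0, fun s s' a b => Commute.zero_left _⟩
  have key := nuRep_higherRep (t := t) (Φ := Φ) hR r
  rw [nuRep_zero_left, nuRep_zero_left, one_mul, mul_one, add_zero] at key
  obtain ⟨u, hu⟩ : IsUnit (higherRep t Φ r (0 : I → (L →ₗ[K] A))) := by
    obtain ⟨r'⟩ : Nonempty (∀ j, Reparen (p'.paren j) (p.paren j)) :=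
      ⟨fun j => (Reparen.nonempty (r j).leaves_eq t Φ).some⟩
    obtain ⟨s⟩ : Nonempty (∀ j, Reparen (p.paren j) (p.paren j)) :=
      ⟨fun j => (Reparen.nonempty rfl t Φ).some⟩
    obtain ⟨s'⟩ : Nonempty (∀ j, Reparen (p'.paren j) (p'.paren j)) :=
      ⟨fun j => (Reparen.nonempty rfl t Φ).some⟩
    exact ⟨⟨_, higherRep t Φ r' 0, (higherRep_comp hR.left r' r s').trans (higherRep_refl hR.left s'),
      (higherRep_comp hR.left r r' s).trans (higherRep_refl hR.left s)⟩, rfl⟩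
  rw [← hu] at key ⊢
  exact u.isUnit.mul_left_cancel (key.trans (mul_one _).symm)

variable {K : Type u} [Field K] {g : Type v} [LieRing g] [LieAlgebra K g]
  {h : Type x} [LieRing h] [LieAlgebra K h] {I J : Type w} [Fintype I] [Fintype J]
  {tg : InvTensor K g} {th : InvTensor K h} {Φ : DrinfeldAssociator K}

/-- The components of the higher associator. -/
noncomputable def higherApp {p p' : ParMor I J} (hp : p.map = p'.map)
    (r : ∀ j, Reparen (p.paren j) (p'.paren j)) (X : FusionCat tg th Φ I) :
    (fusionFunctor p.map).obj X ⟶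
      (fusionFunctor (tg := tg) (th := th) (Φ := Φ) p'.map).obj X :=
  serHom (ρ := X.ρ.comp (pullback p.map)) (σ := X.ρ.comp (pullback p'.map))
    (fun a => by rw [hp]) (higherRep tg Φ r (strands X.ρ)) (commute_higherOne r X)

variable (tg th Φ) in
/-- The higher associator as a natural transformation. -/
noncomputable def higherNat {p p' : ParMor I J} (hp : p.map = p'.map)
    (r : ∀ j, Reparen (p.paren j) (p'.paren j)) :
    fusionFunctor (tg := tg) (th := th) (Φ := Φ) p.map ⟶ fusionFunctor p'.map where
  app := higherApp hp r
  naturality X Y f := DrinfeldCat.hom_ext (conv_swap _ _ _ _ fun i j =>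
    intertwine_higherRep (e := f.coeff i) r (R := strands X.ρ) (R' := strands Y.ρ)
      (fun _ _ => (f.equivariant i _).symm) j)

lemma higherApp_unit {p p' : ParMor I J} (hp : p.map = p'.map)
    (r : ∀ j, Reparen (p.paren j) (p'.paren j)) :
    fusionEps p ≫ higherApp (tg := tg) (th := th) (Φ := Φ) hp r (𝟙_ _) = fusionEps p' := by
  refine DrinfeldCat.hom_ext ?_
  have e : strands (DrinfeldCat.unit (t := fusionTensor tg th I) (Φ := Φ)).ρ = 0 := rfl
  have e' := (congrArg (higherRep tg Φ r) e).trans (higherRep_zero r)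
  have e'' := (congrArg endCoeff e').trans endCoeff_one
  refine (conv_cst_left _ _).trans ((congrArg (fun c n => 𝟙 _ ≫ c n) e'').trans ?_)
  exact funext fun n => Category.id_comp _

lemma higherApp_tensor {p p' : ParMor I J} (hp : p.map = p'.map)
    (r : ∀ j, Reparen (p.paren j) (p'.paren j)) (X Y : FusionCat tg th Φ I) :
    fusionMu p X Y ≫ higherApp hp r (X ⊗ Y) =
      (higherApp hp r X ⊗ₘ higherApp hp r Y) ≫ fusionMu p' X Y := by
  -- This form of the tensor product applies the factor on `Y` first, which gives the order of the
  -- factors in `nuRep_higherRep`.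
  rw [tensorHom_def']
  refine DrinfeldCat.hom_ext ?_
  have e₁ : (fun n => (higherApp hp r X).coeff n ▷ Y.V) =
      endCoeff (higherRep tg Φ r (strands (repL X.ρ Y.V))) :=
    congrArg endCoeff (map_higherRep (rAlg K X.V Y.V) r)
  have e₂ : (fun n => X.V ◁ (higherApp hp r Y).coeff n) =
      endCoeff (higherRep tg Φ r (strands (repR X.V Y.ρ))) :=
    congrArg endCoeff (map_higherRep (lAlg K X.V Y.V) r)
  refine (conv_coeff _ _).trans (Eq.trans ?_ (congrArg₂ (fun a b => conv (conv a b) _) e₂ e₁).symm)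
  refine Eq.trans ?_ ((congrArg (conv · _) (conv_coeff _ _)).trans (conv_coeff _ _)).symm
  exact congrArg endCoeff (nuRep_higherRep (commPair_repL_repR X Y) r).symm

variable (tg th Φ) in
/-- The higher associator as a monoidal natural transformation. -/
noncomputable def higherHom {p p' : ParMor I J} (hp : p.map = p'.map)
    (r : ∀ j, Reparen (p.paren j) (p'.paren j)) :
    (fusionStructure tg th Φ p).functor ⟶ (fusionStructure tg th Φ p').functor :=
  MonFunctor.ofHom (F := (fusionStructure tg th Φ p).functor)
    (G := (fusionStructure tg th Φ p').functor) (higherNat tg th Φ hp r)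
    { unit := higherApp_unit hp r
      tensor := higherApp_tensor hp r }

/-- Coherence allows the reparenthesization chosen in the construction to be replaced by an
arbitrary one. -/
lemma isHigherAssoc_higherHom {p p' : ParMor I J} (hp : p.map = p'.map)
    (r : ∀ j, Reparen (p.paren j) (p'.paren j)) : IsHigherAssoc (higherHom tg th Φ hp r) := by
  refine ⟨⟨r⟩, fun r' X => ?_⟩
  rw [map_actOne_higherAssoc, higherRep_eq (commFam_strands X.ρ) r' r]
  rfl

lemma higherHom_comp {p p' p'' : ParMor I J} (hp : p.map = p'.map) (hp' : p'.map = p''.map)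
    (hp'' : p.map = p''.map) (r : ∀ j, Reparen (p.paren j) (p'.paren j))
    (r' : ∀ j, Reparen (p'.paren j) (p''.paren j)) (r'' : ∀ j, Reparen (p.paren j) (p''.paren j)) :
    higherHom tg th Φ hp r ≫ higherHom tg th Φ hp' r' = higherHom tg th Φ hp'' r'' := by
  refine MonFunctor.hom_ext fun X => DrinfeldCat.hom_ext ?_
  exact (conv_coeff _ _).trans (congrArg endCoeff (higherRep_comp (commFam_strands X.ρ) r r' r''))

lemma higherHom_refl {p : ParMor I J} (r : ∀ j, Reparen (p.paren j) (p.paren j)) :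
    higherHom tg th Φ rfl r = 𝟙 _ := by
  refine MonFunctor.hom_ext fun X => DrinfeldCat.hom_ext ?_
  exact (congrArg endCoeff (higherRep_refl (commFam_strands X.ρ) r)).trans endCoeff_one

lemma reparen_nonempty {I J : FSet.{w}} {p p' : ParMor I.carrier J.carrier} (α : p ⟶ p')
    (tg : InvTensor K g) (Φ : DrinfeldAssociator K) :
    Nonempty (∀ j, Reparen (p.paren j) (p'.paren j)) :=
  ⟨fun j => (Reparen.nonempty (by
    rw [p.leaves_paren, p'.leaves_paren, FSet.ordEq α]) tg Φ).some⟩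

variable (tg th Φ) in
/-- The monoidal natural transformation `Φ^{p,p'}`. -/
noncomputable def theta {I J : FSet.{w}} {p p' : ParMor I.carrier J.carrier} (α : p ⟶ p') :
    (fusionStructure tg th Φ p).functor ⟶ (fusionStructure tg th Φ p').functor :=
  higherHom tg th Φ (congrArg OrdMor.map (FSet.ordEq α)) (reparen_nonempty α tg Φ).some

lemma theta_comp {I J : FSet.{w}} {p p' p'' : ParMor I.carrier J.carrier} (α : p ⟶ p')
    (β : p' ⟶ p'') : theta tg th Φ (α ≫ β) = theta tg th Φ α ≫ theta tg th Φ β :=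
  (higherHom_comp _ _ _ _ _ _).symm

lemma theta_id {I J : FSet.{w}} (p : ParMor I.carrier J.carrier) :
    theta tg th Φ (𝟙 p) = 𝟙 _ := higherHom_refl _

/-- All 2-morphisms of the source are invertible, and the assignment is functorial. -/
lemma isIso_theta {I J : FSet.{w}} {p p' : ParMor I.carrier J.carrier} (α : p ⟶ p') :
    IsIso (theta tg th Φ α) := by
  let β : p' ⟶ p := FSet.homMk (FSet.ordEq α).symm
  exact ⟨theta tg th Φ β, (theta_comp α β).symm.trans (theta_id p),
    (theta_comp β α).symm.trans (theta_id p')⟩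

end Transformation

/-! ### Strict 2-functoriality -/

section TwoFunctor

open PowerSeries (C coeff)
open MonoidalCategory

variable {K : Type u} [Field K] {g : Type v} [LieRing g] [LieAlgebra K g]
  {h : Type x} [LieRing h] [LieAlgebra K h]
  {tg : InvTensor K g} {th : InvTensor K h} {Φ : DrinfeldAssociator K}

lemma functor_id (I : Type w) [Fintype I] :
    (fusionStructure tg th Φ (ParMor.id I)).functor = MonFunctor.idFunctor _ := by
  refine MonFunctor.ext_of rfl ?_ fun X Y => ?_
  · exact Category.comp_id _
  · refine (Category.comp_id _).trans (Eq.trans ?_ (Category.id_comp _).symm)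
    refine DrinfeldCat.hom_ext ?_
    exact (congrArg endCoeff (nuRep_id (t := tg) (Φ := Φ) (Ra := strands (repL X.ρ Y.V))
      (Rb := strands (repR X.V Y.ρ)))).trans endCoeff_one

/-- On `F^p X` the strands are the cables of the fibres of `p`, so this is `nuRep_comp`. -/
lemma fusionMu_comp {I J J' : Type w} [Fintype I] [Fintype J] [Fintype J'] (p : ParMor I J)
    (q : ParMor J J') (X Y : FusionCat tg th Φ I) : fusionMu (p.comp q) X Y =
      fusionMu q ((fusionFunctor p.map).obj X) ((fusionFunctor p.map).obj Y) ≫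
        (fusionFunctor q.map).map (fusionMu p X Y) := by
  refine DrinfeldCat.hom_ext ?_
  have e₁ := strands_pullback (repL X.ρ Y.V) p
  have e₂ := strands_pullback (repR X.V Y.ρ) p
  have e := nuRep_comp (t := tg) (Φ := Φ) p q (commPair_repL_repR X Y)
  rw [← e₁, ← e₂] at e
  exact (congrArg endCoeff e).trans (conv_coeff _ _).symm

lemma functor_comp {I J J' : Type w} [Fintype I] [Fintype J] [Fintype J'] (p : ParMor I J)
    (q : ParMor J J') : (fusionStructure tg th Φ (p.comp q)).functor =
      MonFunctor.compFunctor (fusionStructure tg th Φ p).functor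
        (fusionStructure tg th Φ q).functor := by
  refine MonFunctor.ext_of rfl ?_ fun X Y => ?_
  · refine (Category.comp_id _).trans (DrinfeldCat.hom_ext ?_)
    exact ((conv_cst_left _ _).trans (funext fun n => Category.id_comp _)).symm
  · exact (Category.comp_id _).trans ((fusionMu_comp p q X Y).trans (Category.id_comp _).symm)

/-- Reparenthesizing an outer word while the inner fibres are fixed is the same as reparenthesizing
it with the fibres as cables, which are the strands of `F^p X`. -/
lemma theta_whiskerLeft {I J J' : FSet.{w}} (p : ParMor I.carrier J.carrier)
    {q q' : ParMor J.carrier J'.carrier} (α : q ⟶ q')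
    (β : (p.comp q : ParMor I.carrier J'.carrier) ⟶ p.comp q')
    (X : FusionCat tg th Φ I.carrier) : (MonFunctor.nat (theta tg th Φ β)).app X =
      (MonFunctor.nat (theta tg th Φ α)).app ((fusionFunctor p.map).obj X) := by
  refine DrinfeldCat.hom_ext ?_
  have e := higherRep_whiskerLeft (t := tg) (Φ := Φ) p (commFam_strands X.ρ)
    (reparen_nonempty α tg Φ).some (reparen_nonempty β tg Φ).some
  rw [← strands_pullback] at e
  exact congrArg endCoeff e

lemma theta_whiskerRight {I J J' : FSet.{w}} {p p' : ParMor I.carrier J.carrier} (α : p ⟶ p')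
    (q : ParMor J.carrier J'.carrier)
    (β : (p.comp q : ParMor I.carrier J'.carrier) ⟶ p'.comp q)
    (X : FusionCat tg th Φ I.carrier) : (MonFunctor.nat (theta tg th Φ β)).app X =
      (fusionFunctor q.map).map ((MonFunctor.nat (theta tg th Φ α)).app X) :=
  DrinfeldCat.hom_ext (congrArg endCoeff (higherRep_whiskerRight (t := tg) (Φ := Φ) q
    (commFam_strands X.ρ) (reparen_nonempty α tg Φ).some (reparen_nonempty β tg Φ).some))

/-- Whiskering is compared up to transport along equalities of monoidal functors. On components this
is a transport of objects, which is trivial here because the functors agree on objects by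
definition. -/
lemma nat_eqToHom_conj {C : Type*} [Category* C] [MonoidalCategory C] {D : Type*} [Category* D]
    [MonoidalCategory D] {F F' G G' : MonFunctor C D} (e : F = F') (e' : G' = G) (τ : F' ⟶ G')
    (X : C) (hX : F.obj X = F'.obj X) (hX' : G'.obj X = G.obj X) :
    (MonFunctor.nat (eqToHom e ≫ τ ≫ eqToHom e')).app X =
      eqToHom hX ≫ (MonFunctor.nat τ).app X ≫ eqToHom hX' := by
  rw [MonFunctor.nat_comp, MonFunctor.nat_comp, MonFunctor.eqToHom_app_id,
    MonFunctor.eqToHom_app_id]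

variable (tg th Φ) in
/-- The quantum fusion 2-functor. -/
noncomputable def fusionTwoFunctor : StrictPseudofunctor FSet.{w} MonoidalCat :=
  StrictPseudofunctor.mk''
    { fusionData (fun p => fusionStructure tg th Φ p) (fun α => theta tg th Φ α) with
      map₂_id := fun p => theta_id p
      map₂_comp := fun α β => theta_comp α β
      map_id := fun I => functor_id I.carrier
      map_comp := fun p q => functor_comp p q
      map₂_whisker_left := fun p q q' α => by
        refine MonFunctor.hom_ext fun X => ?_
        refine Eq.trans ?_ (nat_eqToHom_conj (functor_comp p q) (functor_comp p q').symm _ X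
          rfl rfl).symm
        refine Eq.trans ?_ ((Category.id_comp _).trans (Category.comp_id _)).symm
        exact theta_whiskerLeft p α (Bicategory.whiskerLeft p α) X
      map₂_whisker_right := fun {_ _ _ p p'} α q => by
        refine MonFunctor.hom_ext fun X => ?_
        refine Eq.trans ?_ (nat_eqToHom_conj (functor_comp p q) (functor_comp p' q).symm _ X
          rfl rfl).symm
        refine Eq.trans ?_ ((Category.id_comp _).trans (Category.comp_id _)).symm
        exact theta_whiskerRight α q (Bicategory.whiskerRight α q) X }

end TwoFunctor

end QuantumFusion

theorem mainTheorem3 {K : Type u} [Field K] [CharZero K] {g : Type v} [LieRing g] [LieAlgebra K g]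
    {h : Type x} [LieRing h] [LieAlgebra K h] (tg : InvTensor K g) (th : InvTensor K h)
    (Φ : DrinfeldAssociator K) :
    ∃ (M : ∀ {I J : FSet.{w}} (p : ParMor I.carrier J.carrier), FusionStructure tg th Φ p)
      (Θ : ∀ {I J : FSet.{w}} {p p' : ParMor I.carrier J.carrier} (_ : p ⟶ p'),
        (M p).functor ⟶ (M p').functor)
      (F : StrictPseudofunctor FSet.{w} MonoidalCat),
      F.toPrelaxFunctorStruct = fusionData M Θ ∧
        ∀ {I J : FSet.{w}} {p p' : ParMor I.carrier J.carrier} (α : p ⟶ p'),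
          IsIso (Θ α) ∧ IsHigherAssoc (Θ α) :=
  -- The 2-functor was built as an extension of `fusionData`, so the equality of the data is
  -- definitional.
  ⟨fun p => fusionStructure tg th Φ p, fun α => theta tg th Φ α, fusionTwoFunctor tg th Φ, rfl,
    fun α => ⟨isIso_theta α, isHigherAssoc_higherHom _ _⟩⟩
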